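/- **Setting.** Let $\mathcal H,\mathcal H'$ be separable complex Hilbert spaces, $\Theta\subset\mathbb R^m$ open, and $\{\Lambda_\theta\}_{\theta\in\Theta}$ a family of completely positive trace preserving (CPTP) linear maps from the trace class operators on $\mathcal H$ to those on $\mathcal H'$. Put $\|\Lambda\|_{cb}=\sup\{\|(\Lambda\otimes\mathbf I_{\mathcal K})(X)\|_1:\|X\|_1=1\}$, the supremum being also over all separable $\mathcal K$. Assume (CM.1): $\partial_i\Lambda_\theta$ and $\partial_i\partial_j\Lambda_\theta$ exist in cb-norm for all $\theta\in\Theta$, are locally uniformly continuous in cb-norm, and $\|\partial_i\Lambda_\theta\|_{cb},\|\partial_i\partial_j\Lambda_\theta\|_{cb}\le a_1/2<\infty$ on $\Theta$. **Estimators.** An estimator $\mathcal E_n$ that uses $\Lambda_\theta$ $n\ge1$ times consists of a separable ancilla $\mathcal K$, an input state $\rho$ on $\mathcal H\otimes\mathcal K$, CPTP maps $\Xi_1,\dots,\Xi_{n-1}$ from trace class operators on $\mathcal H'\otimes\mathcal K$ to trace class operators on $\mathcal H\otimes\mathcal K$, a POVM $M$ on the Borel sets of some $\mathbb R^l$ acting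 in $\mathcal H'\otimes\mathcal K$, and a measurable $T:\mathbb R^l\to\mathbb R^m$. The data have distribution $P_\theta(\Delta)=\operatorname{tr}M(\Delta)\sigma_\theta$ with $$\sigma_\theta=(\Lambda_\theta\otimes\mathbf I)\,\Xi_{n-1}\,(\Lambda_\theta\otimes\mathbf I)\cdots\Xi_1\,(\Lambda_\theta\otimes\mathbf I)(\rho).$$ Let $\mathrm E_\theta$ be the expectation under $P_\theta$, $\mathrm{MSE}_\theta[\mathcal E_n]_{ij}=\mathrm E_\theta(T^i-\theta^i)(T^j-\theta^j)$, $\mathrm V_\theta[\mathcal E_n]$ the covariance matrix of $T$ under $P_\theta$, and $B_\theta[\mathcal E_n]^i_j=\partial_j\mathrm E_\theta[T^i]$. * $\mathcal E_n$ is *locally unbiased at $\theta$* if the partial derivatives $\partial_j\mathrm E_\theta[T^i]$ exist at $\theta$, $\mathrm E_\theta[T]=\theta$ and $B_\theta[\mathcal E_n]=\mathbf 1$. * A sequence $(\mathcal E_n)_{n\ge1}$ is *asymptotically unbiased* if, for every $\theta\in\Theta$, these derivatives exist, $\mathrm E_\theta[T_n]\to\theta$ and $B_\theta[\mathcal E_n]\to\mathbf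 1$. * (CE) There are a constant $a_{4,n}\ge 0$ and, for all $i$ and $\theta\in\Theta$, a completely positive map $\square_{i,\theta}$ such that $\square_{i,\theta}-\partial_i\Lambda_{\theta_0}$ is completely positive for all $\theta_0\in\Theta$ that differ from $\theta$ only in the $i$-th coordinate, by less than some $r_{i,\theta}>0$, such that for all $i$ and $\theta\in\Theta$ $$\int\|T-\theta\|\operatorname{tr}\varpi_{i,\theta}M(d\omega)\le n a_1a_{4,n},\qquad \mathrm E_\theta\|T-\theta\|^2\le n a_{4,n}^2,$$ where $\varpi_{i,\theta}$ is the sum, over $k=1,\dots,n$, of the operators obtained from the above expression for $\sigma_\theta$ by replacing the $k$-th occurrence of $\Lambda_\theta$ by $\square_{i,\theta}$. * (E') $T$ takes values in a set of finite diameter. For $\theta\in\Theta$ and a real symmetric positive semidefinite $m\times m$ matrix $G_\theta$, let $$C^{Q,Op}_\theta(G_\theta,\mathcal L)=\inf\Big\{\varlimsup_{n\to\infty}n\operatorname{Tr}G_\theta\mathrm{MSE}_\theta[\mathcal E_n]\;;\;(\mathcal E_n)_n\text{ asymptotically unbiased, each }\mathcal E_n\text{ satisfying (CE)}\Big\},$$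 where $\inf\emptyset=\infty$. **Theorem.** If (CM.1) holds, then for every $\theta\in\Theta$ the limit on the right-hand side exists in $[0,\infty]$, and $$C^{Q,Op}_\theta(G_\theta,\mathcal L)\;\ge\;\lim_{n\to\infty}\inf\big\{n\operatorname{Tr}G_\theta\mathrm V_\theta[\mathcal E_{\theta,n}]\;;\;\mathcal E_{\theta,n}\text{ uses }\Lambda_\theta\ n\text{ times, is locally unbiased at }\theta\text{ and satisfies (E')}\big\}.$$ -/

import Mathlib

open Filter Topology MeasureTheory
open scoped ENNReal TensorProduct

universe u

noncomputable section

namespace QOpEstimation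

/-! ## Trace class operators -/

section TraceClass

variable {H : Type u} [NormedAddCommGroup H] [InnerProductSpace ℂ H]

/-- The trace norm `‖A‖₁ = tr |A|`, with values in `[0, ∞]`, in its variational form: the supremum of
`∑ i, |⟨e i, A (f i)⟩|` over all pairs of finite orthonormal families `e`, `f` of equal length. -/
def traceNorm (A : H →L[ℂ] H) : ℝ≥0∞ :=
  ⨆ (N : ℕ) (e : Fin N → H) (f : Fin N → H) (_ : Orthonormal ℂ e) (_ : Orthonormal ℂ f),
    ∑ i, ‖inner ℂ (e i) (A (f i))‖ₑ

theorem sum_le_traceNorm (A : H →L[ℂ] H) {N : ℕ} {e f : Fin N → H}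
    (he : Orthonormal ℂ e) (hf : Orthonormal ℂ f) :
    ∑ i, ‖inner ℂ (e i) (A (f i))‖ₑ ≤ traceNorm A :=
  le_iSup_of_le N <| le_iSup_of_le e <| le_iSup_of_le f <| le_iSup_of_le he <|
    le_iSup_of_le hf le_rfl

theorem traceNorm_le {A : H →L[ℂ] H} {c : ℝ≥0∞}
    (h : ∀ (N : ℕ) (e f : Fin N → H), Orthonormal ℂ e → Orthonormal ℂ f →
      ∑ i, ‖inner ℂ (e i) (A (f i))‖ₑ ≤ c) : traceNorm A ≤ c :=
  iSup_le fun N => iSup_le fun e => iSup_le fun f => iSup_le fun he => iSup_le fun hf =>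
    h N e f he hf

variable (H) in
/-- The space of trace class operators on `H`. -/
def TC : Submodule ℂ (H →L[ℂ] H) where
  carrier := {A | traceNorm A < ⊤}
  add_mem' := by
    intro A B hA hB
    refine lt_of_le_of_lt (traceNorm_le (c := traceNorm A + traceNorm B) ?_)
      (ENNReal.add_lt_top.2 ⟨hA, hB⟩)
    intro N e f he hf
    calc ∑ i, ‖inner ℂ (e i) ((A + B) (f i))‖ₑ
        ≤ ∑ i, (‖inner ℂ (e i) (A (f i))‖ₑ + ‖inner ℂ (e i) (B (f i))‖ₑ) := by
          refine Finset.sum_le_sum fun i _ => ?_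
          rw [_root_.add_apply, inner_add_right]
          exact enorm_add_le _ _
      _ ≤ traceNorm A + traceNorm B := by
          rw [Finset.sum_add_distrib]
          exact add_le_add (sum_le_traceNorm A he hf) (sum_le_traceNorm B he hf)
  zero_mem' := by
    refine lt_of_le_of_lt (traceNorm_le (c := 0) ?_) ENNReal.zero_lt_top
    intro N e f _ _
    simp
  smul_mem' := by
    intro c A hA
    refine lt_of_le_of_lt (traceNorm_le (c := ‖c‖ₑ * traceNorm A) ?_)
      (ENNReal.mul_lt_top enorm_lt_top hA)
    intro N e f he hf
    calc ∑ i, ‖inner ℂ (e i) ((c • A) (f i))‖ₑ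
        = ‖c‖ₑ * ∑ i, ‖inner ℂ (e i) (A (f i))‖ₑ := by
          rw [Finset.mul_sum]
          refine Finset.sum_congr rfl fun i _ => ?_
          rw [_root_.smul_apply, inner_smul_right, enorm_mul]
      _ ≤ ‖c‖ₑ * traceNorm A := by
          gcongr
          exact sum_le_traceNorm A he hf

variable [CompleteSpace H]

/-- The trace `∑ b, ⟨b, A b⟩` over an orthonormal basis of `H`; for trace class `A` the sum converges
absolutely and does not depend on the basis. -/
def trace (A : H →L[ℂ] H) : ℂ :=
  ∑' i, inner ℂ ((exists_hilbertBasis ℂ H).choose_spec.choose i)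
    (A ((exists_hilbertBasis ℂ H).choose_spec.choose i))

end TraceClass

/-! ## Composite systems, ampliations, complete positivity and the cb-norm -/

/-- The Hilbert space tensor product. -/
abbrev HTensor (H K : Type u) [NormedAddCommGroup H] [InnerProductSpace ℂ H]
    [NormedAddCommGroup K] [InnerProductSpace ℂ K] : Type u :=
  UniformSpace.Completion (H ⊗[ℂ] K)

section Ampliation

set_option linter.unusedSectionVars false

variable {H H' K : Type u}
  [NormedAddCommGroup H] [InnerProductSpace ℂ H] [CompleteSpace H]
  [NormedAddCommGroup H'] [InnerProductSpace ℂ H'] [CompleteSpace H']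
  [NormedAddCommGroup K] [InnerProductSpace ℂ K] [CompleteSpace K]

variable (H) in
/-- The operator `h ↦ h ⊗ x` from `H` to `H ⊗ K`. -/
def tensorRight (x : K) : H →L[ℂ] HTensor H K :=
  (UniformSpace.Completion.toComplL (𝕜 := ℂ) (E := H ⊗[ℂ] K)).comp
    ((TensorProduct.mkL ℂ H K).flip x)

/-- The partial matrix element `(1 ⊗ ⟨x|) X (1 ⊗ |y⟩)` of an operator `X` on `H ⊗ K`. -/
def sliceOp (x y : K) (X : HTensor H K →L[ℂ] HTensor H K) : H →L[ℂ] H :=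
  (ContinuousLinearMap.adjoint (tensorRight H x)).comp (X.comp (tensorRight H y))

theorem tensorRight_apply (x : K) (h : H) :
    tensorRight H x h = ((h ⊗ₜ[ℂ] x : H ⊗[ℂ] K) : HTensor H K) := rfl

theorem orthonormal_tensorRight {x : K} (hx : ‖x‖ = 1) {N : ℕ} {e : Fin N → H}
    (he : Orthonormal ℂ e) : Orthonormal ℂ fun i => tensorRight H x (e i) := by
  rw [orthonormal_iff_ite] at he ⊢
  intro i j
  rw [tensorRight_apply, tensorRight_apply, UniformSpace.Completion.inner_coe,
    TensorProduct.inner_tmul, he i j, inner_self_eq_norm_sq_to_K, hx]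
  simp

theorem traceNorm_sliceOp_lt_top (x y : K) (X : TC (HTensor H K)) :
    traceNorm (sliceOp x y (X : HTensor H K →L[ℂ] HTensor H K)) < ⊤ := by
  rcases eq_or_ne x 0 with rfl | hx
  · refine lt_of_le_of_lt (traceNorm_le (c := 0) ?_) ENNReal.zero_lt_top
    intro N e f _ _
    simp [sliceOp, ContinuousLinearMap.adjoint_inner_right, tensorRight_apply,
      UniformSpace.Completion.coe_zero]
  rcases eq_or_ne y 0 with rfl | hy
  · refine lt_of_le_of_lt (traceNorm_le (c := 0) ?_) ENNReal.zero_lt_top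
    intro N e f _ _
    simp [sliceOp, tensorRight_apply,
      UniformSpace.Completion.coe_zero]
  have scale : ∀ z : K, z ≠ 0 → ∀ h : H,
      tensorRight H z h = (‖z‖ : ℂ) • tensorRight H ((‖z‖⁻¹ : ℂ) • z) h := by
    intro z hz h
    have hz' : (‖z‖ : ℂ) ≠ 0 := by simpa using hz
    simp only [tensorRight_apply, TensorProduct.tmul_smul, UniformSpace.Completion.coe_smul]
    rw [smul_smul, mul_inv_cancel₀ hz', one_smul]
  have unit : ∀ z : K, z ≠ 0 → ‖(‖z‖⁻¹ : ℂ) • z‖ = 1 := by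
    intro z hz
    rw [norm_smul]
    simp [hz]
  refine lt_of_le_of_lt (traceNorm_le
    (c := ‖(‖x‖ : ℂ)‖ₑ * ‖(‖y‖ : ℂ)‖ₑ * traceNorm (X : HTensor H K →L[ℂ] HTensor H K)) ?_)
    (ENNReal.mul_lt_top (ENNReal.mul_lt_top enorm_lt_top enorm_lt_top) X.2)
  intro N e f he hf
  have := sum_le_traceNorm (X : HTensor H K →L[ℂ] HTensor H K)
    (orthonormal_tensorRight (unit x hx) he) (orthonormal_tensorRight (unit y hy) hf)
  refine le_trans (le_of_eq ?_) (mul_le_mul_right this _)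
  rw [Finset.mul_sum]
  refine Finset.sum_congr rfl fun i _ => ?_
  simp only [sliceOp, ContinuousLinearMap.comp_apply, ContinuousLinearMap.adjoint_inner_right]
  rw [scale x hx (e i), scale y hy (f i), map_smul, inner_smul_left, inner_smul_right, enorm_mul,
    enorm_mul, ← mul_assoc]
  simp

/-- `sliceOp` as a map between trace class operators. -/
def slice (x y : K) (X : TC (HTensor H K)) : TC H :=
  ⟨sliceOp x y X, traceNorm_sliceOp_lt_top x y X⟩

/-- `Y = (Λ ⊗ 1)(X)`, expressed by matrix elements with respect to the second tensor factor (they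
determine `Y`). -/
def IsAmpl (Λ : TC H →ₗ[ℂ] TC H') (X : TC (HTensor H K)) (Y : TC (HTensor H' K)) : Prop :=
  ∀ x y : K, slice x y Y = Λ (slice x y X)

open Classical in
/-- The operator `(Λ ⊗ 1)(X)` (it exists for all `X` as soon as `Λ` is completely bounded). -/
def ampl (Λ : TC H →ₗ[ℂ] TC H') (X : TC (HTensor H K)) : TC (HTensor H' K) :=
  if h : ∃ Y : TC (HTensor H' K), IsAmpl Λ X Y then h.choose else 0

/-- Complete positivity: for every ancilla `K`, `Λ ⊗ 1` maps positive trace class operators on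
`H ⊗ K` to positive trace class operators on `H' ⊗ K`. -/
def IsCP (Λ : TC H →ₗ[ℂ] TC H') : Prop :=
  ∀ (K : Type u) [NormedAddCommGroup K] [InnerProductSpace ℂ K] [CompleteSpace K]
    [TopologicalSpace.SeparableSpace K] (X : TC (HTensor H K)),
    (X : HTensor H K →L[ℂ] HTensor H K).IsPositive →
      ∃ Y : TC (HTensor H' K), IsAmpl Λ X Y ∧ (Y : HTensor H' K →L[ℂ] HTensor H' K).IsPositive

/-- Completely positive and trace preserving maps. -/
structure IsCPTP (Λ : TC H →ₗ[ℂ] TC H') : Prop where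
  cp : IsCP Λ
  tp : ∀ X : TC H, trace (Λ X : H' →L[ℂ] H') = trace (X : H →L[ℂ] H)

/-- The cb-norm `sup {‖(Λ ⊗ 1)(X)‖₁ : ‖X‖₁ = 1}`, the supremum being over all ancillas; it is `∞` if
some `(Λ ⊗ 1)(X)` does not exist as a trace class operator. -/
def cbNorm (Λ : TC H →ₗ[ℂ] TC H') : ℝ≥0∞ :=
  ⨆ (K : Type u) (_ : NormedAddCommGroup K) (_ : InnerProductSpace ℂ K) (_ : CompleteSpace K)
    (_ : TopologicalSpace.SeparableSpace K) (X : TC (HTensor H K))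
    (_ : traceNorm (X : HTensor H K →L[ℂ] HTensor H K) = 1),
    ⨅ (Y : TC (HTensor H' K)) (_ : IsAmpl Λ X Y), traceNorm (Y : HTensor H' K →L[ℂ] HTensor H' K)

end Ampliation

/-! ## Differentiable families of maps -/

section Families

variable {H H' : Type u}
  [NormedAddCommGroup H] [InnerProductSpace ℂ H] [CompleteSpace H]
  [NormedAddCommGroup H'] [InnerProductSpace ℂ H'] [CompleteSpace H']
  {m : ℕ}

/-- `D` is the partial derivative of the family `Λ` in direction `i` at `θ`, in cb-norm. -/
def HasPartial (Λ : EuclideanSpace ℝ (Fin m) → (TC H →ₗ[ℂ] TC H')) (i : Fin m)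
    (θ : EuclideanSpace ℝ (Fin m)) (D : TC H →ₗ[ℂ] TC H') : Prop :=
  Tendsto (fun t : ℝ =>
    cbNorm (((t : ℂ)⁻¹) • (Λ (θ + t • EuclideanSpace.single i 1) - Λ θ) - D)) (𝓝[≠] 0) (𝓝 0)

open Classical in
/-- The partial derivative `∂ᵢ Λ_θ` in cb-norm (`0` if it does not exist). -/
def partialDeriv (Λ : EuclideanSpace ℝ (Fin m) → (TC H →ₗ[ℂ] TC H')) (i : Fin m)
    (θ : EuclideanSpace ℝ (Fin m)) : TC H →ₗ[ℂ] TC H' :=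
  if h : ∃ D, HasPartial Λ i θ D then h.choose else 0

/-- Local uniform continuity on `Θ` with respect to the cb-norm. -/
def LocallyUniformlyContinuous (Θ : Set (EuclideanSpace ℝ (Fin m)))
    (F : EuclideanSpace ℝ (Fin m) → (TC H →ₗ[ℂ] TC H')) : Prop :=
  ∀ θ ∈ Θ, ∃ U ∈ 𝓝 θ, ∀ ε : ℝ≥0∞, 0 < ε → ∃ δ : ℝ, 0 < δ ∧
    ∀ x ∈ U ∩ Θ, ∀ y ∈ U ∩ Θ, dist x y < δ → cbNorm (F x - F y) < ε

/-- The regularity condition on the model: first and second partial derivatives exist in cb-norm on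
`Θ`, are locally uniformly continuous, and are bounded by `a₁ / 2` in cb-norm. -/
structure RegularFamily (Θ : Set (EuclideanSpace ℝ (Fin m))) (a₁ : ℝ)
    (Λ : EuclideanSpace ℝ (Fin m) → (TC H →ₗ[ℂ] TC H')) : Prop where
  exists_partial : ∀ i, ∀ θ ∈ Θ, ∃ D, HasPartial Λ i θ D
  exists_partial₂ : ∀ i j, ∀ θ ∈ Θ, ∃ D, HasPartial (partialDeriv Λ j) i θ D
  cont : ∀ i, LocallyUniformlyContinuous Θ (partialDeriv Λ i)
  cont₂ : ∀ i j, LocallyUniformlyContinuous Θ (partialDeriv (partialDeriv Λ j) i)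
  bound : ∀ i, ∀ θ ∈ Θ, cbNorm (partialDeriv Λ i θ) ≤ ENNReal.ofReal (a₁ / 2)
  bound₂ : ∀ i j, ∀ θ ∈ Θ,
    cbNorm (partialDeriv (partialDeriv Λ j) i θ) ≤ ENNReal.ofReal (a₁ / 2)

/-- `sq i θ` is a completely positive majorant of `∂ᵢ Λ_θ₀` for all `θ₀` of the model that differ from
`θ` only in the `i`-th coordinate, by less than some `r > 0`. -/
def IsMajorant (Θ : Set (EuclideanSpace ℝ (Fin m)))
    (Λ : EuclideanSpace ℝ (Fin m) → (TC H →ₗ[ℂ] TC H'))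
    (sq : Fin m → EuclideanSpace ℝ (Fin m) → (TC H →ₗ[ℂ] TC H')) : Prop :=
  ∀ i, ∀ θ ∈ Θ, IsCP (sq i θ) ∧ ∃ r : ℝ, 0 < r ∧ ∀ t : ℝ, |t| < r →
    θ + t • EuclideanSpace.single i 1 ∈ Θ →
      IsCP (sq i θ - partialDeriv Λ i (θ + t • EuclideanSpace.single i 1))

end Families

/-! ## Measurements and estimators -/

/-- Positive operator valued measures on the Borel sets of `ℝˡ`, countably additive in the weak
operator topology. -/
structure POVM (l : ℕ) (L : Type u) [NormedAddCommGroup L] [InnerProductSpace ℂ L]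
    [CompleteSpace L] where
  effect : Set (EuclideanSpace ℝ (Fin l)) → (L →L[ℂ] L)
  isPositive : ∀ Δ, MeasurableSet Δ → (effect Δ).IsPositive
  effect_univ : effect Set.univ = 1
  hasSum_effect : ∀ A : ℕ → Set (EuclideanSpace ℝ (Fin l)), (∀ i, MeasurableSet (A i)) →
    Pairwise (fun i j => Disjoint (A i) (A j)) →
      ∀ x y : L, HasSum (fun i => inner ℂ x (effect (A i) y)) (inner ℂ x (effect (⋃ i, A i) y))

open Classical in
/-- The measure `Δ ↦ tr M(Δ) X`, for a positive trace class operator `X`. -/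
def POVM.law {l : ℕ} {L : Type u} [NormedAddCommGroup L] [InnerProductSpace ℂ L]
    [CompleteSpace L] (M : POVM l L) (X : TC L) : Measure (EuclideanSpace ℝ (Fin l)) :=
  if h : ∃ μ : Measure (EuclideanSpace ℝ (Fin l)), ∀ Δ, MeasurableSet Δ →
      μ Δ = ENNReal.ofReal (trace ((M.effect Δ).comp (X : L →L[ℂ] L))).re
  then h.choose else 0

/-- An estimation scheme: an ancilla `K`, an input state on `H ⊗ K`, operations `Ξ k` (the one applied
between use number `k + 1` and use number `k + 2` of the unknown map), a measurement of the final
state on `H' ⊗ K`, and the estimate as a function of the data. -/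
structure Estimator (H H' : Type u)
    [NormedAddCommGroup H] [InnerProductSpace ℂ H] [CompleteSpace H]
    [NormedAddCommGroup H'] [InnerProductSpace ℂ H'] [CompleteSpace H'] (m : ℕ) where
  K : Type u
  [normed : NormedAddCommGroup K]
  [innerProd : InnerProductSpace ℂ K]
  [complete : CompleteSpace K]
  [separable : TopologicalSpace.SeparableSpace K]
  ρ : TC (HTensor H K)
  ρ_pos : (ρ : HTensor H K →L[ℂ] HTensor H K).IsPositive
  ρ_trace : trace (ρ : HTensor H K →L[ℂ] HTensor H K) = 1
  Ξ : ℕ → (TC (HTensor H' K) →ₗ[ℂ] TC (HTensor H K))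
  Ξ_cptp : ∀ k, IsCPTP (Ξ k)
  l : ℕ
  M : POVM l (HTensor H' K)
  T : EuclideanSpace ℝ (Fin l) → EuclideanSpace ℝ (Fin m)
  measurable_T : Measurable T

namespace Estimator

variable {H H' : Type u}
  [NormedAddCommGroup H] [InnerProductSpace ℂ H] [CompleteSpace H]
  [NormedAddCommGroup H'] [InnerProductSpace ℂ H'] [CompleteSpace H']
  {m : ℕ}

attribute [instance] normed innerProd complete separable

/-- The operator obtained after `n + 1` uses, if the map `A k` is applied at use number `k + 1`. -/
def run (E : Estimator H H' m) (A : ℕ → (TC H →ₗ[ℂ] TC H')) : ℕ → TC (HTensor H' E.K)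
  | 0 => ampl (A 0) E.ρ
  | n + 1 => ampl (A (n + 1)) (E.Ξ n (E.run A n))

/-- The state after `n ≥ 1` uses of `Λ`. -/
def output (E : Estimator H H' m) (Λ : TC H →ₗ[ℂ] TC H') (n : ℕ) : TC (HTensor H' E.K) :=
  E.run (fun _ => Λ) (n - 1)

/-- The result of replacing, by `sq`, the derivative in the Leibniz expansion of the derivative of
the output after `n ≥ 1` uses: the sum over `k < n` of the outputs in which use number `k + 1` of `Λ`
is replaced by `sq`. -/
def leibnizOutput (E : Estimator H H' m) (Λ sq : TC H →ₗ[ℂ] TC H') (n : ℕ) :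
    TC (HTensor H' E.K) :=
  ∑ k ∈ Finset.range n, E.run (Function.update (fun _ => Λ) k sq) (n - 1)

/-- The probability distribution of the data after `n` uses of `Λ`. -/
def P (E : Estimator H H' m) (Λ : TC H →ₗ[ℂ] TC H') (n : ℕ) :
    Measure (EuclideanSpace ℝ (Fin E.l)) :=
  E.M.law (E.output Λ n)

/-- The expectation of the `i`-th component of the estimate. -/
def mean (E : Estimator H H' m) (Λ : TC H →ₗ[ℂ] TC H') (n : ℕ) (i : Fin m) : ℝ :=
  ∫ ω, E.T ω i ∂(E.P Λ n)

/-- The mean square error matrix of the estimate of `θ`. -/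
def MSE (E : Estimator H H' m) (Λ : TC H →ₗ[ℂ] TC H') (n : ℕ) (θ : EuclideanSpace ℝ (Fin m)) :
    Matrix (Fin m) (Fin m) ℝ :=
  Matrix.of fun i j => ∫ ω, (E.T ω i - θ i) * (E.T ω j - θ j) ∂(E.P Λ n)

/-- The covariance matrix of the estimate. -/
def V (E : Estimator H H' m) (Λ : TC H →ₗ[ℂ] TC H') (n : ℕ) : Matrix (Fin m) (Fin m) ℝ :=
  Matrix.of fun i j => ∫ ω, (E.T ω i - E.mean Λ n i) * (E.T ω j - E.mean Λ n j) ∂(E.P Λ n)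

/-- The partial derivatives of the expectation of the estimate exist at `θ`. -/
def MeanDifferentiable (E : Estimator H H' m)
    (Λ : EuclideanSpace ℝ (Fin m) → (TC H →ₗ[ℂ] TC H')) (n : ℕ)
    (θ : EuclideanSpace ℝ (Fin m)) : Prop :=
  ∀ i j, DifferentiableAt ℝ (fun t : ℝ => E.mean (Λ (θ + t • EuclideanSpace.single j 1)) n i) 0

/-- The matrix `B` with entries `B i j = ∂ⱼ E_θ[Tⁱ]`. -/
def B (E : Estimator H H' m) (Λ : EuclideanSpace ℝ (Fin m) → (TC H →ₗ[ℂ] TC H')) (n : ℕ)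
    (θ : EuclideanSpace ℝ (Fin m)) : Matrix (Fin m) (Fin m) ℝ :=
  Matrix.of fun i j =>
    deriv (fun t : ℝ => E.mean (Λ (θ + t • EuclideanSpace.single j 1)) n i) 0

/-- Local unbiasedness at `θ` after `n` uses. -/
structure LocallyUnbiased (E : Estimator H H' m)
    (Λ : EuclideanSpace ℝ (Fin m) → (TC H →ₗ[ℂ] TC H')) (n : ℕ)
    (θ : EuclideanSpace ℝ (Fin m)) : Prop where
  differentiable : E.MeanDifferentiable Λ n θ
  mean_eq : ∀ i, E.mean (Λ θ) n i = θ i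
  B_eq : E.B Λ n θ = 1

/-- The estimate takes values in a set of finite diameter. -/
def BoundedRange (E : Estimator H H' m) : Prop :=
  Bornology.IsBounded (Set.range E.T)

/-- The integrability condition on an estimator that uses the unknown map `n` times: with some
constant `a₄` and some family `sq` of majorants of the derivatives of the model,
`∫ ‖T - θ‖ d tr(ϖ M) ≤ n a₁ a₄`, where `ϖ = leibnizOutput`, and `E_θ ‖T - θ‖² ≤ n a₄²`, for all `θ`
in `Θ`. -/
def IntegrabilityCondition (E : Estimator H H' m) (Θ : Set (EuclideanSpace ℝ (Fin m))) (a₁ : ℝ)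
    (Λ : EuclideanSpace ℝ (Fin m) → (TC H →ₗ[ℂ] TC H')) (n : ℕ) : Prop :=
  ∃ a₄ : ℝ, 0 ≤ a₄ ∧ ∃ sq : Fin m → EuclideanSpace ℝ (Fin m) → (TC H →ₗ[ℂ] TC H'),
    IsMajorant Θ Λ sq ∧ ∀ θ ∈ Θ,
      (∀ i, ∫⁻ ω, ‖E.T ω - θ‖ₑ ∂(E.M.law (E.leibnizOutput (Λ θ) (sq i θ) n))
        ≤ ENNReal.ofReal (n * a₁ * a₄)) ∧
      ∫⁻ ω, ‖E.T ω - θ‖ₑ ^ 2 ∂(E.P (Λ θ) n) ≤ ENNReal.ofReal (n * a₄ ^ 2)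

end Estimator

section Bounds

variable {H H' : Type u}
  [NormedAddCommGroup H] [InnerProductSpace ℂ H] [CompleteSpace H]
  [NormedAddCommGroup H'] [InnerProductSpace ℂ H'] [CompleteSpace H']
  {m : ℕ}

/-- Asymptotic unbiasedness of a sequence of estimators, the `n`-th of which uses the map `n` times:
`E_θ[T_n] → θ` and `B_θ[E_n] → 1` for all `θ` in `Θ`. -/
structure AsymptoticallyUnbiased (Θ : Set (EuclideanSpace ℝ (Fin m)))
    (Λ : EuclideanSpace ℝ (Fin m) → (TC H →ₗ[ℂ] TC H')) (E : ℕ → Estimator H H' m) : Prop where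
  differentiable : ∀ n, 1 ≤ n → ∀ θ ∈ Θ, (E n).MeanDifferentiable Λ n θ
  tendsto_mean : ∀ θ ∈ Θ, ∀ i, Tendsto (fun n => (E n).mean (Λ θ) n i) atTop (𝓝 (θ i))
  tendsto_B : ∀ θ ∈ Θ, ∀ i j,
    Tendsto (fun n => (E n).B Λ n θ i j) atTop (𝓝 ((1 : Matrix (Fin m) (Fin m) ℝ) i j))

/-- The asymptotic Cramér-Rao type bound for operation estimation: the infimum of
`limsup n Tr G MSE_θ[E_n]` over asymptotically unbiased sequences that satisfy the integrability
condition. -/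
def CQOp (Θ : Set (EuclideanSpace ℝ (Fin m))) (a₁ : ℝ)
    (Λ : EuclideanSpace ℝ (Fin m) → (TC H →ₗ[ℂ] TC H')) (G : Matrix (Fin m) (Fin m) ℝ)
    (θ : EuclideanSpace ℝ (Fin m)) : ℝ≥0∞ :=
  ⨅ (E : ℕ → Estimator H H' m) (_ : AsymptoticallyUnbiased Θ Λ E)
    (_ : ∀ n, 1 ≤ n → (E n).IntegrabilityCondition Θ a₁ Λ n),
    limsup (fun n : ℕ => ENNReal.ofReal (n * (G * (E n).MSE (Λ θ) n θ).trace)) atTop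

/-- The infimum of `n Tr G V_θ` over the estimators that use the map `n` times, are locally unbiased
at `θ`, and take values in a set of finite diameter. -/
def localBound (Λ : EuclideanSpace ℝ (Fin m) → (TC H →ₗ[ℂ] TC H'))
    (G : Matrix (Fin m) (Fin m) ℝ) (θ : EuclideanSpace ℝ (Fin m)) (n : ℕ) : ℝ≥0∞ :=
  ⨅ (E : Estimator H H' m) (_ : E.LocallyUnbiased Λ n θ) (_ : E.BoundedRange),
    ENNReal.ofReal (n * (G * E.V (Λ θ) n).trace)

end Bounds

end QOpEstimation

end

noncomputable section

namespace QOpEstimation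

open ContinuousLinearMap (adjoint)

set_option linter.unusedSectionVars false

/-! ## The trace norm -/

section TraceNorm

variable {H L E F : Type u} [NormedAddCommGroup H] [InnerProductSpace ℂ H]
  [NormedAddCommGroup L] [InnerProductSpace ℂ L]
  [NormedAddCommGroup E] [InnerProductSpace ℂ E] [NormedAddCommGroup F] [InnerProductSpace ℂ F]

/-! Both sides are compared with one number, `schemeBound`: the infimum of `n Tr G V` over all `n ≥
1` and all finite-outcome schemes with `n` uses, covariance `V` at `θ`, and mean with derivative
matrix `1` at `θ`. A constant shift of the estimates makes such a scheme locally unbiased and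
changes neither derivatives nor covariance, so only the pair `(B, V)` of derivatives and covariance
matters (`Achieves`). Linear post-processing turns it into `(C B, C V Cᵀ)`; running two schemes in
succession and adding their estimates adds the pairs and the numbers of uses (`Achieves.add`). The
succession is again a scheme because one ancilla can hold a register for the first scheme and, for
each of its outcomes, a register for the second; the occupied register remembers the outcome
(`exists_compose`).

The local bounds converge to `schemeBound`. Averaging `q` repetitions of a scheme with `n₀` uses
divides `V` by `q` at the price of `q n₀` uses, so `n Tr G V` is preserved up to rounding
(`limsup_localBound_le`). Conversely every bounded locally unbiased estimator is a limit of finite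
schemes, so no local bound with `n ≥ 1` lies below `schemeBound` (`schemeBound_le_localBound`).

For an asymptotically unbiased sequence, `MSE` dominates `V`, and it remains to repair the
derivatives `B_n`, which only tend to `1`. Multiplying by `B_n⁻¹` is not safe: `G` may be
degenerate, and then `n Tr G V` does not control the variance in the kernel of `G`. Instead the
missing part `1 - B_n` is supplied by `k = ⌈ε n⌉` repetitions of one fixed scheme with derivatives
`1`, `n₀` uses and covariance `V₀`. This multiplies the number of uses by about `1 + ε n₀` and
raises `n Tr G V` by at most `|Tr G (1 - B_n) V₀ (1 - B_n)ᵀ| / ε`, which vanishes as `n → ∞`; then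
`ε → 0` (`schemeBound_le_limsup`).

The analytic core is the approximation of an unbounded estimator by finite schemes with convergence
of the derivatives (`tendsto_deriv_of_truncation`). By (CM.1) the output state has a second order
expansion in trace norm, and (CE) bounds the second moments near `θ`. Truncate `T` at level `r` and
compare increments over `t = s / r`. The truncated mean has a Taylor remainder of order `r t² = s
t`. The truncation error, divided by `t`, is governed by `√(r² p_r(t)) / s`, where `p_r` is the tail
probability `P(‖T‖ > r)`. Adding the expansions of `p_r` at `t` and `-t` removes the linear term,
and `p_r(-t) ≥ 0`, so `p_r(t) ≤ 2 p_r(0) + 2 t² κ_r + o(t²)` uniformly in `r`; here `κ_r`, the tail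
functional of the second order coefficient, tends to `0`, and `r² p_r(0) → 0` by finiteness of the
second moment. Hence `r² p_r(t) → 0`, and letting `s → 0` finishes.

The first half of the proof derives the needed operator theory (ideal property of the trace norm,
positive decompositions, cyclicity of the trace, complete positivity of measure-and-prepare maps)
from the variational definition of the trace norm. -/

theorem sum_enorm_inner_le_traceNorm (A : H →L[ℂ] H) {ι : Type*} [Fintype ι] {e f : ι → H}
    (he : Orthonormal ℂ e) (hf : Orthonormal ℂ f) :
    ∑ i, ‖inner ℂ (e i) (A (f i))‖ₑ ≤ traceNorm A := by
  classical
  have := sum_le_traceNorm A (he.comp _ (Fintype.equivFin ι).symm.injective)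
    (hf.comp _ (Fintype.equivFin ι).symm.injective)
  rw [← (Fintype.equivFin ι).symm.sum_comp]
  exact this

theorem traceNorm_zero : traceNorm (0 : H →L[ℂ] H) = 0 :=
  le_antisymm (traceNorm_le fun N e f _ _ => by simp) bot_le

theorem traceNorm_add_le (A B : H →L[ℂ] H) : traceNorm (A + B) ≤ traceNorm A + traceNorm B := by
  refine traceNorm_le fun N e f he hf => ?_
  calc ∑ i, ‖inner ℂ (e i) ((A + B) (f i))‖ₑ
      ≤ ∑ i, (‖inner ℂ (e i) (A (f i))‖ₑ + ‖inner ℂ (e i) (B (f i))‖ₑ) := by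
        refine Finset.sum_le_sum fun i _ => ?_
        rw [_root_.add_apply, inner_add_right]
        exact enorm_add_le _ _
    _ ≤ traceNorm A + traceNorm B := by
        rw [Finset.sum_add_distrib]
        exact add_le_add (sum_le_traceNorm A he hf) (sum_le_traceNorm B he hf)

theorem traceNorm_smul (c : ℂ) (A : H →L[ℂ] H) : traceNorm (c • A) = ‖c‖ₑ * traceNorm A := by
  simp only [traceNorm, ENNReal.mul_iSup, Finset.mul_sum, _root_.smul_apply, inner_smul_right,
    enorm_mul]

theorem traceNorm_neg (A : H →L[ℂ] H) : traceNorm (-A) = traceNorm A := by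
  simpa using traceNorm_smul (-1) A

theorem traceNorm_sub_le (A B : H →L[ℂ] H) : traceNorm (A - B) ≤ traceNorm A + traceNorm B := by
  rw [sub_eq_add_neg, ← traceNorm_neg B]
  exact traceNorm_add_le _ _

theorem enorm_inner_le_traceNorm (A : H →L[ℂ] H) (x y : H) :
    ‖inner ℂ x (A y)‖ₑ ≤ ‖x‖ₑ * ‖y‖ₑ * traceNorm A := by
  rcases eq_or_ne x 0 with rfl | hx
  · simp
  rcases eq_or_ne y 0 with rfl | hy
  · simp
  have unit : ∀ z : H, z ≠ 0 → Orthonormal ℂ fun _ : Fin 1 => ((‖z‖⁻¹ : ℝ) : ℂ) • z := by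
    intro z hz
    refine ⟨fun _ => ?_, fun i j hij => absurd (Subsingleton.elim i j) hij⟩
    simp [norm_smul, hz]
  have scale : ∀ z : H, z ≠ 0 → z = (‖z‖ : ℂ) • ((‖z‖⁻¹ : ℝ) : ℂ) • z := by
    intro z hz
    rw [smul_smul, ← Complex.ofReal_mul, mul_inv_cancel₀ (norm_ne_zero_iff.2 hz)]
    simp
  have h := sum_le_traceNorm A (unit x hx) (unit y hy)
  rw [Finset.sum_const, Finset.card_univ, Fintype.card_fin, one_smul] at h
  have e : inner ℂ x (A y) = (‖x‖ : ℂ) * (‖y‖ : ℂ) *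
      inner ℂ (((‖x‖⁻¹ : ℝ) : ℂ) • x) (A (((‖y‖⁻¹ : ℝ) : ℂ) • y)) := by
    conv_lhs => rw [scale x hx, scale y hy, map_smul, inner_smul_left, inner_smul_right]
    rw [Complex.conj_ofReal, mul_assoc]
  rw [e, enorm_mul, enorm_mul]
  have hn : ∀ z : H, ‖(‖z‖ : ℂ)‖ₑ = ‖z‖ₑ := fun z => by
    rw [← ofReal_norm, Complex.norm_real, norm_norm, ofReal_norm]
  rw [hn, hn]
  gcongr

theorem opENorm_le_traceNorm (A : H →L[ℂ] H) : ‖A‖ₑ ≤ traceNorm A := by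
  rcases eq_or_ne (traceNorm A) ⊤ with h | h
  · simp [h]
  rw [← ofReal_norm, ← ENNReal.ofReal_toReal h]
  refine ENNReal.ofReal_le_ofReal (ContinuousLinearMap.opNorm_le_bound _ ENNReal.toReal_nonneg ?_)
  intro x
  -- Testing against `A x` itself gives `‖A x‖² ≤ ‖A x‖ ‖x‖ ‖A‖₁`; one factor is cancelled below.
  have h1 := enorm_inner_le_traceNorm A (A x) x
  rw [← ofReal_norm, ← ofReal_norm, ← ofReal_norm, ← ENNReal.ofReal_toReal h,
    ← ENNReal.ofReal_mul (norm_nonneg _), ← ENNReal.ofReal_mul (by positivity),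
    ENNReal.ofReal_le_ofReal_iff (by positivity), inner_self_eq_norm_sq_to_K, norm_pow] at h1
  simp only [RCLike.norm_ofReal, abs_norm] at h1
  rcases (norm_nonneg (A x)).eq_or_lt with h0 | h0
  · rw [← h0]; positivity
  · have : ‖A x‖ * ‖A x‖ ≤ ‖A x‖ * (‖x‖ * (traceNorm A).toReal) := by
      rw [← mul_assoc, ← sq]; exact h1
    linarith [le_of_mul_le_mul_left this h0]

theorem eq_zero_of_traceNorm_eq_zero {A : H →L[ℂ] H} (h : traceNorm A = 0) : A = 0 := by
  have := opENorm_le_traceNorm A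
  rw [h, ← ofReal_norm, nonpos_iff_eq_zero, ENNReal.ofReal_eq_zero] at this
  exact norm_le_zero_iff.1 this

/-- Lower semicontinuity of the trace norm, for series. -/
theorem traceNorm_le_tsum {κ : Type*} {A : H →L[ℂ] H} {B : κ → H →L[ℂ] H}
    (h : ∀ x y, HasSum (fun k => inner ℂ x (B k y)) (inner ℂ x (A y))) :
    traceNorm A ≤ ∑' k, traceNorm (B k) := by
  refine traceNorm_le fun N e f he hf => ?_
  calc ∑ i, ‖inner ℂ (e i) (A (f i))‖ₑ
      ≤ ∑ i, ∑' k, ‖inner ℂ (e i) (B k (f i))‖ₑ := by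
        refine Finset.sum_le_sum fun i _ => ?_
        rw [← (h (e i) (f i)).tsum_eq]
        exact enorm_tsum_le_tsum_enorm
    _ = ∑' k, ∑ i, ‖inner ℂ (e i) (B k (f i))‖ₑ :=
        (Summable.tsum_finsetSum fun i _ => ENNReal.summable).symm
    _ ≤ ∑' k, traceNorm (B k) := ENNReal.tsum_le_tsum fun k => sum_le_traceNorm _ he hf

variable [CompleteSpace H] [CompleteSpace L] [CompleteSpace E] [CompleteSpace F]

theorem traceNorm_adjoint (A : H →L[ℂ] H) : traceNorm (adjoint A) = traceNorm A := by
  have key : ∀ A : H →L[ℂ] H, traceNorm (adjoint A) ≤ traceNorm A := fun A =>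
    traceNorm_le fun N e f he hf => by
      refine le_of_eq_of_le (Finset.sum_congr rfl fun i _ => ?_) (sum_le_traceNorm A hf he)
      rw [ContinuousLinearMap.adjoint_inner_right, ← inner_conj_symm, ← ofReal_norm,
        RCLike.norm_conj, ofReal_norm]
  refine le_antisymm (key A) ?_
  simpa using key (adjoint A)

theorem exists_mul_eq_norm (z : ℂ) : ∃ c : ℂ, ‖c‖ ≤ 1 ∧ c * z = ‖z‖ := by
  rcases eq_or_ne z 0 with rfl | hz
  · exact ⟨0, by simp⟩
  · have hz' : (‖z‖ : ℂ) ≠ 0 := by simpa using hz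
    refine ⟨(starRingEnd ℂ) z / ‖z‖, by simp [hz], ?_⟩
    rw [div_mul_eq_mul_div, Complex.conj_mul', sq, mul_div_assoc, div_self hz', mul_one]

/-- Any finite-rank operator is diagonalized by a pair of orthogonal families. -/
theorem exists_orthonormalBasis_map_orthogonal (W : Submodule ℂ H) [FiniteDimensional ℂ W]
    (F : H →L[ℂ] H) :
    ∃ (d : ℕ) (w : OrthonormalBasis (Fin d) ℂ W),
      Pairwise fun j k => inner ℂ (F (w j)) (F (w k)) = 0 := by
  let G : W →L[ℂ] H := F.comp W.subtypeL
  have hS : ((adjoint G).comp G : W →ₗ[ℂ] W).IsSymmetric := by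
    intro x y
    change inner ℂ ((adjoint G) (G x)) y = inner ℂ x ((adjoint G) (G y))
    rw [ContinuousLinearMap.adjoint_inner_left, ContinuousLinearMap.adjoint_inner_right]
  refine ⟨_, hS.eigenvectorBasis rfl, fun j k hjk => ?_⟩
  have h1 : inner ℂ (G (hS.eigenvectorBasis rfl j)) (G (hS.eigenvectorBasis rfl k)) = 0 := by
    rw [← ContinuousLinearMap.adjoint_inner_right]
    have := hS.apply_eigenvectorBasis rfl k
    change (adjoint G) (G (hS.eigenvectorBasis rfl k)) = _ at this
    rw [this, inner_smul_right, (hS.eigenvectorBasis rfl).orthonormal.2 hjk, mul_zero]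
  exact h1

/-- Absorbing the phases, the sum is a trace of `A T` for the finite-rank operator `T = ∑ c_i |D
f_i⟩⟨C e_i|`, whose norm is at most `‖C‖ ‖D‖`. A singular value decomposition of `T` on the span of
the `C e_i` rewrites this trace with two orthonormal families, which the trace norm controls. The
ideal property is the case of bounded `C`, `D` between different spaces. -/
theorem sum_enorm_inner_comp_le (A : H →L[ℂ] H) (C : E →L[ℂ] H) (D : F →L[ℂ] H)
    {ι : Type*} [Fintype ι] {e : ι → E} {f : ι → F} (he : Orthonormal ℂ e)
    (hf : Orthonormal ℂ f) :
    ∑ i, ‖inner ℂ (C (e i)) (A (D (f i)))‖ₑ ≤ ‖C‖ₑ * ‖D‖ₑ * traceNorm A := by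
  classical
  choose c hc hcz using fun i => exists_mul_eq_norm (inner ℂ (C (e i)) (A (D (f i))))
  let T : H →L[ℂ] H := ∑ i, c i • (innerSL ℂ (C (e i))).smulRight (D (f i))
  have hT : ∀ h, T h = ∑ i, (c i * inner ℂ (C (e i)) h) • D (f i) := by
    intro h
    simp [T, smul_smul]
  have hTn : ∀ h, ‖T h‖ ≤ ‖C‖ * ‖D‖ * ‖h‖ := by
    intro h
    have h1 : T h = D (∑ i, (c i * inner ℂ (C (e i)) h) • f i) := by
      rw [hT, map_sum]; simp
    -- Orthonormality of `f` gives a sum of squares; Bessel's inequality for `e` at `C* h` bounds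
    -- it.
    have h2 : ‖∑ i, (c i * inner ℂ (C (e i)) h) • f i‖ ^ 2 ≤ (‖C‖ * ‖h‖) ^ 2 := by
      have h3 : ‖∑ i, (c i * inner ℂ (C (e i)) h) • f i‖ ^ 2 =
          ∑ i, ‖c i * inner ℂ (C (e i)) h‖ ^ 2 := by
        rw [← inner_self_eq_norm_sq (𝕜 := ℂ), hf.inner_sum, map_sum]
        refine Finset.sum_congr rfl fun i _ => ?_
        rw [RCLike.conj_mul, ← RCLike.ofReal_pow, RCLike.ofReal_re]
      rw [h3]
      calc ∑ i, ‖c i * inner ℂ (C (e i)) h‖ ^ 2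
          ≤ ∑ i, ‖inner ℂ (e i) (adjoint C h)‖ ^ 2 := by
            refine Finset.sum_le_sum fun i _ => ?_
            rw [norm_mul, ContinuousLinearMap.adjoint_inner_right]
            gcongr
            exact mul_le_of_le_one_left (norm_nonneg _) (hc i)
        _ ≤ ‖adjoint C h‖ ^ 2 := he.sum_inner_products_le _
        _ ≤ (‖C‖ * ‖h‖) ^ 2 := by
            gcongr
            refine ((adjoint C).le_opNorm h).trans ?_
            rw [LinearIsometryEquiv.norm_map]
    rw [h1]
    refine (D.le_opNorm _).trans ?_
    have h3 := (sq_le_sq₀ (norm_nonneg _) (by positivity)).1 h2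
    calc _ ≤ ‖D‖ * (‖C‖ * ‖h‖) := by gcongr
      _ = _ := by ring
  let W : Submodule ℂ H := Submodule.span ℂ (Set.range fun i => C (e i))
  have : FiniteDimensional ℂ W := FiniteDimensional.span_of_finite ℂ (Set.finite_range _)
  obtain ⟨d, w, hw⟩ := exists_orthonormalBasis_map_orthogonal W T
  have hwo : Orthonormal ℂ fun j => (w j : H) :=
    w.orthonormal.comp_linearIsometry W.subtypeₗᵢ
  have hu : ∀ i (y : H), inner ℂ (C (e i)) y = ∑ j, inner ℂ (C (e i)) (w j : H) *
      inner ℂ (w j : H) y := by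
    intro i y
    have hmem : C (e i) ∈ W := Submodule.subset_span ⟨i, rfl⟩
    have := w.sum_repr' ⟨C (e i), hmem⟩
    have h2 : C (e i) = ∑ j, inner ℂ (w j : H) (C (e i)) • (w j : H) := by
      have := congrArg (Subtype.val) this
      simpa using this.symm
    conv_lhs => rw [h2, sum_inner]
    refine Finset.sum_congr rfl fun j _ => ?_
    rw [inner_smul_left, inner_conj_symm]
  have htr : (∑ i, (‖inner ℂ (C (e i)) (A (D (f i)))‖ : ℂ)) =
      ∑ j, inner ℂ (w j : H) (A (T (w j))) := by
    calc (∑ i, (‖inner ℂ (C (e i)) (A (D (f i)))‖ : ℂ))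
        = ∑ i, ∑ j, c i * (inner ℂ (C (e i)) (w j : H) * inner ℂ (w j : H) (A (D (f i)))) := by
          refine Finset.sum_congr rfl fun i _ => ?_
          rw [← hcz, hu, Finset.mul_sum]
      _ = _ := by
          rw [Finset.sum_comm]
          refine Finset.sum_congr rfl fun j _ => ?_
          rw [hT, map_sum, inner_sum]
          refine Finset.sum_congr rfl fun i _ => ?_
          rw [map_smul, inner_smul_right]; ring
  have hfin : ∑ i, ‖inner ℂ (C (e i)) (A (D (f i)))‖ₑ ≤ ∑ j, ‖inner ℂ (w j : H) (A (T (w j)))‖ₑ := by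
    have h1 : ∑ i, ‖inner ℂ (C (e i)) (A (D (f i)))‖ ≤ ∑ j, ‖inner ℂ (w j : H) (A (T (w j)))‖ := by
      have := norm_sum_le Finset.univ fun j => inner ℂ (w j : H) (A (T (w j)))
      rw [← htr, ← Complex.ofReal_sum, Complex.norm_real, Real.norm_of_nonneg
        (Finset.sum_nonneg fun i _ => norm_nonneg _)] at this
      exact this
    simp only [← ofReal_norm]
    rw [← ENNReal.ofReal_sum_of_nonneg fun i _ => norm_nonneg _,
      ← ENNReal.ofReal_sum_of_nonneg fun i _ => norm_nonneg _]
    exact ENNReal.ofReal_le_ofReal h1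
  refine hfin.trans ?_
  -- Only nonzero `T w_j` can be normalized to an orthonormal family; the other indices contribute
  -- `0`.
  let J := {j : Fin d // T (w j) ≠ 0}
  have hz : ∀ j, T (w j) = (‖T (w j)‖ : ℂ) • ((‖T (w j)‖⁻¹ : ℝ) : ℂ) • T (w j) := by
    intro j
    by_cases h : T (w j) = 0
    · simp [h]
    · rw [smul_smul, ← Complex.ofReal_mul, mul_inv_cancel₀ (norm_ne_zero_iff.2 h)]; simp
  have ha : Orthonormal ℂ fun j : J => ((‖T (w j)‖⁻¹ : ℝ) : ℂ) • T (w j) := by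
    refine ⟨fun j => by simp [norm_smul, j.2], fun j k hjk => ?_⟩
    simp only [inner_smul_left, inner_smul_right]
    rw [hw (fun h => hjk (Subtype.ext h))]; simp
  have hwJ : Orthonormal ℂ fun j : J => (w j : H) := hwo.comp _ Subtype.val_injective
  calc ∑ j, ‖inner ℂ (w j : H) (A (T (w j)))‖ₑ
      = ∑ j : J, ‖inner ℂ (w j : H) (A (T (w j)))‖ₑ := by
        rw [← Fintype.sum_subtype_add_sum_subtype (fun j => T (w j) ≠ 0)]
        have h0 : ∑ j : {j // ¬ T (w j) ≠ 0}, ‖inner ℂ (w j : H) (A (T (w j)))‖ₑ = 0 :=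
          Finset.sum_eq_zero fun j _ => by rw [not_not.1 j.2]; simp
        rw [h0, add_zero]
    _ ≤ ∑ j : J, ‖C‖ₑ * ‖D‖ₑ * ‖inner ℂ (w j : H) (A (((‖T (w j)‖⁻¹ : ℝ) : ℂ) • T (w j)))‖ₑ := by
        refine Finset.sum_le_sum fun j _ => ?_
        conv_lhs => rw [hz j, map_smul, inner_smul_right, enorm_mul]
        gcongr
        have h4 := hTn (w j)
        have h5 : ‖(w j : H)‖ = 1 := hwo.1 j
        rw [h5, mul_one] at h4
        rw [← ofReal_norm, ← ofReal_norm, ← ofReal_norm, ← ENNReal.ofReal_mul (norm_nonneg _),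
          Complex.norm_real, norm_norm]
        exact ENNReal.ofReal_le_ofReal h4
    _ ≤ ‖C‖ₑ * ‖D‖ₑ * traceNorm A := by
        rw [← Finset.mul_sum]
        gcongr
        exact sum_enorm_inner_le_traceNorm A hwJ ha

/-- The ideal property of the trace norm. -/
theorem traceNorm_comp_le (A : H →L[ℂ] H) (B : L →L[ℂ] H) (C : H →L[ℂ] L) :
    traceNorm (C.comp (A.comp B)) ≤ ‖C‖ₑ * ‖B‖ₑ * traceNorm A := by
  refine traceNorm_le fun N e f he hf => ?_
  have := sum_enorm_inner_comp_le A (adjoint C) B he hf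
  have hC : ‖adjoint C‖ₑ = ‖C‖ₑ := by
    rw [← ofReal_norm, LinearIsometryEquiv.norm_map, ofReal_norm]
  rw [hC] at this
  refine le_of_eq_of_le (Finset.sum_congr rfl fun i _ => ?_) this
  rw [ContinuousLinearMap.adjoint_inner_left]; rfl

theorem traceNorm_comp_left_le (A C : H →L[ℂ] H) :
    traceNorm (C.comp A) ≤ ‖C‖ₑ * traceNorm A := by
  refine (traceNorm_comp_le A (.id ℂ H) C).trans ?_
  gcongr
  refine mul_le_of_le_one_right bot_le ?_
  rw [← ofReal_norm, ← ENNReal.ofReal_one]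
  exact ENNReal.ofReal_le_ofReal ContinuousLinearMap.norm_id_le

theorem traceNorm_comp_right_le (A B : H →L[ℂ] H) :
    traceNorm (A.comp B) ≤ ‖B‖ₑ * traceNorm A := by
  refine (traceNorm_comp_le A B (.id ℂ H)).trans ?_
  gcongr
  refine mul_le_of_le_one_left bot_le ?_
  rw [← ofReal_norm, ← ENNReal.ofReal_one]
  exact ENNReal.ofReal_le_ofReal ContinuousLinearMap.norm_id_le

end TraceNorm

section Trace

variable {H L : Type u} [NormedAddCommGroup H] [InnerProductSpace ℂ H] [CompleteSpace H]
  [NormedAddCommGroup L] [InnerProductSpace ℂ L] [CompleteSpace L] {ι κ : Type*}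

/-! ### Hilbert-Schmidt sums -/

theorem tsum_enorm_inner_sq (b : HilbertBasis ι ℂ H) (x : H) :
    ∑' i, ‖inner ℂ (b i) x‖ₑ ^ 2 = ‖x‖ₑ ^ 2 := by
  have h := b.hasSum_inner_mul_inner x x
  have h2 : HasSum (fun i => ‖inner ℂ (b i) x‖ ^ 2) (‖x‖ ^ 2) := by
    rw [← Complex.hasSum_ofReal]
    have e : (fun i => ((‖inner ℂ (b i) x‖ ^ 2 : ℝ) : ℂ)) =
        fun i => inner ℂ x (b i) * inner ℂ (b i) x := by
      funext i
      rw [← inner_conj_symm x (b i), RCLike.conj_mul]; simp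
    have e2 : ((‖x‖ ^ 2 : ℝ) : ℂ) = inner ℂ x x := by
      rw [inner_self_eq_norm_sq_to_K]; simp
    rw [e, e2]
    exact h
  simp only [← ofReal_norm, ← ENNReal.ofReal_pow (norm_nonneg _)]
  rw [← h2.tsum_eq, ENNReal.ofReal_tsum_of_nonneg (fun i => by positivity) h2.summable]

theorem enorm_inner_comm (x y : H) : ‖inner ℂ x y‖ₑ = ‖inner ℂ y x‖ₑ := by
  rw [← inner_conj_symm, ← ofReal_norm, RCLike.norm_conj, ofReal_norm]

/-- Parseval in both bases and an exchange of two sums of nonnegative terms. In particular the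
Hilbert-Schmidt sum is independent of the basis. -/
theorem tsum_enorm_sq_adjoint (b : HilbertBasis ι ℂ H) (c : HilbertBasis κ ℂ L) (P : H →L[ℂ] L) :
    ∑' j, ‖adjoint P (c j)‖ₑ ^ 2 = ∑' i, ‖P (b i)‖ₑ ^ 2 := by
  simp_rw [← tsum_enorm_inner_sq b, ← tsum_enorm_inner_sq c]
  rw [ENNReal.tsum_comm]
  simp_rw [ContinuousLinearMap.adjoint_inner_right, enorm_inner_comm]

theorem summable_norm_inner_sq (b : HilbertBasis ι ℂ H) (c : HilbertBasis κ ℂ L) (R : H →L[ℂ] L)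
    (hR : ∑' i, ‖R (b i)‖ₑ ^ 2 ≠ ⊤) :
    Summable fun p : ι × κ => ‖inner ℂ (c p.2) (R (b p.1))‖ ^ 2 := by
  have h1 : ∑' p : ι × κ, ENNReal.ofReal (‖inner ℂ (c p.2) (R (b p.1))‖ ^ 2) ≠ ⊤ := by
    rw [ENNReal.tsum_prod']
    simp only [ENNReal.ofReal_pow (norm_nonneg _), ofReal_norm]
    simp_rw [tsum_enorm_inner_sq c]
    exact hR
  exact (ENNReal.summable_toReal h1).congr fun p => ENNReal.toReal_ofReal (by positivity)

theorem summable_inner_mul_inner (b : HilbertBasis ι ℂ H) (c : HilbertBasis κ ℂ L)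
    (P Q : H →L[ℂ] L) (hP : ∑' i, ‖P (b i)‖ₑ ^ 2 ≠ ⊤) (hQ : ∑' i, ‖Q (b i)‖ₑ ^ 2 ≠ ⊤) :
    Summable fun p : ι × κ => inner ℂ (P (b p.1)) (c p.2) * inner ℂ (c p.2) (Q (b p.1)) := by
  refine Summable.of_norm_bounded
    ((summable_norm_inner_sq b c P hP).add (summable_norm_inner_sq b c Q hQ)) fun p => ?_
  rw [norm_mul, norm_inner_symm]
  have : ∀ x y : ℝ, x * y ≤ x ^ 2 + y ^ 2 := fun x y => by
    nlinarith [sq_nonneg (x - y), sq_nonneg x, sq_nonneg y]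
  exact this _ _

/-- The double series of `⟨P b_i, c_j⟩⟨c_j, Q b_i⟩` converges absolutely for Hilbert-Schmidt `P`,
`Q`, so it may be summed in either order. This is the source of cyclicity and basis independence of
the trace. -/
theorem hasSum_inner_comm (b : HilbertBasis ι ℂ H) (c : HilbertBasis κ ℂ L) (P Q : H →L[ℂ] L)
    (hP : ∑' i, ‖P (b i)‖ₑ ^ 2 ≠ ⊤) (hQ : ∑' i, ‖Q (b i)‖ₑ ^ 2 ≠ ⊤) :
    ∃ s : ℂ, HasSum (fun i => inner ℂ (P (b i)) (Q (b i))) s ∧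
      HasSum (fun j => inner ℂ (adjoint Q (c j)) (adjoint P (c j))) s := by
  obtain ⟨s, hs⟩ := summable_inner_mul_inner b c P Q hP hQ
  have h1 : ∀ i, HasSum (fun j => inner ℂ (P (b i)) (c j) * inner ℂ (c j) (Q (b i)))
      (inner ℂ (P (b i)) (Q (b i))) := fun i => c.hasSum_inner_mul_inner _ _
  have h2 : ∀ j, HasSum (fun i => inner ℂ (P (b i)) (c j) * inner ℂ (c j) (Q (b i)))
      (inner ℂ (adjoint Q (c j)) (adjoint P (c j))) := fun j => by
    have e : (fun i => inner ℂ (P (b i)) (c j) * inner ℂ (c j) (Q (b i))) = fun i =>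
        inner ℂ (adjoint Q (c j)) (b i) * inner ℂ (b i) (adjoint P (c j)) := by
      funext i
      rw [ContinuousLinearMap.adjoint_inner_right, ContinuousLinearMap.adjoint_inner_left, mul_comm]
    rw [e]
    exact b.hasSum_inner_mul_inner _ _
  have hs' : HasSum (fun p : κ × ι => inner ℂ (P (b p.2)) (c p.1) * inner ℂ (c p.1) (Q (b p.2))) s :=
    (Equiv.prodComm κ ι).hasSum_iff.2 hs
  exact ⟨s, HasSum.prod_fiberwise hs h1, HasSum.prod_fiberwise hs' h2⟩

/-! ### Positive operators -/

theorem exists_sqrt {X : H →L[ℂ] H} (hX : X.IsPositive) :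
    ∃ S : H →L[ℂ] H, adjoint S = S ∧ S.comp S = X := by
  have h0 : 0 ≤ X := (ContinuousLinearMap.nonneg_iff_isPositive X).2 hX
  refine ⟨CFC.sqrt X, ?_, CFC.sqrt_mul_sqrt_self X h0⟩
  exact ((ContinuousLinearMap.nonneg_iff_isPositive _).1 (CFC.sqrt_nonneg X)).isSelfAdjoint

/-- Upper bound: `|⟨S x, S y⟩| ≤ (‖S x‖² + ‖S y‖²) / 2` and Bessel's inequality for each family.
Lower bound: both families taken to be finite parts of the basis. -/
theorem traceNorm_comp_self (b : HilbertBasis ι ℂ H) {S : H →L[ℂ] H} (hS : adjoint S = S) :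
    traceNorm (S.comp S) = ∑' i, ‖S (b i)‖ₑ ^ 2 := by
  have hin : ∀ x y, inner ℂ x (S (S y)) = inner ℂ (S x) (S y) := fun x y => by
    rw [← ContinuousLinearMap.adjoint_inner_left, hS]
  refine le_antisymm (traceNorm_le fun N e f he hf => ?_) ?_
  · have bessel : ∀ g : Fin N → H, Orthonormal ℂ g →
        ∑ i, ‖S (g i)‖ₑ ^ 2 ≤ ∑' i, ‖S (b i)‖ₑ ^ 2 := by
      intro g hg
      calc ∑ i, ‖S (g i)‖ₑ ^ 2 = ∑ i, ∑' j, ‖inner ℂ (b j) (S (g i))‖ₑ ^ 2 := by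
            simp_rw [tsum_enorm_inner_sq b]
        _ = ∑' j, ∑ i, ‖inner ℂ (b j) (S (g i))‖ₑ ^ 2 :=
            (Summable.tsum_finsetSum fun i _ => ENNReal.summable).symm
        _ ≤ _ := by
            refine ENNReal.tsum_le_tsum fun j => ?_
            have h := hg.sum_inner_products_le (S (b j)) (s := Finset.univ)
            have h2 : ∀ i, inner ℂ (b j) (S (g i)) = inner ℂ (S (b j)) (g i) := fun i => by
              rw [← ContinuousLinearMap.adjoint_inner_left, hS]
            simp_rw [h2, enorm_inner_comm (S (b j)), ← ofReal_norm,
              ← ENNReal.ofReal_pow (norm_nonneg _)]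
            rw [← ENNReal.ofReal_sum_of_nonneg fun i _ => by positivity]
            exact ENNReal.ofReal_le_ofReal h
    have amgm : ∀ x y : H, ‖inner ℂ x (S (S y))‖ₑ ≤ (‖S x‖ₑ ^ 2 + ‖S y‖ₑ ^ 2) / 2 := by
      intro x y
      rw [hin, ENNReal.le_div_iff_mul_le (by simp) (by simp)]
      simp only [← ofReal_norm, ← ENNReal.ofReal_pow (norm_nonneg _)]
      rw [← ENNReal.ofReal_add (by positivity) (by positivity), ← ENNReal.ofReal_ofNat 2,
        ← ENNReal.ofReal_mul (norm_nonneg _)]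
      refine ENNReal.ofReal_le_ofReal ?_
      nlinarith [norm_inner_le_norm (𝕜 := ℂ) (S x) (S y), sq_nonneg (‖S x‖ - ‖S y‖)]
    calc ∑ i, ‖inner ℂ (e i) ((S.comp S) (f i))‖ₑ
        ≤ ∑ i, (‖S (e i)‖ₑ ^ 2 + ‖S (f i)‖ₑ ^ 2) / 2 := Finset.sum_le_sum fun i _ => amgm _ _
      _ = (∑ i, ‖S (e i)‖ₑ ^ 2 + ∑ i, ‖S (f i)‖ₑ ^ 2) / 2 := by
          simp_rw [div_eq_mul_inv]
          rw [← Finset.sum_mul, Finset.sum_add_distrib]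
      _ ≤ (∑' i, ‖S (b i)‖ₑ ^ 2 + ∑' i, ‖S (b i)‖ₑ ^ 2) / 2 := by
          gcongr
          exacts [bessel e he, bessel f hf]
      _ = _ := by rw [← two_mul, mul_comm, mul_div_assoc, ENNReal.div_self (by simp) (by simp),
                    mul_one]
  · rw [ENNReal.tsum_eq_iSup_sum]
    refine iSup_le fun s => ?_
    have hb : Orthonormal ℂ fun i : s => b i := b.orthonormal.comp _ Subtype.val_injective
    refine le_of_eq_of_le ?_ (sum_enorm_inner_le_traceNorm (S.comp S) hb hb)
    rw [← Finset.sum_coe_sort s]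
    refine Finset.sum_congr rfl fun i _ => ?_
    rw [ContinuousLinearMap.comp_apply, hin, ← ofReal_norm, ← ofReal_norm,
      inner_self_eq_norm_sq_to_K, ← ENNReal.ofReal_pow (norm_nonneg _), norm_pow]
    simp

/-! ### The trace -/

theorem tsum_enorm_inner_le_traceNorm (b : HilbertBasis ι ℂ H) (A : H →L[ℂ] H) :
    ∑' i, ‖inner ℂ (b i) (A (b i))‖ₑ ≤ traceNorm A := by
  rw [ENNReal.tsum_eq_iSup_sum]
  refine iSup_le fun s => ?_
  have hb : Orthonormal ℂ fun i : s => b i := b.orthonormal.comp _ Subtype.val_injective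
  refine le_of_eq_of_le ?_ (sum_enorm_inner_le_traceNorm A hb hb)
  rw [← Finset.sum_coe_sort s]

theorem summable_inner {A : H →L[ℂ] H} (hA : traceNorm A < ⊤) (b : HilbertBasis ι ℂ H) :
    Summable fun i => inner ℂ (b i) (A (b i)) := by
  have h := ((tsum_enorm_inner_le_traceNorm b A).trans_lt hA).ne
  refine Summable.of_norm ?_
  have h2 := ENNReal.summable_toReal h
  simpa using h2

variable (H) in
/-- The orthonormal basis in the definition of the trace. -/
def traceBasis : HilbertBasis (exists_hilbertBasis ℂ H).choose ℂ H :=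
  (exists_hilbertBasis ℂ H).choose_spec.choose

theorem hasSum_trace {A : H →L[ℂ] H} (hA : traceNorm A < ⊤) :
    HasSum (fun i => inner ℂ (traceBasis H i) (A (traceBasis H i))) (trace A) :=
  (summable_inner hA (traceBasis H)).hasSum

theorem enorm_trace_le (A : H →L[ℂ] H) : ‖trace A‖ₑ ≤ traceNorm A :=
  enorm_tsum_le_tsum_enorm.trans (tsum_enorm_inner_le_traceNorm (traceBasis H) A)

variable (H) in
/-- The trace as a linear functional on trace class operators. -/
def trL : TC H →ₗ[ℂ] ℂ where
  toFun X := trace (X : H →L[ℂ] H)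
  map_add' X Y := by
    refine HasSum.unique (hasSum_trace (X + Y).2) ?_
    simpa [inner_add_right] using (hasSum_trace X.2).add (hasSum_trace Y.2)
  map_smul' c X := by
    refine HasSum.unique (hasSum_trace (c • X).2) ?_
    simpa [inner_smul_right] using (hasSum_trace X.2).mul_left c

theorem trL_apply (X : TC H) : trL H X = trace (X : H →L[ℂ] H) := rfl

/-- Cyclicity in the form `tr (N S S) = tr (S N S)`, with the right side computed in an arbitrary
basis. Every positive trace class operator is such a square, so all trace identities below reduce to
this one. -/
theorem traceNorm_comp_self_conj {S : H →L[ℂ] H} (hS : adjoint S = S)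
    (hX : traceNorm (S.comp S) < ⊤) (c : HilbertBasis ι ℂ H) (N : H →L[ℂ] H) :
    HasSum (fun j => inner ℂ (S (c j)) (N (S (c j)))) (trace (N.comp (S.comp S))) := by
  have hN : traceNorm (N.comp (S.comp S)) < ⊤ :=
    (traceNorm_comp_left_le _ _).trans_lt (ENNReal.mul_lt_top enorm_lt_top hX)
  have hfin : ∀ {κ : Type u} (b : HilbertBasis κ ℂ H), ∑' i, ‖S (b i)‖ₑ ^ 2 ≠ ⊤ := fun b => by
    rw [← traceNorm_comp_self b hS]; exact hX.ne
  -- `‖S N* b_i‖` has no termwise bound by `‖S b_i‖`; for the adjoint `N S` the bound by `‖N‖ ‖S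
  -- b_i‖` is immediate.
  have hP : ∑' i, ‖(S.comp (adjoint N)) (traceBasis H i)‖ₑ ^ 2 ≠ ⊤ := by
    rw [← tsum_enorm_sq_adjoint (traceBasis H) (traceBasis H), ContinuousLinearMap.adjoint_comp,
      ContinuousLinearMap.adjoint_adjoint, hS]
    refine ne_top_of_le_ne_top (ENNReal.mul_ne_top (b := ∑' i, ‖S (traceBasis H i)‖ₑ ^ 2)
      (a := ‖N‖ₑ ^ 2) (by simp) (hfin _)) ?_
    rw [← ENNReal.tsum_mul_left]
    refine ENNReal.tsum_le_tsum fun i => ?_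
    rw [← mul_pow]
    gcongr
    exact N.le_opENorm _
  obtain ⟨s, h1, h2⟩ := hasSum_inner_comm (traceBasis H) c (S.comp (adjoint N)) S hP (hfin _)
  have h3 : s = trace (N.comp (S.comp S)) := by
    refine h1.unique ?_
    convert hasSum_trace hN using 2 with i
    simp only [ContinuousLinearMap.comp_apply]
    rw [← hS, ContinuousLinearMap.adjoint_inner_left, hS, ContinuousLinearMap.adjoint_inner_left]
  rw [← h3]
  convert h2 using 2 with j
  rw [ContinuousLinearMap.adjoint_comp, ContinuousLinearMap.adjoint_adjoint, hS]; rfl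

end Trace

section Decomposition

variable {H L : Type u} [NormedAddCommGroup H] [InnerProductSpace ℂ H] [CompleteSpace H]
  [NormedAddCommGroup L] [InnerProductSpace ℂ L] [CompleteSpace L]

/-! ### Decomposition of trace class operators into positive ones -/

/-- `A⁺` equals `A` times a spectral projection, which is not a continuous function of `A`. A
continuous ramp `g` of slope `n + 1` replaces it: `x g(x)` and `x⁺` differ only for `0 < x < 1 / (n
+ 1)`, by at most that length. -/
theorem norm_mul_cfc_sub_posPart_le {A : H →L[ℂ] H} (hA : IsSelfAdjoint A) (n : ℕ) :
    ∃ B : H →L[ℂ] H, ‖B‖ ≤ 1 ∧ ‖A.comp B - A⁺‖ ≤ 1 / (n + 1 : ℝ) := by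
  have hn : (0 : ℝ) < n + 1 := by positivity
  let g : ℝ → ℝ := fun x => min 1 ((n + 1) * max x 0)
  have hg : Continuous g := by fun_prop
  refine ⟨cfc g A, ?_, ?_⟩
  · refine norm_cfc_le zero_le_one fun x _ => ?_
    rw [Real.norm_of_nonneg (le_min zero_le_one (by positivity))]
    exact min_le_left _ _
  · have h1 : A⁺ = cfc (fun x : ℝ => max x 0) A := by
      rw [CFC.posPart_def, cfcₙ_eq_cfc]
      rfl
    have h2 : A.comp (cfc g A) = cfc (fun x : ℝ => x * g x) A := by
      have := cfc_mul (fun x : ℝ => x) g A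
      rw [this, cfc_id' ℝ A]; rfl
    rw [h1, h2, ← cfc_sub (fun x : ℝ => x * g x) (fun x => max x 0) A]
    refine norm_cfc_le (by positivity) fun x _ => ?_
    simp only [g]
    rcases le_total x 0 with hx | hx
    · rw [max_eq_right hx]; simp; positivity
    · rw [max_eq_left hx]
      rcases le_total 1 ((n + 1) * x) with h | h
      · rw [min_eq_left h]; simp; positivity
      · rw [min_eq_right h, Real.norm_eq_abs, abs_le, le_div_iff₀ hn]
        have h3 : x ≤ 1 / (n + 1) := by rw [le_div_iff₀ hn]; linarith
        rw [neg_le, ← sub_nonneg]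
        constructor
        · have : 1 / (n + 1 : ℝ) - -(x * ((n + 1) * x) - x) =
            (1 / (n + 1) - x) + x * ((n + 1) * x) := by ring
          rw [this]
          have := mul_nonneg hx (mul_nonneg hn.le hx)
          linarith
        · nlinarith [mul_nonneg hn.le hx]

/-- Each `A g(A)` has trace norm at most that of `A` by the ideal property, and the trace norm is
lower semicontinuous under norm limits. -/
theorem traceNorm_posPart_le {A : H →L[ℂ] H} (hA : IsSelfAdjoint A) :
    traceNorm A⁺ ≤ traceNorm A := by
  choose B hB hAB using norm_mul_cfc_sub_posPart_le hA
  have hlim : Tendsto (fun n => A.comp (B n)) atTop (𝓝 A⁺) := by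
    rw [tendsto_iff_norm_sub_tendsto_zero]
    exact squeeze_zero (fun _ => norm_nonneg _) hAB tendsto_one_div_add_atTop_nhds_zero_nat
  refine traceNorm_le fun N e f he hf => ?_
  have h1 : Tendsto (fun n => ∑ i, ‖inner ℂ (e i) (A.comp (B n) (f i))‖ₑ) atTop
      (𝓝 (∑ i, ‖inner ℂ (e i) (A⁺ (f i))‖ₑ)) := by
    refine tendsto_finsetSum _ fun i _ => ?_
    have hc : Continuous fun T : H →L[ℂ] H => ‖inner ℂ (e i) (T (f i))‖ₑ := by fun_prop
    exact (hc.tendsto _).comp hlim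
  refine le_of_tendsto' h1 fun n => (sum_le_traceNorm _ he hf).trans ?_
  refine (traceNorm_comp_right_le A (B n)).trans ?_
  refine mul_le_of_le_one_left bot_le ?_
  rw [← ofReal_norm, ← ENNReal.ofReal_one]
  exact ENNReal.ofReal_le_ofReal (hB n)

theorem exists_pos_sub_pos {A : H →L[ℂ] H} (hA : IsSelfAdjoint A) :
    ∃ P Q : H →L[ℂ] H, P.IsPositive ∧ Q.IsPositive ∧ traceNorm P ≤ traceNorm A ∧
      traceNorm Q ≤ traceNorm A ∧ A = P - Q := by
  refine ⟨A⁺, (-A)⁺, ?_, ?_, traceNorm_posPart_le hA, ?_, ?_⟩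
  · exact (ContinuousLinearMap.nonneg_iff_isPositive _).1 (CFC.posPart_nonneg A)
  · exact (ContinuousLinearMap.nonneg_iff_isPositive _).1 (CFC.posPart_nonneg _)
  · exact (traceNorm_posPart_le hA.neg).trans_eq (traceNorm_neg A)
  · rw [CFC.posPart_neg, CFC.posPart_sub_negPart A hA]

/-- Self-adjoint real and imaginary parts, each split into positive and negative part. The bound on
every piece reduces later estimates to positive operators at the cost of a factor `4`. -/
theorem TC.exists_pos_decomp (X : TC H) :
    ∃ P : Fin 4 → TC H, (∀ k, ((P k : TC H) : H →L[ℂ] H).IsPositive) ∧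
      (∀ k, traceNorm (P k : H →L[ℂ] H) ≤ traceNorm (X : H →L[ℂ] H)) ∧
      X = P 0 - P 1 + Complex.I • (P 2 - P 3) := by
  obtain ⟨A, hA⟩ := X
  have half : ∀ (c : ℂ), ‖c‖ = 1 →
      traceNorm ((1 / 2 : ℂ) • (c • A + star (c • A))) ≤ traceNorm A := by
    intro c hc
    rw [traceNorm_smul]
    refine (mul_le_mul_right (traceNorm_add_le _ _) _).trans ?_
    have h1 : traceNorm (star (c • A)) = traceNorm (c • A) := traceNorm_adjoint _
    have hc' : ‖c‖ₑ = 1 := by rw [← ofReal_norm, hc, ENNReal.ofReal_one]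
    have h2 : ‖(1 / 2 : ℂ)‖ₑ = 2⁻¹ := by
      rw [← ofReal_norm]; simp [ENNReal.ofReal_inv_of_pos]
    rw [h1, traceNorm_smul, hc', one_mul, ← two_mul, ← mul_assoc, h2,
      ENNReal.inv_mul_cancel (by simp) (by simp), one_mul]
  have sa : ∀ (c : ℂ), IsSelfAdjoint ((1 / 2 : ℂ) • (c • A + star (c • A))) := by
    intro c
    refine IsSelfAdjoint.smul ?_ (IsSelfAdjoint.add_star_self _)
    simp [isSelfAdjoint_iff]
  obtain ⟨P, Q, hP, hQ, hPn, hQn, h1⟩ := exists_pos_sub_pos (sa 1)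
  obtain ⟨R, S, hR, hS, hRn, hSn, h2⟩ := exists_pos_sub_pos (sa (-Complex.I))
  have b1 := half 1 (by simp)
  have b2 := half (-Complex.I) (by simp)
  refine ⟨![⟨P, (hPn.trans b1).trans_lt hA⟩, ⟨Q, (hQn.trans b1).trans_lt hA⟩,
    ⟨R, (hRn.trans b2).trans_lt hA⟩, ⟨S, (hSn.trans b2).trans_lt hA⟩], ?_, ?_, ?_⟩
  · intro k; fin_cases k
    exacts [hP, hQ, hR, hS]
  · intro k; fin_cases k
    exacts [hPn.trans b1, hQn.trans b1, hRn.trans b2, hSn.trans b2]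
  · ext1
    change A = P - Q + Complex.I • (R - S)
    rw [← h1, ← h2]
    simp only [one_smul, star_smul, star_neg, smul_add, smul_smul]
    have e1 : star Complex.I = -Complex.I := Complex.conj_I
    rw [e1]
    have e2 : Complex.I * (1 / 2 * -Complex.I) = 1 / 2 := by
      linear_combination (-1 / 2 : ℂ) * Complex.I_mul_I
    have e3 : Complex.I * (1 / 2 * - -Complex.I) = - (1 / 2) := by
      linear_combination (1 / 2 : ℂ) * Complex.I_mul_I
    rw [e2, e3]
    module

/-- Linear maps on trace class operators are determined by their values at positive operators. -/
theorem TC.linearMap_ext {M : Type*} [AddCommGroup M] [Module ℂ M] {f g : TC H →ₗ[ℂ] M}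
    (h : ∀ X : TC H, (X : H →L[ℂ] H).IsPositive → f X = g X) : f = g := by
  ext1 X
  obtain ⟨P, hP, -, hX⟩ := TC.exists_pos_decomp X
  rw [hX]
  simp only [map_add, map_sub, map_smul, h _ (hP _)]

/-! ### Operations on trace class operators -/

/-- The map `X ↦ C X` on trace class operators. -/
def TC.mulLeft (C : H →L[ℂ] H) : TC H →ₗ[ℂ] TC H where
  toFun X := ⟨C.comp (X : H →L[ℂ] H),
    (traceNorm_comp_left_le _ _).trans_lt (ENNReal.mul_lt_top enorm_lt_top X.2)⟩
  map_add' X Y := Subtype.ext (by ext; simp)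
  map_smul' c X := Subtype.ext (by ext; simp)

theorem TC.coe_mulLeft (C : H →L[ℂ] H) (X : TC H) :
    (TC.mulLeft C X : H →L[ℂ] H) = C.comp (X : H →L[ℂ] H) := rfl

/-- The map `X ↦ A X A*` on trace class operators. -/
def TC.conj (A : H →L[ℂ] L) : TC H →ₗ[ℂ] TC L where
  toFun X := ⟨A.comp ((X : H →L[ℂ] H).comp (adjoint A)), (traceNorm_comp_le _ _ _).trans_lt
    (ENNReal.mul_lt_top (ENNReal.mul_lt_top enorm_lt_top enorm_lt_top) X.2)⟩
  map_add' X Y := Subtype.ext (by ext; simp)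
  map_smul' c X := Subtype.ext (by ext; simp)

theorem TC.coe_conj (A : H →L[ℂ] L) (X : TC H) :
    (TC.conj A X : L →L[ℂ] L) = A.comp ((X : H →L[ℂ] H).comp (adjoint A)) := rfl

theorem TC.conj_isPositive (A : H →L[ℂ] L) {X : TC H} (hX : (X : H →L[ℂ] H).IsPositive) :
    (TC.conj A X : L →L[ℂ] L).IsPositive := hX.conj_adjoint A

theorem TC.trace_mulLeft_pos {N : H →L[ℂ] H} (hN : N.IsPositive) {X : TC H}
    (hX : (X : H →L[ℂ] H).IsPositive) :
    0 ≤ (trace (N.comp (X : H →L[ℂ] H))).re ∧ (trace (N.comp (X : H →L[ℂ] H))).im = 0 := by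
  obtain ⟨S, hS, hSX⟩ := exists_sqrt hX
  have hfin : traceNorm (S.comp S) < ⊤ := by rw [hSX]; exact X.2
  have h := traceNorm_comp_self_conj hS hfin (traceBasis H) N
  rw [hSX] at h
  have hz : ∀ z, 0 ≤ (inner ℂ z (N z)).re ∧ 0 = (inner ℂ z (N z)).im := fun z =>
    Complex.le_def.1 (hN.inner_nonneg_right z)
  refine ⟨(Complex.hasSum_re h).nonneg fun j => (hz _).1,
    (Complex.hasSum_im h).unique ?_⟩
  convert hasSum_zero with j
  exact (hz _).2.symm

/-- Both sides are linear in `X`, so `X = S²` may be assumed. With `Q = A S` the two sides are `tr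
(Q Q*)` and `tr (Q* Q)`, and `hasSum_inner_comm` applies. -/
theorem trace_conj_eq (A : H →L[ℂ] L) (X : TC H) :
    trace (TC.conj A X : L →L[ℂ] L) = trace (((adjoint A).comp A).comp (X : H →L[ℂ] H)) := by
  have : (trL L).comp (TC.conj A) = (trL H).comp (TC.mulLeft ((adjoint A).comp A)) := by
    refine TC.linearMap_ext fun X hX => ?_
    obtain ⟨S, hS, hSX⟩ := exists_sqrt hX
    have hfin : traceNorm (S.comp S) < ⊤ := by rw [hSX]; exact X.2
    have h1 := traceNorm_comp_self_conj hS hfin (traceBasis H) ((adjoint A).comp A)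
    have hs := hfin.ne
    rw [traceNorm_comp_self (traceBasis H) hS] at hs
    have hAS : ∑' i, ‖(A.comp S) (traceBasis H i)‖ₑ ^ 2 ≠ ⊤ := by
      refine ne_top_of_le_ne_top (ENNReal.mul_ne_top (a := ‖A‖ₑ ^ 2) (by simp) hs) ?_
      rw [← ENNReal.tsum_mul_left]
      refine ENNReal.tsum_le_tsum fun i => ?_
      rw [← mul_pow]
      gcongr
      exact A.le_opENorm _
    obtain ⟨s, h2, h3⟩ := hasSum_inner_comm (traceBasis H) (traceBasis L) _ _ hAS hAS
    have h4 := hasSum_trace (TC.conj A X).2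
    change trace (TC.conj A X : L →L[ℂ] L) = trace (((adjoint A).comp A).comp (X : H →L[ℂ] H))
    rw [hSX] at h1
    have e1 : s = trace (((adjoint A).comp A).comp (X : H →L[ℂ] H)) := by
      refine h2.unique ?_
      convert h1 using 2 with i
      simp only [ContinuousLinearMap.comp_apply]
      rw [ContinuousLinearMap.adjoint_inner_right]
    rw [← e1]
    refine h4.unique ?_
    convert h3 using 2 with j
    rw [TC.coe_conj, ← hSX, ContinuousLinearMap.adjoint_comp, hS]
    simp only [ContinuousLinearMap.comp_apply]
    rw [← ContinuousLinearMap.adjoint_inner_left, ← hS, ContinuousLinearMap.adjoint_inner_right, hS]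
  exact LinearMap.congr_fun this X

theorem trace_conj_isometry {A : H →L[ℂ] L} (hA : (adjoint A).comp A = .id ℂ H) (X : TC H) :
    trace (TC.conj A X : L →L[ℂ] L) = trace (X : H →L[ℂ] H) := by
  rw [trace_conj_eq, hA, ContinuousLinearMap.id_comp]

/-- For positive operators the trace is the trace norm. -/
theorem trace_eq_traceNorm {X : TC H} (hX : (X : H →L[ℂ] H).IsPositive) :
    trace (X : H →L[ℂ] H) = ((traceNorm (X : H →L[ℂ] H)).toReal : ℂ) := by
  obtain ⟨S, hS, hSX⟩ := exists_sqrt hX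
  have hfin : traceNorm (S.comp S) < ⊤ := by rw [hSX]; exact X.2
  have h := traceNorm_comp_self_conj hS hfin (traceBasis H) (.id ℂ H)
  rw [hSX, ContinuousLinearMap.id_comp] at h
  refine h.unique ?_
  rw [← hSX, traceNorm_comp_self (traceBasis H) hS]
  rw [traceNorm_comp_self (traceBasis H) hS] at hfin
  rw [ENNReal.tsum_toReal_eq fun i => by simp]
  have hsum := ENNReal.summable_toReal hfin.ne
  have e : (fun j => inner ℂ (S (traceBasis H j)) ((ContinuousLinearMap.id ℂ H) (S (traceBasis H j))))
      = fun j => (((‖S (traceBasis H j)‖ₑ ^ 2).toReal : ℝ) : ℂ) := by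
    funext j
    rw [ContinuousLinearMap.id_apply, inner_self_eq_norm_sq_to_K]
    simp
  rw [e]
  exact Complex.hasSum_ofReal.2 hsum.hasSum

theorem traceNorm_eq_ofReal_trace {X : TC H} (hX : (X : H →L[ℂ] H).IsPositive) :
    traceNorm (X : H →L[ℂ] H) = ENNReal.ofReal (trace (X : H →L[ℂ] H)).re := by
  rw [trace_eq_traceNorm hX, Complex.ofReal_re, ENNReal.ofReal_toReal X.2.ne]

theorem traceNorm_eq_tsum {ι : Type*} (b : HilbertBasis ι ℂ H) {X : H →L[ℂ] H}
    (hX : X.IsPositive) : traceNorm X = ∑' i, ENNReal.ofReal (inner ℂ (b i) (X (b i))).re := by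
  obtain ⟨S, hS, hSX⟩ := exists_sqrt hX
  rw [← hSX, traceNorm_comp_self b hS]
  refine tsum_congr fun i => ?_
  rw [ContinuousLinearMap.comp_apply, ← ContinuousLinearMap.adjoint_inner_left, hS,
    inner_self_eq_norm_sq_to_K, ← ofReal_norm, ← ENNReal.ofReal_pow (norm_nonneg _)]
  norm_cast

theorem re_inner_nonneg {X : H →L[ℂ] H} (hX : X.IsPositive) (x : H) :
    0 ≤ (inner ℂ x (X x)).re :=
  (Complex.le_def.1 (hX.inner_nonneg_right x)).1

/-- A positive map bounded on positive operators is bounded. -/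
theorem traceNorm_map_le {Φ : TC H →ₗ[ℂ] TC L} {c : ℝ≥0∞}
    (h : ∀ X : TC H, (X : H →L[ℂ] H).IsPositive →
      traceNorm (Φ X : L →L[ℂ] L) ≤ c * traceNorm (X : H →L[ℂ] H)) (X : TC H) :
    traceNorm (Φ X : L →L[ℂ] L) ≤ 4 * c * traceNorm (X : H →L[ℂ] H) := by
  obtain ⟨P, hP, hPn, hX⟩ := TC.exists_pos_decomp X
  have h1 : ∀ k, traceNorm (Φ (P k) : L →L[ℂ] L) ≤ c * traceNorm (X : H →L[ℂ] H) := fun k =>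
    (h _ (hP k)).trans (by gcongr; exact hPn k)
  have e : (Φ X : L →L[ℂ] L) = (Φ (P 0) : L →L[ℂ] L) - Φ (P 1)
      + Complex.I • ((Φ (P 2) : L →L[ℂ] L) - Φ (P 3)) := by
    conv_lhs => rw [hX]
    simp
  rw [e]
  refine (traceNorm_add_le _ _).trans ?_
  rw [traceNorm_smul]
  have hI : ‖Complex.I‖ₑ = 1 := by rw [← ofReal_norm]; simp
  rw [hI, one_mul]
  refine (add_le_add (traceNorm_sub_le _ _) (traceNorm_sub_le _ _)).trans ?_
  refine (add_le_add (add_le_add (h1 0) (h1 1)) (add_le_add (h1 2) (h1 3))).trans (le_of_eq ?_)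
  ring

end Decomposition

section Tensor

variable {H L K M : Type u} [NormedAddCommGroup H] [InnerProductSpace ℂ H] [CompleteSpace H]
  [NormedAddCommGroup L] [InnerProductSpace ℂ L] [CompleteSpace L]
  [NormedAddCommGroup K] [InnerProductSpace ℂ K] [CompleteSpace K]
  [NormedAddCommGroup M] [InnerProductSpace ℂ M] [CompleteSpace M]

/-! ### The Hilbert space tensor product -/

theorem inner_tensorRight (x y : K) (h h' : H) :
    inner ℂ (tensorRight H x h) (tensorRight H y h') = inner ℂ h h' * inner ℂ x y := by
  rw [tensorRight_apply, tensorRight_apply, UniformSpace.Completion.inner_coe,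
    TensorProduct.inner_tmul]

variable (K) in
/-- The operator `x ↦ h ⊗ x` from `K` to `H ⊗ K`. -/
def tensorLeft (h : H) : K →L[ℂ] HTensor H K :=
  (UniformSpace.Completion.toComplL (𝕜 := ℂ) (E := H ⊗[ℂ] K)).comp (TensorProduct.mkL ℂ H K h)

theorem tensorLeft_apply (x : K) (h : H) : tensorLeft K h x = tensorRight H x h := rfl

theorem HTensor.mem_of_tensorRight_mem {S : Submodule ℂ (HTensor H K)}
    (hS : IsClosed (S : Set (HTensor H K))) (h : ∀ x h, tensorRight H x h ∈ S) (z : HTensor H K) :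
    z ∈ S := by
  refine UniformSpace.Completion.induction_on (p := fun z => z ∈ S) z hS fun a => ?_
  induction a using TensorProduct.induction_on with
  | zero => rw [UniformSpace.Completion.coe_zero]; exact S.zero_mem
  | tmul x y => exact h y x
  | add x y hx hy => rw [UniformSpace.Completion.coe_add]; exact S.add_mem hx hy

theorem HTensor.clm_ext {V : Type*} [NormedAddCommGroup V] [NormedSpace ℂ V]
    {f g : HTensor H K →L[ℂ] V}
    (h : ∀ x y, f (tensorRight H x y) = g (tensorRight H x y)) : f = g := by
  ext z
  exact HTensor.mem_of_tensorRight_mem (S := LinearMap.eqLocus f.toLinearMap g.toLinearMap)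
    (isClosed_eq f.continuous g.continuous) h z

theorem HTensor.op_ext {X Y : HTensor H K →L[ℂ] HTensor L M}
    (h : ∀ x y a b, inner ℂ (tensorRight L x a) (X (tensorRight H y b)) =
      inner ℂ (tensorRight L x a) (Y (tensorRight H y b))) : X = Y := by
  refine HTensor.clm_ext fun y b => ?_
  have : innerSL ℂ (X (tensorRight H y b)) = innerSL ℂ (Y (tensorRight H y b)) := by
    refine HTensor.clm_ext fun x a => ?_
    rw [innerSL_apply_apply, innerSL_apply_apply, ← inner_conj_symm, h, inner_conj_symm]
  refine ext_inner_right ℂ fun v => ?_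
  rw [← innerSL_apply_apply, this, innerSL_apply_apply]

theorem map_mem_topologicalClosure {ι : Type*} (d : HilbertBasis ι ℂ H) (f : H →L[ℂ] L)
    {S : Submodule ℂ L} (hd : ∀ i, f (d i) ∈ S.topologicalClosure) (v : H) :
    f v ∈ S.topologicalClosure := by
  have hT : (Submodule.span ℂ (Set.range d)).topologicalClosure ≤
      S.topologicalClosure.comap f.toLinearMap := by
    refine Submodule.topologicalClosure_minimal _ ?_
      (S.isClosed_topologicalClosure.preimage f.continuous)
    rw [Submodule.span_le]
    rintro _ ⟨i, rfl⟩
    exact hd i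
  exact hT (by rw [d.dense_span]; trivial)

/-- The product of two orthonormal bases. -/
def productBasis {ι κ : Type*} (b : HilbertBasis ι ℂ H) (c : HilbertBasis κ ℂ K) :
    HilbertBasis (ι × κ) ℂ (HTensor H K) :=
  HilbertBasis.mk (v := fun p => tensorRight H (c p.2) (b p.1))
    ((b.orthonormal.tmul c.orthonormal).comp_linearIsometry
      (UniformSpace.Completion.toComplₗᵢ (𝕜 := ℂ) (E := H ⊗[ℂ] K))) (by
    intro z _
    refine HTensor.mem_of_tensorRight_mem (Submodule.isClosed_topologicalClosure _) ?_ z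
    intro x h
    refine map_mem_topologicalClosure c (tensorLeft K h) (fun j => ?_) x
    refine map_mem_topologicalClosure b (tensorRight H (c j)) (fun i => ?_) h
    exact Submodule.le_topologicalClosure _ (Submodule.subset_span ⟨(i, j), rfl⟩))

theorem productBasis_apply {ι κ : Type*} (b : HilbertBasis ι ℂ H) (c : HilbertBasis κ ℂ K)
    (p : ι × κ) : productBasis b c p = tensorRight H (c p.2) (b p.1) :=
  congrFun (HilbertBasis.coe_mk _ _) p

/-- The operator `A ⊗ B`. -/
def tmap (A : H →L[ℂ] L) (B : K →L[ℂ] M) : HTensor H K →L[ℂ] HTensor L M :=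
  ((UniformSpace.Completion.toComplL (𝕜 := ℂ) (E := L ⊗[ℂ] M)).comp
    (TensorProduct.mapL A B)).extend (UniformSpace.Completion.toComplL (𝕜 := ℂ) (E := H ⊗[ℂ] K))

theorem tmap_tensorRight (A : H →L[ℂ] L) (B : K →L[ℂ] M) (x : K) (h : H) :
    tmap A B (tensorRight H x h) = tensorRight L (B x) (A h) := by
  refine (ContinuousLinearMap.extend_eq _ ?_ ?_ (h ⊗ₜ[ℂ] x)).trans ?_
  · exact UniformSpace.Completion.denseRange_coe
  · exact UniformSpace.Completion.isUniformInducing_coe _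
  · rfl

theorem adjoint_tmap (A : H →L[ℂ] L) (B : K →L[ℂ] M) :
    adjoint (tmap A B) = tmap (adjoint A) (adjoint B) := by
  refine HTensor.op_ext fun x y a b => ?_
  rw [ContinuousLinearMap.adjoint_inner_right, tmap_tensorRight, tmap_tensorRight,
    inner_tensorRight, inner_tensorRight, ContinuousLinearMap.adjoint_inner_right,
    ContinuousLinearMap.adjoint_inner_right]

theorem tmap_comp {N R : Type u} [NormedAddCommGroup N] [InnerProductSpace ℂ N] [CompleteSpace N]
    [NormedAddCommGroup R] [InnerProductSpace ℂ R] [CompleteSpace R]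
    (A : H →L[ℂ] L) (B : K →L[ℂ] M) (C : L →L[ℂ] N) (D : M →L[ℂ] R) :
    (tmap C D).comp (tmap A B) = tmap (C.comp A) (D.comp B) :=
  HTensor.clm_ext fun x y => by
    rw [ContinuousLinearMap.comp_apply]; simp only [tmap_tensorRight]; rfl

theorem tmap_id : tmap (.id ℂ H) (.id ℂ K) = .id ℂ (HTensor H K) :=
  HTensor.clm_ext fun x y => by simp only [tmap_tensorRight]; rfl

theorem tmap_zero_right (A : H →L[ℂ] L) : tmap A (0 : K →L[ℂ] M) = 0 :=
  HTensor.clm_ext fun x y => by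
    rw [tmap_tensorRight, ← tensorLeft_apply]; simp

/-! ### Slices -/

theorem coe_slice (x y : K) (X : TC (HTensor H K)) :
    (slice x y X : H →L[ℂ] H) = (adjoint (tensorRight H x)).comp
      ((X : HTensor H K →L[ℂ] HTensor H K).comp (tensorRight H y)) := rfl

theorem inner_slice (x y : K) (X : TC (HTensor H K)) (a b : H) :
    inner ℂ a ((slice x y X : H →L[ℂ] H) b) =
      inner ℂ (tensorRight H x a) ((X : HTensor H K →L[ℂ] HTensor H K) (tensorRight H y b)) := by
  rw [coe_slice, ContinuousLinearMap.comp_apply, ContinuousLinearMap.adjoint_inner_right,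
    ContinuousLinearMap.comp_apply]

theorem TC.ext_inner {X Y : TC H}
    (h : ∀ a b, inner ℂ a ((X : H →L[ℂ] H) b) = inner ℂ a ((Y : H →L[ℂ] H) b)) : X = Y :=
  Subtype.ext (ContinuousLinearMap.ext fun b => ext_inner_left ℂ fun a => h a b)

/-- `slice` as a linear map. -/
def sliceL (x y : K) : TC (HTensor H K) →ₗ[ℂ] TC H where
  toFun := slice x y
  map_add' X Y := TC.ext_inner fun a b => by
    rw [inner_slice]
    simp [inner_add_right, inner_slice]
  map_smul' c X := TC.ext_inner fun a b => by
    rw [inner_slice]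
    simp [inner_smul_right, inner_slice]

theorem sliceL_apply (x y : K) (X : TC (HTensor H K)) : sliceL x y X = slice x y X := rfl

theorem slice_ext {X Y : TC (HTensor H K)} (h : ∀ x y, slice x y X = slice x y Y) : X = Y :=
  Subtype.ext <| HTensor.op_ext fun x y a b => by rw [← inner_slice, h, inner_slice]

theorem slice_isPositive (x : K) {X : TC (HTensor H K)}
    (hX : (X : HTensor H K →L[ℂ] HTensor H K).IsPositive) :
    (slice x x X : H →L[ℂ] H).IsPositive := hX.adjoint_conj _

theorem slice_conj_left (A : H →L[ℂ] L) (x y : K) (X : TC (HTensor H K)) :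
    slice x y (TC.conj (tmap A (.id ℂ K)) X) = TC.conj A (slice x y X) :=
  TC.ext_inner fun a b => by
    have h : inner ℂ a ((TC.conj A (slice x y X) : L →L[ℂ] L) b) =
        inner ℂ (adjoint A a) ((slice x y X : H →L[ℂ] H) (adjoint A b)) := by
      rw [TC.coe_conj, ContinuousLinearMap.comp_apply, ContinuousLinearMap.comp_apply,
        ContinuousLinearMap.adjoint_inner_left]
    rw [h, inner_slice, inner_slice, TC.coe_conj, ContinuousLinearMap.comp_apply,
      ContinuousLinearMap.comp_apply, ← ContinuousLinearMap.adjoint_inner_left, adjoint_tmap,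
      tmap_tensorRight, tmap_tensorRight, ContinuousLinearMap.adjoint_id]
    rfl

theorem slice_conj_right (B : K →L[ℂ] M) (x y : M) (X : TC (HTensor H K)) :
    slice x y (TC.conj (tmap (.id ℂ H) B) X) = slice (adjoint B x) (adjoint B y) X :=
  TC.ext_inner fun a b => by
    rw [inner_slice, TC.coe_conj, inner_slice]
    simp only [ContinuousLinearMap.comp_apply]
    rw [← ContinuousLinearMap.adjoint_inner_left, adjoint_tmap, tmap_tensorRight, tmap_tensorRight,
      ContinuousLinearMap.adjoint_id]
    rfl

/-- For positive operators the trace norm is the sum of the diagonal matrix elements, and a product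
basis groups these by the second factor. Properties of `Λ` on positive operators thereby pass to `Λ
⊗ 1`. -/
theorem traceNorm_eq_tsum_slice {κ : Type*} (c : HilbertBasis κ ℂ K) {X : TC (HTensor H K)}
    (hX : (X : HTensor H K →L[ℂ] HTensor H K).IsPositive) :
    traceNorm (X : HTensor H K →L[ℂ] HTensor H K) =
      ∑' j, traceNorm (slice (c j) (c j) X : H →L[ℂ] H) := by
  rw [traceNorm_eq_tsum (productBasis (traceBasis H) c) hX, ENNReal.tsum_prod', ENNReal.tsum_comm]
  refine tsum_congr fun j => ?_
  rw [traceNorm_eq_tsum (traceBasis H) (slice_isPositive (c j) hX)]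
  refine tsum_congr fun i => ?_
  rw [productBasis_apply, inner_slice]

/-! ### Ampliations -/

variable {Λ Λ' : TC H →ₗ[ℂ] TC L}

theorem IsAmpl.unique {X : TC (HTensor H K)} {Y Y' : TC (HTensor L K)} (h : IsAmpl Λ X Y)
    (h' : IsAmpl Λ X Y') : Y = Y' :=
  slice_ext fun x y => (h x y).trans (h' x y).symm

theorem IsAmpl.ampl_eq {X : TC (HTensor H K)} {Y : TC (HTensor L K)} (h : IsAmpl Λ X Y) :
    ampl Λ X = Y := by
  have hex : ∃ Y : TC (HTensor L K), IsAmpl Λ X Y := ⟨Y, h⟩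
  rw [ampl, dif_pos hex]
  exact hex.choose_spec.unique h

theorem isAmpl_ampl {X : TC (HTensor H K)} (h : ∃ Y : TC (HTensor L K), IsAmpl Λ X Y) :
    IsAmpl Λ X (ampl Λ X) := by
  rw [ampl, dif_pos h]
  exact h.choose_spec

theorem IsAmpl.add {X X' : TC (HTensor H K)} {Y Y' : TC (HTensor L K)} (h : IsAmpl Λ X Y)
    (h' : IsAmpl Λ X' Y') : IsAmpl Λ (X + X') (Y + Y') := fun x y => by
  simp only [← sliceL_apply, map_add]
  simp only [sliceL_apply, h x y, h' x y]

theorem IsAmpl.smul {X : TC (HTensor H K)} {Y : TC (HTensor L K)} (h : IsAmpl Λ X Y) (c : ℂ) :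
    IsAmpl Λ (c • X) (c • Y) := fun x y => by
  simp only [← sliceL_apply, map_smul]
  simp only [sliceL_apply, h x y]

theorem IsAmpl.add_left {X : TC (HTensor H K)} {Y Y' : TC (HTensor L K)} (h : IsAmpl Λ X Y)
    (h' : IsAmpl Λ' X Y') : IsAmpl (Λ + Λ') X (Y + Y') := fun x y => by
  rw [← sliceL_apply, map_add]
  simp only [sliceL_apply, h x y, h' x y, LinearMap.add_apply]

theorem IsAmpl.smul_left {X : TC (HTensor H K)} {Y : TC (HTensor L K)} (h : IsAmpl Λ X Y) (c : ℂ) :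
    IsAmpl (c • Λ) X (c • Y) := fun x y => by
  rw [← sliceL_apply, map_smul]
  simp only [sliceL_apply, h x y, LinearMap.smul_apply]

theorem IsAmpl.comp {X : TC (HTensor H K)} {Y : TC (HTensor L K)} {Z : TC (HTensor M K)}
    {Φ : TC L →ₗ[ℂ] TC M} (h : IsAmpl Λ X Y) (h' : IsAmpl Φ Y Z) : IsAmpl (Φ.comp Λ) X Z :=
  fun x y => by rw [h' x y, h x y, LinearMap.comp_apply]

/-- `Λ` and `B` act on different tensor factors: slicing after conjugation by `1 ⊗ B` is slicing
along `B* x`, `B* y` before. This is why register embeddings commute with the unknown map. -/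
theorem IsAmpl.conj_right {X : TC (HTensor H K)} {Y : TC (HTensor L K)} (h : IsAmpl Λ X Y)
    (B : K →L[ℂ] M) :
    IsAmpl Λ (TC.conj (tmap (.id ℂ H) B) X) (TC.conj (tmap (.id ℂ L) B) Y) := fun x y => by
  rw [slice_conj_right, slice_conj_right, h]

/-! ### Complete positivity -/

/-- Complete positivity with a one-dimensional ancilla: `X` is embedded as `X ⊗ |a⟩⟨a|` and
recovered by slicing along the unit vector `a`. -/
theorem IsCP.isPositive (h : IsCP Λ) {X : TC H} (hX : (X : H →L[ℂ] H).IsPositive) :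
    (Λ X : L →L[ℂ] L).IsPositive := by
  -- Indexed by `PUnit` so that the ancilla lies in the required universe.
  let A : Type u := EuclideanSpace ℂ PUnit.{u + 1}
  let a : A := EuclideanSpace.single PUnit.unit 1
  have ha : inner ℂ a a = 1 := by
    have hn : ‖(EuclideanSpace.single PUnit.unit 1 : EuclideanSpace ℂ PUnit.{u + 1})‖ = 1 := by simp
    rw [inner_self_eq_norm_sq_to_K, hn]
    simp
  let J := tensorRight H a
  obtain ⟨Y, hY, hYpos⟩ := h A (TC.conj J X) (TC.conj_isPositive J hX)
  have e : slice a a (TC.conj J X) = X := by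
    refine TC.ext_inner fun b c => ?_
    rw [inner_slice, TC.coe_conj]
    simp only [ContinuousLinearMap.comp_apply]
    have hJ : ∀ c, adjoint J (tensorRight H a c) = c := fun c => by
      refine ext_inner_left ℂ fun v => ?_
      rw [ContinuousLinearMap.adjoint_inner_right, inner_tensorRight, ha, mul_one]
    rw [hJ, ← ContinuousLinearMap.adjoint_inner_left, hJ]
  have := hY a a
  rw [e] at this
  rw [← this]
  exact slice_isPositive a hYpos

theorem isCP_add (h : IsCP Λ) (h' : IsCP Λ') : IsCP (Λ + Λ') := by
  intro K _ _ _ _ X hX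
  obtain ⟨Y, hY, hYp⟩ := h K X hX
  obtain ⟨Y', hY', hYp'⟩ := h' K X hX
  exact ⟨Y + Y', hY.add_left hY', hYp.add hYp'⟩

theorem isCP_zero : IsCP (0 : TC H →ₗ[ℂ] TC L) := by
  intro K _ _ _ _ X hX
  exact ⟨0, fun x y => (sliceL x y).map_zero, ContinuousLinearMap.isPositive_zero⟩

theorem isCP_sum {ι : Type*} (s : Finset ι) {Φ : ι → TC H →ₗ[ℂ] TC L} (h : ∀ i ∈ s, IsCP (Φ i)) :
    IsCP (∑ i ∈ s, Φ i) := by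
  classical
  induction s using Finset.induction_on with
  | empty => simpa using isCP_zero
  | insert a s ha ih =>
    rw [Finset.sum_insert ha]
    exact isCP_add (h a (Finset.mem_insert_self a s))
      (ih fun i hi => h i (Finset.mem_insert_of_mem hi))

theorem IsCP.comp {Φ : TC L →ₗ[ℂ] TC M} (h' : IsCP Φ) (h : IsCP Λ) : IsCP (Φ.comp Λ) := by
  intro K _ _ _ _ X hX
  obtain ⟨Y, hY, hYp⟩ := h K X hX
  obtain ⟨Z, hZ, hZp⟩ := h' K Y hYp
  exact ⟨Z, hY.comp hZ, hZp⟩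

theorem isCP_conj (A : H →L[ℂ] L) : IsCP (TC.conj A) := by
  intro K _ _ _ _ X hX
  exact ⟨TC.conj (tmap A (.id ℂ K)) X, fun x y => slice_conj_left A x y X,
    TC.conj_isPositive _ hX⟩

theorem traceNorm_eq_tsum_of_hasSum {κ : Type*} {A : H →L[ℂ] H} {B : κ → H →L[ℂ] H}
    (h : ∀ x y, HasSum (fun k => inner ℂ x (B k y)) (inner ℂ x (A y)))
    (hB : ∀ k, (B k).IsPositive) (hA : A.IsPositive) : ∑' k, traceNorm (B k) = traceNorm A := by
  simp_rw [traceNorm_eq_tsum (traceBasis H) hA, traceNorm_eq_tsum (traceBasis H) (hB _)]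
  rw [ENNReal.tsum_comm]
  refine tsum_congr fun i => ?_
  have h1 := Complex.hasSum_re (h (traceBasis H i) (traceBasis H i))
  rw [← h1.tsum_eq, ENNReal.ofReal_tsum_of_nonneg (fun k => re_inner_nonneg (hB k) _) h1.summable]

theorem isPositive_of_hasSum {κ : Type*} {A : H →L[ℂ] H} {B : κ → H →L[ℂ] H}
    (h : ∀ x y, HasSum (fun k => inner ℂ x (B k y)) (inner ℂ x (A y)))
    (hB : ∀ k, (B k).IsPositive) : A.IsPositive := by
  rw [ContinuousLinearMap.isPositive_iff_complex]
  intro x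
  have h1 := h x x
  have h2 : ∀ k, (inner ℂ x (B k x)).im = 0 := fun k =>
    (Complex.le_def.1 ((hB k).inner_nonneg_right x)).2.symm
  have him : (inner ℂ x (A x)).im = 0 := by
    refine (Complex.hasSum_im h1).unique ?_
    simp_rw [h2]
    exact hasSum_zero
  have hre : 0 ≤ (inner ℂ x (A x)).re :=
    (Complex.hasSum_re h1).nonneg fun k => re_inner_nonneg (hB k) x
  have e : inner ℂ (A x) x = starRingEnd ℂ (inner ℂ x (A x)) := (inner_conj_symm _ _).symm
  rw [e]
  generalize inner ℂ x (A x) = w at him hre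
  exact ⟨Complex.ext (by simp) (by simp [him]), by simpa using hre⟩

/-- The bound on positive operators, read slice by slice, makes the trace norms of the ampliated
terms summable. Hence they sum in operator norm to a positive trace class operator, and its slices
are the weak sums, that is, the values of `Φ`. -/
theorem isCP_of_hasSum {κ : Type*} {Φ : TC H →ₗ[ℂ] TC L} {Ψ : κ → TC H →ₗ[ℂ] TC L}
    (hΨ : ∀ k, IsCP (Ψ k))
    (h : ∀ (X : TC H) (x y : L), HasSum (fun k => inner ℂ x ((Ψ k X : L →L[ℂ] L) y))
      (inner ℂ x ((Φ X : L →L[ℂ] L) y)))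
    {c : ℝ≥0∞} (hc : c ≠ ⊤) (hΦ : ∀ Z : TC H, (Z : H →L[ℂ] H).IsPositive →
      traceNorm (Φ Z : L →L[ℂ] L) ≤ c * traceNorm (Z : H →L[ℂ] H)) : IsCP Φ := by
  intro K _ _ _ _ X hX
  choose Y hY hYp using fun k => hΨ k K X hX
  have hbound : ∑' k, traceNorm (Y k : HTensor L K →L[ℂ] HTensor L K) ≤
      c * traceNorm (X : HTensor H K →L[ℂ] HTensor H K) := by
    simp_rw [traceNorm_eq_tsum_slice (traceBasis K) hX,
      fun k => traceNorm_eq_tsum_slice (traceBasis K) (hYp k)]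
    rw [ENNReal.tsum_comm, ← ENNReal.tsum_mul_left]
    refine ENNReal.tsum_le_tsum fun j => ?_
    simp_rw [hY _ _ _]
    have hs := slice_isPositive (traceBasis K j) hX
    rw [traceNorm_eq_tsum_of_hasSum (h _) (fun k => (hΨ k).isPositive hs)
      (isPositive_of_hasSum (h _) fun k => (hΨ k).isPositive hs)]
    exact hΦ _ hs
  have hlt := hbound.trans_lt (ENNReal.mul_lt_top hc.lt_top X.2)
  have hsum : Summable fun k => (Y k : HTensor L K →L[ℂ] HTensor L K) := by
    refine Summable.of_norm ?_
    have h2 : ∑' k, ‖(Y k : HTensor L K →L[ℂ] HTensor L K)‖ₑ ≠ ⊤ :=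
      ne_top_of_le_ne_top hlt.ne (ENNReal.tsum_le_tsum fun k => opENorm_le_traceNorm _)
    simpa using ENNReal.summable_toReal h2
  obtain ⟨T, hT⟩ := hsum
  have hTin : ∀ x y, HasSum (fun k => inner ℂ x ((Y k : HTensor L K →L[ℂ] HTensor L K) y))
      (inner ℂ x (T y)) := fun x y => by
    have h3 := (ContinuousLinearMap.apply ℂ (HTensor L K) y).hasSum hT
    exact (innerSL ℂ x).hasSum h3
  refine ⟨⟨T, (traceNorm_le_tsum hTin).trans_lt hlt⟩, fun x y => ?_, isPositive_of_hasSum hTin hYp⟩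
  refine TC.ext_inner fun a b => ?_
  rw [inner_slice]
  refine (hTin _ _).unique ?_
  simp_rw [← inner_slice, hY _ x y]
  exact h _ a b

end Tensor

section Channels

variable {H L K M : Type u} [NormedAddCommGroup H] [InnerProductSpace ℂ H] [CompleteSpace H]
  [NormedAddCommGroup L] [InnerProductSpace ℂ L] [CompleteSpace L]
  [NormedAddCommGroup K] [InnerProductSpace ℂ K] [CompleteSpace K]
  [NormedAddCommGroup M] [InnerProductSpace ℂ M] [CompleteSpace M]

/-! ### Channels -/

theorem IsCPTP.traceNorm_eq {Φ : TC H →ₗ[ℂ] TC L} (h : IsCPTP Φ) {X : TC H}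
    (hX : (X : H →L[ℂ] H).IsPositive) :
    traceNorm (Φ X : L →L[ℂ] L) = traceNorm (X : H →L[ℂ] H) := by
  rw [traceNorm_eq_ofReal_trace hX, traceNorm_eq_ofReal_trace (h.cp.isPositive hX), h.tp]

theorem IsCPTP.traceNorm_le {Φ : TC H →ₗ[ℂ] TC L} (h : IsCPTP Φ) (X : TC H) :
    traceNorm (Φ X : L →L[ℂ] L) ≤ 4 * traceNorm (X : H →L[ℂ] H) := by
  simpa using traceNorm_map_le (c := 1) (fun X hX => by rw [h.traceNorm_eq hX, one_mul]) X

/-- `Λ ⊗ 1` exists for all ancillas and is bounded by `c`. -/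
def AmplBound (Λ : TC H →ₗ[ℂ] TC L) (c : ℝ≥0∞) : Prop :=
  ∀ (K : Type u) [NormedAddCommGroup K] [InnerProductSpace ℂ K] [CompleteSpace K]
    [TopologicalSpace.SeparableSpace K] (X : TC (HTensor H K)),
    ∃ Y : TC (HTensor L K), IsAmpl Λ X Y ∧ traceNorm (Y : HTensor L K →L[ℂ] HTensor L K) ≤
      c * traceNorm (X : HTensor H K →L[ℂ] HTensor H K)

theorem IsCPTP.isAmpl_pos {Λ : TC H →ₗ[ℂ] TC L} (h : IsCPTP Λ)
    [TopologicalSpace.SeparableSpace K] {X : TC (HTensor H K)}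
    (hX : (X : HTensor H K →L[ℂ] HTensor H K).IsPositive) :
    IsAmpl Λ X (ampl Λ X) ∧ (ampl Λ X : HTensor L K →L[ℂ] HTensor L K).IsPositive ∧
      traceNorm (ampl Λ X : HTensor L K →L[ℂ] HTensor L K) =
        traceNorm (X : HTensor H K →L[ℂ] HTensor H K) := by
  obtain ⟨Y, hY, hYp⟩ := h.cp K X hX
  rw [hY.ampl_eq]
  refine ⟨hY, hYp, ?_⟩
  rw [traceNorm_eq_tsum_slice (traceBasis K) hX, traceNorm_eq_tsum_slice (traceBasis K) hYp]
  refine tsum_congr fun j => ?_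
  rw [hY, h.traceNorm_eq (slice_isPositive _ hX)]

/-- On positive operators the ampliation preserves the trace norm; the four pieces of a general
operator give the factor `4`. Any finite constant would serve. -/
theorem IsCPTP.amplBound {Λ : TC H →ₗ[ℂ] TC L} (h : IsCPTP Λ) : AmplBound Λ 4 := by
  intro K _ _ _ _ X
  obtain ⟨P, hP, hPn, hX⟩ := TC.exists_pos_decomp X
  have h1 := fun k => h.isAmpl_pos (hP k)
  refine ⟨ampl Λ (P 0) + (-1 : ℂ) • ampl Λ (P 1) +
    Complex.I • (ampl Λ (P 2) + (-1 : ℂ) • ampl Λ (P 3)), ?_, ?_⟩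
  · have h2 := ((h1 0).1.add ((h1 1).1.smul (-1))).add
      (((h1 2).1.add ((h1 3).1.smul (-1))).smul Complex.I)
    have e : P 0 + (-1 : ℂ) • P 1 + Complex.I • (P 2 + (-1 : ℂ) • P 3) = X := by
      rw [hX]; module
    rwa [e] at h2
  · have hb : ∀ k, traceNorm (ampl Λ (P k) : HTensor L K →L[ℂ] HTensor L K) ≤
        traceNorm (X : HTensor H K →L[ℂ] HTensor H K) := fun k => (h1 k).2.2.trans_le (hPn k)
    have hI : ‖Complex.I‖ₑ = 1 := by rw [← ofReal_norm]; simp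
    have hm : ‖(-1 : ℂ)‖ₑ = 1 := by rw [← ofReal_norm]; simp
    refine (traceNorm_add_le _ _).trans ?_
    rw [Submodule.coe_smul, traceNorm_smul, hI, one_mul]
    refine (add_le_add (traceNorm_add_le _ _) (traceNorm_add_le _ _)).trans ?_
    rw [Submodule.coe_smul, Submodule.coe_smul, traceNorm_smul, traceNorm_smul, hm, one_mul, one_mul]
    refine (add_le_add (add_le_add (hb 0) (hb 1)) (add_le_add (hb 2) (hb 3))).trans (le_of_eq ?_)
    ring

theorem isCPTP_conj_comp {Φ : TC H →ₗ[ℂ] TC L} (h : IsCPTP Φ) {W : L →L[ℂ] M}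
    (hW : (adjoint W).comp W = .id ℂ L) : IsCPTP ((TC.conj W).comp Φ) :=
  ⟨(isCP_conj W).comp h.cp, fun X => by rw [LinearMap.comp_apply, trace_conj_isometry hW, h.tp]⟩

/-- The map `X ↦ tr(F X) τ`. -/
def measPrep (F : H →L[ℂ] H) (τ : TC L) : TC H →ₗ[ℂ] TC L :=
  ((trL H).comp (TC.mulLeft F)).smulRight τ

theorem measPrep_apply (F : H →L[ℂ] H) (τ : TC L) (X : TC H) :
    measPrep F τ X = trace (F.comp (X : H →L[ℂ] H)) • τ := rfl

theorem inner_apply_of_adjoint_eq {S : H →L[ℂ] H} (hS : adjoint S = S) (x y : H) :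
    inner ℂ x (S y) = inner ℂ (S x) y := by
  rw [← ContinuousLinearMap.adjoint_inner_left, hS]

theorem inner_conj_rankOne (s : H) (r x y : L) (X : TC H) :
    inner ℂ x ((TC.conj ((innerSL ℂ s).smulRight r) X : L →L[ℂ] L) y) =
      inner ℂ s ((X : H →L[ℂ] H) s) * (inner ℂ x r * inner ℂ r y) := by
  have hadj : adjoint ((innerSL ℂ s).smulRight r) y = inner ℂ r y • s := by
    refine ext_inner_left ℂ fun v => ?_
    rw [ContinuousLinearMap.adjoint_inner_right, inner_smul_right,
      ContinuousLinearMap.smulRight_apply, innerSL_apply_apply, inner_smul_left, inner_conj_symm,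
      mul_comm]
  rw [TC.coe_conj, ContinuousLinearMap.comp_apply, ContinuousLinearMap.comp_apply, hadj,
    ContinuousLinearMap.smulRight_apply, innerSL_apply_apply, map_smul, inner_smul_right,
    inner_smul_right]
  ring

theorem hasSum_mul_complex {ι κ : Type*} {f : ι → ℂ} {g : κ → ℂ} {a b : ℂ} (ha : HasSum f a)
    (hb : HasSum g b) : HasSum (fun p : ι × κ => f p.1 * g p.2) (a * b) :=
  ha.mul hb (summable_mul_of_summable_norm ha.summable.norm hb.summable.norm)

theorem hasSum_conj_rankOne {ι κ : Type*} {s : ι → H} {r : κ → L} {X : TC H} {x y : L} {a b : ℂ}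
    (ha : HasSum (fun i => inner ℂ (s i) ((X : H →L[ℂ] H) (s i))) a)
    (hb : HasSum (fun j => inner ℂ x (r j) * inner ℂ (r j) y) b) :
    HasSum (fun p : ι × κ => inner ℂ x
      ((TC.conj ((innerSL ℂ (s p.1)).smulRight (r p.2)) X : L →L[ℂ] L) y)) (a * b) := by
  have h := hasSum_mul_complex ha hb
  have e : (fun p : ι × κ => inner ℂ x
      ((TC.conj ((innerSL ℂ (s p.1)).smulRight (r p.2)) X : L →L[ℂ] L) y)) = fun p : ι × κ =>
      inner ℂ (s p.1) ((X : H →L[ℂ] H) (s p.1)) * (inner ℂ x (r p.2) * inner ℂ (r p.2) y) :=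
    funext fun p => inner_conj_rankOne _ _ _ _ _
  rw [e]
  exact h

/-- Kraus form: with `F = S²` and `τ = R²`, the map is the weakly convergent sum of the conjugations
by the rank one operators `|R e_j⟩⟨S b_i|`. -/
theorem isCP_measPrep {F : H →L[ℂ] H} (hF : F.IsPositive) {τ : TC L}
    (hτ : (τ : L →L[ℂ] L).IsPositive) : IsCP (measPrep F τ) := by
  obtain ⟨S, hS, hSF⟩ := exists_sqrt hF
  obtain ⟨R, hR, hRτ⟩ := exists_sqrt hτ
  have h1 : ∀ X : TC H, HasSum (fun i => inner ℂ (S (traceBasis H i))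
      ((X : H →L[ℂ] H) (S (traceBasis H i)))) (trace (F.comp (X : H →L[ℂ] H))) := by
    intro X
    have h := hasSum_trace (TC.conj S X).2
    rw [trace_conj_eq, hS, hSF, TC.coe_conj, hS] at h
    simp only [ContinuousLinearMap.comp_apply, inner_apply_of_adjoint_eq hS] at h
    exact h
  have h2 : ∀ x y, HasSum (fun j => inner ℂ x (R (traceBasis L j)) * inner ℂ (R (traceBasis L j)) y)
      (inner ℂ x ((τ : L →L[ℂ] L) y)) := by
    intro x y
    have h := (traceBasis L).hasSum_inner_mul_inner (R x) (R y)
    simp only [← inner_apply_of_adjoint_eq hR x] at h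
    simp only [inner_apply_of_adjoint_eq hR _ y] at h
    rw [← hRτ, ContinuousLinearMap.comp_apply]
    exact h
  refine isCP_of_hasSum (Ψ := fun p : _ × _ =>
    TC.conj ((innerSL ℂ (S (traceBasis H p.1))).smulRight (R (traceBasis L p.2))))
    (fun p => isCP_conj _) (c := ‖F‖ₑ * traceNorm (τ : L →L[ℂ] L)) ?_
    (ENNReal.mul_lt_top enorm_lt_top τ.2).ne ?_
  · intro X x y
    rw [measPrep_apply, Submodule.coe_smul, _root_.smul_apply, inner_smul_right]
    have h := hasSum_conj_rankOne (s := fun i => S (traceBasis H i))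
      (r := fun j => R (traceBasis L j)) (h1 X) (h2 x y)
    exact h
  · intro Z hZ
    rw [measPrep_apply, Submodule.coe_smul, traceNorm_smul, mul_right_comm]
    gcongr
    exact (enorm_trace_le _).trans (traceNorm_comp_left_le _ _)

theorem isCPTP_sum_measPrep {ι : Type*} [Fintype ι] {F : ι → H →L[ℂ] H} {τ : ι → TC L}
    (hF : ∀ i, (F i).IsPositive) (hF1 : ∑ i, F i = 1)
    (hτ : ∀ i, (τ i : L →L[ℂ] L).IsPositive) (hτ1 : ∀ i, trace (τ i : L →L[ℂ] L) = 1) :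
    IsCPTP (∑ i, measPrep (F i) (τ i)) := by
  refine ⟨isCP_sum _ fun i _ => isCP_measPrep (hF i) (hτ i), fun X => ?_⟩
  rw [← trL_apply, LinearMap.sum_apply, map_sum]
  simp_rw [measPrep_apply, map_smul, trL_apply, hτ1, smul_eq_mul, mul_one]
  have : ∑ i, TC.mulLeft (F i) X = X := by
    ext1
    rw [AddSubmonoidClass.coe_finsetSum]
    simp_rw [TC.coe_mulLeft]
    ext x
    have := congrArg (fun T : H →L[ℂ] H => T ((X : H →L[ℂ] H) x)) hF1
    simpa using this
  conv_rhs => rw [← this]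
  rw [← trL_apply, map_sum]
  rfl

theorem TC.conj_conj (A : H →L[ℂ] L) (B : L →L[ℂ] M) (X : TC H) :
    TC.conj B (TC.conj A X) = TC.conj (B.comp A) X := by
  ext1
  simp only [TC.coe_conj, ContinuousLinearMap.adjoint_comp]
  rfl

theorem TC.conj_id (X : TC H) : TC.conj (.id ℂ H) X = X := by
  ext1
  rw [TC.coe_conj, ContinuousLinearMap.adjoint_id]; rfl

theorem TC.conj_zero (X : TC H) : TC.conj (0 : H →L[ℂ] L) X = 0 := by
  ext1
  rw [TC.coe_conj]; simp

theorem sum_comp_adjoint_comp {ι : Type*} [Fintype ι] [DecidableEq ι] {J : ι → H →L[ℂ] L}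
    (hJ : ∀ i j, (adjoint (J i)).comp (J j) = if i = j then .id ℂ H else 0) (j : ι) :
    (∑ i, (J i).comp (adjoint (J i))).comp (J j) = J j := by
  ext x
  have h1 : ∀ i, adjoint (J i) (J j x) = if i = j then x else 0 := by
    intro i
    have := congrArg (fun T : H →L[ℂ] H => T x) (hJ i j)
    split_ifs with h <;> simpa [h] using this
  have h2 : (∑ i, (J i).comp (adjoint (J i))) (J j x) = ∑ i, J i (adjoint (J i) (J j x)) := by simp
  rw [ContinuousLinearMap.comp_apply, h2, Finset.sum_eq_single j]
  · rw [h1, if_pos rfl]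
  · intro i _ hi
    rw [h1, if_neg hi, map_zero]
  · simp

/-- The ranges of the isometries `J i` are orthogonal, so the sum `P` is a projection and `1 - P =
(1 - P)* (1 - P)`. -/
theorem isPositive_one_sub_sum {ι : Type*} [Fintype ι] [DecidableEq ι] {J : ι → H →L[ℂ] L}
    (hJ : ∀ i j, (adjoint (J i)).comp (J j) = if i = j then .id ℂ H else 0) :
    (1 - ∑ i, (J i).comp (adjoint (J i))).IsPositive := by
  let P : L →L[ℂ] L := ∑ i, (J i).comp (adjoint (J i))
  have hPJ : ∀ j, P.comp (J j) = J j := sum_comp_adjoint_comp hJ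
  have hPa : adjoint P = P := by
    simp [P, map_sum, ContinuousLinearMap.adjoint_comp]
  have hPP : P.comp P = P := by
    have : P.comp P = ∑ i, (P.comp (J i)).comp (adjoint (J i)) := by
      conv_lhs => rw [show P.comp P = P.comp (∑ i, (J i).comp (adjoint (J i))) from rfl]
      ext x; simp
    rw [this]
    simp_rw [hPJ]
    rfl
  have e : (adjoint (1 - P)).comp (1 - P) = 1 - P := by
    have h1 : adjoint (1 - P) = 1 - P := by
      rw [map_sub, hPa]; congr 1; exact ContinuousLinearMap.adjoint_id
    rw [h1]
    change (1 - P) * (1 - P) = 1 - P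
    have h2 : P * P = P := hPP
    rw [mul_sub, sub_mul, sub_mul, h2]; simp
  rw [← e]
  exact ContinuousLinearMap.isPositive_adjoint_comp_self _

/-- Channels on mutually orthogonal subspaces can be combined into one channel. -/
theorem exists_glue {ι : Type*} [Fintype ι] [DecidableEq ι] {J : ι → H →L[ℂ] L}
    (hJ : ∀ i j, (adjoint (J i)).comp (J j) = if i = j then .id ℂ H else 0)
    {Φ : ι → TC H →ₗ[ℂ] TC M} (hΦ : ∀ i, IsCPTP (Φ i)) {τ : TC M}
    (hτ : (τ : M →L[ℂ] M).IsPositive) (hτ1 : trace (τ : M →L[ℂ] M) = 1) :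
    ∃ Ψ : TC L →ₗ[ℂ] TC M, IsCPTP Ψ ∧ ∀ i X, Ψ (TC.conj (J i) X) = Φ i X := by
  let P : L →L[ℂ] L := ∑ i, (J i).comp (adjoint (J i))
  have hPJ : ∀ j, P.comp (J j) = J j := sum_comp_adjoint_comp hJ
  have hF : (1 - P).IsPositive := isPositive_one_sub_sum hJ
  -- Compress to each block and apply its channel. Weight outside all blocks is replaced by the
  -- fixed state `τ`, which restores trace preservation and is invisible on operators supported in a
  -- block.
  refine ⟨∑ i, (Φ i).comp (TC.conj (adjoint (J i))) + measPrep (1 - P) τ, ⟨?_, ?_⟩, ?_⟩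
  · exact isCP_add (isCP_sum _ fun i _ => (hΦ i).cp.comp (isCP_conj _)) (isCP_measPrep hF hτ)
  · intro X
    rw [← trL_apply, LinearMap.add_apply, LinearMap.sum_apply, map_add, map_sum, measPrep_apply,
      map_smul, trL_apply, hτ1, smul_eq_mul, mul_one]
    simp_rw [LinearMap.comp_apply, trL_apply, (hΦ _).tp, trace_conj_eq,
      ContinuousLinearMap.adjoint_adjoint]
    have h1 : (∑ i, TC.mulLeft ((J i).comp (adjoint (J i))) X) + TC.mulLeft (1 - P) X = X := by
      ext1
      rw [Submodule.coe_add, AddSubmonoidClass.coe_finsetSum]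
      simp_rw [TC.coe_mulLeft]
      ext x
      simp [P]
    have h2 := congrArg (trL L) h1
    rw [map_add, map_sum] at h2
    exact h2
  · intro i X
    rw [LinearMap.add_apply, LinearMap.sum_apply]
    simp_rw [LinearMap.comp_apply, TC.conj_conj, hJ]
    rw [Finset.sum_eq_single i]
    · rw [if_pos rfl, TC.conj_id, measPrep_apply, TC.coe_conj]
      have : (1 - P).comp ((J i).comp ((X : H →L[ℂ] H).comp (adjoint (J i)))) = 0 := by
        rw [← ContinuousLinearMap.comp_assoc, ContinuousLinearMap.sub_comp, hPJ]
        ext x; simp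
      rw [this]
      have h0 : trace (0 : L →L[ℂ] L) = 0 := by simp [trace]
      rw [h0, zero_smul, add_zero]
    · intro j _ hj
      rw [if_neg hj, TC.conj_zero, map_zero]
    · simp

end Channels

/-! ### The distribution of the data -/

section Law

variable {l : ℕ} {L : Type u} [NormedAddCommGroup L] [InnerProductSpace ℂ L] [CompleteSpace L]

theorem POVM.effect_empty (M : POVM l L) : M.effect ∅ = 0 := by
  ext y
  refine ext_inner_left ℂ fun x => ?_
  have h := M.hasSum_effect (fun _ => ∅) (fun _ => MeasurableSet.empty)
    (fun _ _ _ => disjoint_bot_left) x y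
  -- A constant sequence over `ℕ` is summable only if the constant is `0`.
  have h2 := (summable_const_iff (β := ℕ) _).1 h.summable
  rw [h2]; simp

/-- The measure `Δ ↦ ⟨x, M(Δ) x⟩`. -/
def POVM.vectorLaw (M : POVM l L) (x : L) : Measure (EuclideanSpace ℝ (Fin l)) :=
  Measure.ofMeasurable (fun Δ _ => ENNReal.ofReal (inner ℂ x (M.effect Δ x)).re)
    (by simp [M.effect_empty])
    (fun A hA hd => by
      have h := Complex.hasSum_re (M.hasSum_effect A hA hd x x)
      rw [← h.tsum_eq, ENNReal.ofReal_tsum_of_nonneg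
        (fun i => re_inner_nonneg (M.isPositive _ (hA i)) x) h.summable])

theorem POVM.vectorLaw_apply (M : POVM l L) (x : L) {Δ : Set (EuclideanSpace ℝ (Fin l))}
    (hΔ : MeasurableSet Δ) : M.vectorLaw x Δ = ENNReal.ofReal (inner ℂ x (M.effect Δ x)).re :=
  Measure.ofMeasurable_apply Δ hΔ

/-- The law is defined by choice, so a measure with these values must be exhibited. With `X = S²` it
is the sum over a basis of the measures `Δ ↦ ⟨S b_i, M(Δ) S b_i⟩`. -/
theorem POVM.law_apply (M : POVM l L) {X : TC L} (hX : (X : L →L[ℂ] L).IsPositive)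
    {Δ : Set (EuclideanSpace ℝ (Fin l))} (hΔ : MeasurableSet Δ) :
    M.law X Δ = ENNReal.ofReal (trace ((M.effect Δ).comp (X : L →L[ℂ] L))).re := by
  have hex : ∃ μ : Measure (EuclideanSpace ℝ (Fin l)), ∀ Δ, MeasurableSet Δ →
      μ Δ = ENNReal.ofReal (trace ((M.effect Δ).comp (X : L →L[ℂ] L))).re := by
    obtain ⟨S, hS, hSX⟩ := exists_sqrt hX
    have hfin : traceNorm (S.comp S) < ⊤ := by rw [hSX]; exact X.2
    refine ⟨Measure.sum fun i => M.vectorLaw (S (traceBasis L i)), fun Δ hΔ => ?_⟩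
    have h := Complex.hasSum_re (traceNorm_comp_self_conj hS hfin (traceBasis L) (M.effect Δ))
    rw [Measure.sum_apply _ hΔ, ← hSX, ← h.tsum_eq, ENNReal.ofReal_tsum_of_nonneg
        (fun i => re_inner_nonneg (M.isPositive _ hΔ) _) h.summable]
    exact tsum_congr fun i => M.vectorLaw_apply _ hΔ
  rw [POVM.law, dif_pos hex]
  exact hex.choose_spec Δ hΔ

theorem POVM.law_univ (M : POVM l L) {X : TC L} (hX : (X : L →L[ℂ] L).IsPositive) :
    M.law X Set.univ = traceNorm (X : L →L[ℂ] L) := by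
  rw [M.law_apply hX MeasurableSet.univ, M.effect_univ, traceNorm_eq_ofReal_trace hX]
  rfl

theorem POVM.isFiniteMeasure_law (M : POVM l L) {X : TC L} (hX : (X : L →L[ℂ] L).IsPositive) :
    IsFiniteMeasure (M.law X) :=
  ⟨by rw [M.law_univ hX]; exact X.2⟩

theorem POVM.real_law (M : POVM l L) {X : TC L} (hX : (X : L →L[ℂ] L).IsPositive)
    {Δ : Set (EuclideanSpace ℝ (Fin l))} (hΔ : MeasurableSet Δ) :
    (M.law X).real Δ = (trace ((M.effect Δ).comp (X : L →L[ℂ] L))).re := by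
  rw [measureReal_def, M.law_apply hX hΔ, ENNReal.toReal_ofReal]
  exact (TC.trace_mulLeft_pos (M.isPositive _ hΔ) hX).1

theorem POVM.sum_effect (M : POVM l L) {N : ℕ} {A : Fin N → Set (EuclideanSpace ℝ (Fin l))}
    (hA : ∀ i, MeasurableSet (A i)) (hd : Pairwise fun i j => Disjoint (A i) (A j)) :
    ∑ i, M.effect (A i) = M.effect (⋃ i, A i) := by
  ext y
  refine ext_inner_left ℂ fun x => ?_
  -- The finite family is padded with empty sets to fit countable additivity.
  let B : ℕ → Set (EuclideanSpace ℝ (Fin l)) := fun k => if h : k < N then A ⟨k, h⟩ else ∅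
  have hBA : ∀ i : Fin N, B i = A i := fun i => by simp [B]
  have hB : ∀ k, MeasurableSet (B k) := fun k => by
    by_cases h : k < N
    · simpa [B, h] using hA _
    · simp [B, h]
  have hBd : Pairwise fun i j => Disjoint (B i) (B j) := fun i j hij => by
    by_cases h : i < N
    · by_cases h' : j < N
      · simp only [B, h, h', dif_pos]
        exact hd fun e => hij (congrArg Fin.val e)
      · simp [B, h']
    · simp [B, h]
  have hU : ⋃ k, B k = ⋃ i, A i := by
    refine Set.Subset.antisymm (Set.iUnion_subset fun k => ?_) (Set.iUnion_subset fun i => ?_)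
    · by_cases h : k < N
      · simp only [B, h, dif_pos]; exact Set.subset_iUnion A _
      · simp [B, h]
    · rw [← hBA]; exact Set.subset_iUnion B _
  have h := M.hasSum_effect B hB hBd x y
  rw [hU] at h
  refine HasSum.unique ?_ h
  have h2 := hasSum_sum_of_ne_finset_zero (L := .unconditional ℕ) (f := fun k => inner ℂ x (M.effect (B k) y))
    (s := Finset.range N) (fun k hk => by
      rw [Finset.mem_range] at hk
      simp [B, hk, M.effect_empty])
  rw [Finset.sum_range] at h2
  simp_rw [hBA] at h2
  rw [_root_.sum_apply, inner_sum]
  exact h2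

theorem isPositive_sum {ι : Type*} (s : Finset ι) {M : ι → L →L[ℂ] L}
    (hM : ∀ i ∈ s, (M i).IsPositive) : (∑ i ∈ s, M i).IsPositive := by
  rw [← ContinuousLinearMap.nonneg_iff_isPositive]
  exact Finset.sum_nonneg fun i hi => (ContinuousLinearMap.nonneg_iff_isPositive _).2 (hM i hi)

/-- The POVM with finitely many outcomes `c i` and effects `M i`. -/
def finPOVM {ι : Type*} [Fintype ι] (c : ι → EuclideanSpace ℝ (Fin l)) (M : ι → L →L[ℂ] L)
    (hM : ∀ i, (M i).IsPositive) (hM1 : ∑ i, M i = 1) : POVM l L where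
  effect Δ := by classical exact ∑ i, if c i ∈ Δ then M i else 0
  isPositive Δ _ := by
    classical
    refine isPositive_sum _ fun i _ => ?_
    split_ifs
    exacts [hM i, ContinuousLinearMap.isPositive_zero]
  effect_univ := by simpa using hM1
  hasSum_effect A _ hd x y := by
    classical
    simp only [_root_.sum_apply, inner_sum]
    refine hasSum_sum fun i _ => ?_
    by_cases h : c i ∈ ⋃ k, A k
    · rw [if_pos h]
      obtain ⟨k, hk⟩ := Set.mem_iUnion.1 h
      have h2 := hasSum_single (f := fun k => inner ℂ x ((if c i ∈ A k then M i else 0) y)) k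
        (fun k' hk' => by
          rw [if_neg fun h' => Set.disjoint_left.1 (hd hk') h' hk]; simp)
      rwa [if_pos hk] at h2
    · rw [if_neg h]
      have : ∀ k, c i ∉ A k := fun k hk => h (Set.mem_iUnion.2 ⟨k, hk⟩)
      simp [this, hasSum_zero]

open Classical in
theorem finPOVM_effect {ι : Type*} [Fintype ι] (c : ι → EuclideanSpace ℝ (Fin l))
    (M : ι → L →L[ℂ] L) (hM : ∀ i, (M i).IsPositive) (hM1 : ∑ i, M i = 1)
    (Δ : Set (EuclideanSpace ℝ (Fin l))) :
    (finPOVM c M hM hM1).effect Δ = ∑ i, if c i ∈ Δ then M i else 0 := by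
  simp only [finPOVM]

end Law

/-! ### The states produced by an estimation scheme -/

section Run

variable {H H' K K' : Type u} [NormedAddCommGroup H] [InnerProductSpace ℂ H] [CompleteSpace H]
  [NormedAddCommGroup H'] [InnerProductSpace ℂ H'] [CompleteSpace H']
  [NormedAddCommGroup K] [InnerProductSpace ℂ K] [CompleteSpace K]
  [TopologicalSpace.SeparableSpace K]
  [NormedAddCommGroup K'] [InnerProductSpace ℂ K'] [CompleteSpace K']
  {Λ Λ' : TC H →ₗ[ℂ] TC H'} {c c' : ℝ≥0∞}

theorem AmplBound.isAmpl (h : AmplBound Λ c) (X : TC (HTensor H K)) : IsAmpl Λ X (ampl Λ X) :=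
  isAmpl_ampl ((h K X).imp fun _ hY => hY.1)

theorem AmplBound.traceNorm_le (h : AmplBound Λ c) (X : TC (HTensor H K)) :
    traceNorm (ampl Λ X : HTensor H' K →L[ℂ] HTensor H' K) ≤
      c * traceNorm (X : HTensor H K →L[ℂ] HTensor H K) := by
  obtain ⟨Y, hY, hYn⟩ := h K X
  rwa [hY.ampl_eq]

variable (K) in
/-- `ampl` as a linear map. -/
def AmplBound.amplL (h : AmplBound Λ c) : TC (HTensor H K) →ₗ[ℂ] TC (HTensor H' K) where
  toFun := ampl Λ
  map_add' X Y := ((h.isAmpl X).add (h.isAmpl Y)).ampl_eq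
  map_smul' a X := ((h.isAmpl X).smul a).ampl_eq

theorem AmplBound.amplL_apply (h : AmplBound Λ c) (X : TC (HTensor H K)) :
    h.amplL K X = ampl Λ X := rfl

theorem AmplBound.ampl_conj [TopologicalSpace.SeparableSpace K'] (h : AmplBound Λ c)
    (B : K →L[ℂ] K') (X : TC (HTensor H K)) :
    ampl Λ (TC.conj (tmap (.id ℂ H) B) X) = TC.conj (tmap (.id ℂ H') B) (ampl Λ X) :=
  ((h.isAmpl X).conj_right B).ampl_eq

variable {m : ℕ}

theorem Estimator.run_spec (E : Estimator H H' m) (hΛ : IsCPTP Λ) (n : ℕ) :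
    (E.run (fun _ => Λ) n : HTensor H' E.K →L[ℂ] HTensor H' E.K).IsPositive ∧
      traceNorm (E.run (fun _ => Λ) n : HTensor H' E.K →L[ℂ] HTensor H' E.K) = 1 := by
  have h0 : traceNorm (E.ρ : HTensor H E.K →L[ℂ] HTensor H E.K) = 1 := by
    rw [traceNorm_eq_ofReal_trace E.ρ_pos, E.ρ_trace]; simp
  induction n with
  | zero =>
    have h := hΛ.isAmpl_pos E.ρ_pos
    exact ⟨h.2.1, h.2.2.trans h0⟩
  | succ n ih =>
    have h := hΛ.isAmpl_pos ((E.Ξ_cptp n).cp.isPositive ih.1)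
    exact ⟨h.2.1, by rw [Estimator.run, h.2.2, (E.Ξ_cptp n).traceNorm_eq ih.1, ih.2]⟩

theorem Estimator.output_isPositive (E : Estimator H H' m) (hΛ : IsCPTP Λ) (n : ℕ) :
    (E.output Λ n : HTensor H' E.K →L[ℂ] HTensor H' E.K).IsPositive := (E.run_spec hΛ _).1

theorem Estimator.trace_output (E : Estimator H H' m) (hΛ : IsCPTP Λ) (n : ℕ) :
    trace (E.output Λ n : HTensor H' E.K →L[ℂ] HTensor H' E.K) = 1 := by
  rw [trace_eq_traceNorm (E.output_isPositive hΛ n), Estimator.output, (E.run_spec hΛ _).2]; simp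

theorem Estimator.isProbabilityMeasure_P (E : Estimator H H' m) (hΛ : IsCPTP Λ) (n : ℕ) :
    IsProbabilityMeasure (E.P Λ n) :=
  ⟨by rw [Estimator.P, E.M.law_univ (E.output_isPositive hΛ n)]; exact (E.run_spec hΛ _).2⟩

/-- The intermediate states do not involve the final measurement, so it can be exchanged freely. -/
theorem Estimator.run_congr (E : Estimator H H' m) {l : ℕ} (M : POVM l (HTensor H' E.K))
    (T : EuclideanSpace ℝ (Fin l) → EuclideanSpace ℝ (Fin m)) (hT : Measurable T)
    (A : ℕ → (TC H →ₗ[ℂ] TC H')) (n : ℕ) :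
    Estimator.run { E with l := l, M := M, T := T, measurable_T := hT } A n = E.run A n := by
  induction n with
  | zero => rfl
  | succ n ih => simp only [Estimator.run]; rw [ih]

end Run

/-! ### Estimation schemes with finitely many outcomes -/

section Ancilla

variable {K₁ K₂ : Type u} [NormedAddCommGroup K₁] [InnerProductSpace ℂ K₁] [CompleteSpace K₁]
  [NormedAddCommGroup K₂] [InnerProductSpace ℂ K₂] [CompleteSpace K₂]

variable (K₁ K₂) in
/-- The Hilbert sum of `K₁` with copies of `K₂` indexed by `ι`. -/
abbrev RegisterSpace (ι : Type) [Fintype ι] : Type u :=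
  WithLp 2 (K₁ × PiLp 2 (fun _ : ι => K₂))

variable (K₁ K₂) in
/-- The embedding of `K₁`. -/
def registerLeft (ι : Type) [Fintype ι] : K₁ →L[ℂ] RegisterSpace K₁ K₂ ι :=
  (WithLp.prodContinuousLinearEquiv 2 ℂ K₁ (PiLp 2 (fun _ : ι => K₂))).symm.toContinuousLinearMap.comp
    (ContinuousLinearMap.inl ℂ K₁ (PiLp 2 (fun _ : ι => K₂)))

variable (K₁ K₂) in
/-- The embedding of the copy of `K₂` with index `i`. -/
def registerRight {ι : Type} [Fintype ι] [DecidableEq ι] (i : ι) :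
    K₂ →L[ℂ] RegisterSpace K₁ K₂ ι :=
  (WithLp.prodContinuousLinearEquiv 2 ℂ K₁ (PiLp 2 (fun _ : ι => K₂))).symm.toContinuousLinearMap.comp
    ((ContinuousLinearMap.inr ℂ K₁ (PiLp 2 (fun _ : ι => K₂))).comp
      ((PiLp.continuousLinearEquiv 2 ℂ (fun _ : ι => K₂)).symm.toContinuousLinearMap.comp
        (ContinuousLinearMap.single ℂ (fun _ : ι => K₂) i)))

theorem adjoint_registerLeft_comp (ι : Type) [Fintype ι] :
    (adjoint (registerLeft K₁ K₂ ι)).comp (registerLeft K₁ K₂ ι) = .id ℂ K₁ := by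
  ext x
  refine ext_inner_left ℂ fun v => ?_
  rw [ContinuousLinearMap.comp_apply, ContinuousLinearMap.adjoint_inner_right,
    WithLp.prod_inner_apply]
  simp [registerLeft]

theorem adjoint_registerRight_comp {ι : Type} [Fintype ι] [DecidableEq ι] (i j : ι) :
    (adjoint (registerRight K₁ K₂ i)).comp (registerRight K₁ K₂ j) =
      if i = j then .id ℂ K₂ else 0 := by
  ext x
  refine ext_inner_left ℂ fun v => ?_
  rw [ContinuousLinearMap.comp_apply, ContinuousLinearMap.adjoint_inner_right,
    WithLp.prod_inner_apply, PiLp.inner_apply]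
  have : ∀ k, inner ℂ (if k = i then v else 0) (if k = j then x else 0) =
      if k = i then (if i = j then inner ℂ v x else 0) else 0 := by
    intro k
    by_cases hk : k = i
    · subst hk
      by_cases hj : k = j
      · subst hj; simp
      · simp [hj]
    · simp [hk]
  simp only [registerRight, ContinuousLinearMap.comp_apply, ContinuousLinearEquiv.coe_coe,
    ContinuousLinearMap.inr_apply, ContinuousLinearMap.single_apply]
  simp [this]
  split_ifs <;> simp

variable {H : Type u} [NormedAddCommGroup H] [InnerProductSpace ℂ H] [CompleteSpace H]

theorem adjoint_tmap_comp_tmap (H : Type u) [NormedAddCommGroup H] [InnerProductSpace ℂ H]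
    [CompleteSpace H] (A B : K₁ →L[ℂ] K₂) :
    (adjoint (tmap (.id ℂ H) A)).comp (tmap (.id ℂ H) B) = tmap (.id ℂ H) ((adjoint A).comp B) := by
  rw [adjoint_tmap, tmap_comp, ContinuousLinearMap.adjoint_id, ContinuousLinearMap.id_comp]

theorem adjoint_tmap_registerLeft_comp (ι : Type) [Fintype ι] :
    (adjoint (tmap (.id ℂ H) (registerLeft K₁ K₂ ι))).comp (tmap (.id ℂ H) (registerLeft K₁ K₂ ι)) =
      .id ℂ _ := by
  rw [adjoint_tmap_comp_tmap, adjoint_registerLeft_comp, tmap_id]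

theorem adjoint_tmap_registerRight_comp {ι : Type} [Fintype ι] [DecidableEq ι] (i j : ι) :
    (adjoint (tmap (.id ℂ H) (registerRight K₁ K₂ i))).comp
      (tmap (.id ℂ H) (registerRight K₁ K₂ j)) = if i = j then .id ℂ _ else 0 := by
  rw [adjoint_tmap_comp_tmap, adjoint_registerRight_comp]
  split_ifs
  · exact tmap_id
  · exact tmap_zero_right _

end Ancilla

/-- An estimation scheme whose final measurement has finitely many outcomes `a`, with effects `M a`
and estimates `x a`; the input state and the operations are those of `E`. -/
structure FiniteScheme (H H' : Type u)
    [NormedAddCommGroup H] [InnerProductSpace ℂ H] [CompleteSpace H]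
    [NormedAddCommGroup H'] [InnerProductSpace ℂ H'] [CompleteSpace H'] (m : ℕ) where
  E : Estimator H H' m
  ι : Type
  [fintype : Fintype ι]
  M : ι → HTensor H' E.K →L[ℂ] HTensor H' E.K
  M_pos : ∀ a, (M a).IsPositive
  sum_M : ∑ a, M a = 1
  x : ι → EuclideanSpace ℝ (Fin m)

namespace FiniteScheme

attribute [instance] fintype

variable {H H' : Type u} [NormedAddCommGroup H] [InnerProductSpace ℂ H] [CompleteSpace H]
  [NormedAddCommGroup H'] [InnerProductSpace ℂ H'] [CompleteSpace H'] {m : ℕ}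
  {Λ : TC H →ₗ[ℂ] TC H'}

/-- The probability of the outcome `a` after `n` uses. -/
def prob (S : FiniteScheme H H' m) (Λ : TC H →ₗ[ℂ] TC H') (n : ℕ) (a : S.ι) : ℝ :=
  (trace ((S.M a).comp (S.E.output Λ n : HTensor H' S.E.K →L[ℂ] HTensor H' S.E.K))).re

/-- The expectation of a function of the estimate. -/
def expect (S : FiniteScheme H H' m) (Λ : TC H →ₗ[ℂ] TC H') (n : ℕ)
    (g : EuclideanSpace ℝ (Fin m) → ℝ) : ℝ :=
  ∑ a, S.prob Λ n a * g (S.x a)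

theorem trace_eq_prob (S : FiniteScheme H H' m) (hΛ : IsCPTP Λ) (n : ℕ) (a : S.ι) :
    trace ((S.M a).comp (S.E.output Λ n : HTensor H' S.E.K →L[ℂ] HTensor H' S.E.K)) =
      (S.prob Λ n a : ℂ) := by
  have h := TC.trace_mulLeft_pos (S.M_pos a) (S.E.output_isPositive hΛ n)
  exact Complex.ext rfl h.2

theorem prob_nonneg (S : FiniteScheme H H' m) (hΛ : IsCPTP Λ) (n : ℕ) (a : S.ι) :
    0 ≤ S.prob Λ n a := (TC.trace_mulLeft_pos (S.M_pos a) (S.E.output_isPositive hΛ n)).1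

theorem sum_trace {L : Type u} [NormedAddCommGroup L] [InnerProductSpace ℂ L] [CompleteSpace L]
    {ι : Type*} [Fintype ι] (M : ι → L →L[ℂ] L) (X : TC L) :
    ∑ a, trace ((M a).comp (X : L →L[ℂ] L)) = trace ((∑ a, M a).comp (X : L →L[ℂ] L)) := by
  have h : ∑ a, TC.mulLeft (M a) X = TC.mulLeft (∑ a, M a) X := by
    ext1
    rw [AddSubmonoidClass.coe_finsetSum]
    simp_rw [TC.coe_mulLeft]
    ext x
    simp
  have h2 := congrArg (trL L) h
  rw [map_sum] at h2
  exact h2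

theorem sum_prob (S : FiniteScheme H H' m) (hΛ : IsCPTP Λ) (n : ℕ) : ∑ a, S.prob Λ n a = 1 := by
  have h := sum_trace S.M (S.E.output Λ n)
  rw [S.sum_M] at h
  have h2 := congrArg Complex.re h
  rw [Complex.re_sum] at h2
  refine h2.trans ?_
  change (trace (S.E.output Λ n : HTensor H' S.E.K →L[ℂ] HTensor H' S.E.K)).re = 1
  rw [S.E.trace_output hΛ]; rfl

/-! ### Estimators and finite schemes -/

/-- A finite scheme is an estimator of bounded range. -/
theorem exists_estimator (S : FiniteScheme H H' m) :
    ∃ E : Estimator H H' m, E.BoundedRange ∧ ∀ (Λ : TC H →ₗ[ℂ] TC H') (n : ℕ), IsCPTP Λ →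
      ∀ g : EuclideanSpace ℝ (Fin m) → ℝ, ∫ ω, g (E.T ω) ∂(E.P Λ n) = S.expect Λ n g := by
  classical
  -- Outcomes are encoded as distinct points of the real line; `T` decodes them and takes the
  -- harmless value `0` elsewhere.
  let c : S.ι → EuclideanSpace ℝ (Fin 1) := fun a =>
    EuclideanSpace.single 0 ((Fintype.equivFin S.ι a : ℕ) : ℝ)
  have hc : Function.Injective c := fun a b h => by
    have h2 := congrArg (fun v : EuclideanSpace ℝ (Fin 1) => v 0) h
    simp only [c, PiLp.single_eq_same, Nat.cast_inj, Fin.val_inj] at h2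
    exact (Fintype.equivFin S.ι).injective h2
  let T : EuclideanSpace ℝ (Fin 1) → EuclideanSpace ℝ (Fin m) :=
    fun ω => ∑ a, if ω = c a then S.x a else 0
  have hTc : ∀ a, T (c a) = S.x a := fun a => by
    simp only [T]
    rw [Finset.sum_eq_single a] <;> simp +contextual [hc.eq_iff, eq_comm]
  have hT : Measurable T := by
    refine Finset.measurable_sum _ fun a _ => ?_
    exact Measurable.ite (measurableSet_eq) measurable_const measurable_const
  let P := finPOVM c S.M S.M_pos S.sum_M
  let E : Estimator H H' m := { S.E with l := 1, M := P, T := T, measurable_T := hT }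
  refine ⟨E, ?_, fun Λ n hΛ g => ?_⟩
  · refine Set.Finite.isBounded (Set.Finite.subset
      ((Set.finite_range S.x).union (Set.finite_singleton 0)) ?_)
    rintro _ ⟨ω, rfl⟩
    by_cases h : ∃ a, ω = c a
    · obtain ⟨a, rfl⟩ := h
      exact Or.inl ⟨a, (hTc a).symm⟩
    · push Not at h
      exact Or.inr (by simp [E, T, h])
  · have hout : E.output Λ n = S.E.output Λ n := S.E.run_congr _ _ hT _ _
    have hlaw : E.P Λ n = ∑ a, ENNReal.ofReal (S.prob Λ n a) • Measure.dirac (c a) := by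
      ext Δ hΔ
      have h1 : E.P Λ n Δ = ENNReal.ofReal (trace ((P.effect Δ).comp
          (S.E.output Λ n : HTensor H' S.E.K →L[ℂ] HTensor H' S.E.K))).re := by
        rw [Estimator.P, hout]
        exact P.law_apply (S.E.output_isPositive hΛ n) hΔ
      rw [h1, finPOVM_effect, ← sum_trace, Complex.re_sum,
        ENNReal.ofReal_sum_of_nonneg, Measure.finsetSum_apply]
      · refine Finset.sum_congr rfl fun a _ => ?_
        rw [Measure.smul_apply, Measure.dirac_apply' _ hΔ]
        by_cases h : c a ∈ Δ
        · simp [h, prob]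
        · simp [h, trace]
      · intro a _
        split_ifs
        · exact S.prob_nonneg hΛ n a
        · simp [trace]
    rw [hlaw, integral_finsetSum_measure]
    · refine Finset.sum_congr rfl fun a _ => ?_
      rw [integral_smul_measure, integral_dirac, ENNReal.toReal_ofReal (S.prob_nonneg hΛ n a)]
      change _ • g (T (c a)) = _
      rw [hTc]; rfl
    · intro a _
      exact (integrable_dirac (by simp)).smul_measure (by simp)

/-- An estimator whose estimate is replaced by a function of finite range. -/
theorem exists_of_estimator (E : Estimator H H' m)
    {T : EuclideanSpace ℝ (Fin E.l) → EuclideanSpace ℝ (Fin m)} (hT : Measurable T)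
    (hfin : (Set.range T).Finite) :
    ∃ S : FiniteScheme H H' m, ∀ (Λ : TC H →ₗ[ℂ] TC H') (n : ℕ), IsCPTP Λ →
      ∀ g : EuclideanSpace ℝ (Fin m) → ℝ, S.expect Λ n g = ∫ ω, g (T ω) ∂(E.P Λ n) := by
  classical
  obtain ⟨N, y, hyr⟩ := hfin.fin_embedding
  have hmeas : ∀ a, MeasurableSet (T ⁻¹' {y a}) := fun a => hT (measurableSet_singleton _)
  have hd : Pairwise fun a b => Disjoint (T ⁻¹' {y a}) (T ⁻¹' {y b}) := fun a b hab =>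
    (Set.disjoint_singleton.2 (y.injective.ne hab)).preimage T
  have hU : ⋃ a, T ⁻¹' {y a} = Set.univ := by
    refine Set.eq_univ_of_forall fun ω => ?_
    have : T ω ∈ Set.range y := hyr ▸ Set.mem_range_self ω
    obtain ⟨a, ha⟩ := this
    exact Set.mem_iUnion.2 ⟨a, ha.symm⟩
  refine ⟨{ E := E, ι := Fin N, M := fun a => E.M.effect (T ⁻¹' {y a}),
            M_pos := fun a => E.M.isPositive _ (hmeas a),
            sum_M := by rw [E.M.sum_effect hmeas hd, hU, E.M.effect_univ], x := y },
    fun Λ n hΛ g => ?_⟩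
  have := E.isProbabilityMeasure_P hΛ n
  have h1 : (fun ω => g (T ω)) = fun ω => ∑ a, (T ⁻¹' {y a}).indicator (fun _ => g (y a)) ω := by
    funext ω
    obtain ⟨a, ha⟩ := Set.mem_iUnion.1 (hU ▸ Set.mem_univ ω)
    have ha' : T ω = y a := ha
    rw [Finset.sum_eq_single a]
    · rw [Set.indicator_of_mem ha, ha']
    · intro b _ hb
      refine Set.indicator_of_notMem (fun h => ?_) _
      exact hb (y.injective ((Set.mem_singleton_iff.1 h).symm.trans ha'))
    · simp
  rw [h1, integral_finsetSum _ fun a _ => (integrable_const _).indicator (hmeas a)]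
  refine Finset.sum_congr rfl fun a _ => ?_
  rw [integral_indicator_const _ (hmeas a), smul_eq_mul, Estimator.P,
    E.M.real_law (E.output_isPositive hΛ n) (hmeas a)]
  rfl

/-! ### Sequential composition -/

/-- A finite scheme from its constituents. -/
theorem exists_of_data {K : Type u} [NormedAddCommGroup K] [InnerProductSpace ℂ K]
    [CompleteSpace K] [TopologicalSpace.SeparableSpace K] (ρ : TC (HTensor H K))
    (hρ : (ρ : HTensor H K →L[ℂ] HTensor H K).IsPositive)
    (hρ1 : trace (ρ : HTensor H K →L[ℂ] HTensor H K) = 1)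
    (Ξ : ℕ → (TC (HTensor H' K) →ₗ[ℂ] TC (HTensor H K))) (hΞ : ∀ s, IsCPTP (Ξ s))
    {ι : Type} [Fintype ι] (M : ι → HTensor H' K →L[ℂ] HTensor H' K) (hM : ∀ a, (M a).IsPositive)
    (hM1 : ∑ a, M a = 1) (x : ι → EuclideanSpace ℝ (Fin m)) :
    ∃ S : FiniteScheme H H' m, ∀ (Λ : TC H →ₗ[ℂ] TC H') (R : ℕ → TC (HTensor H' K)),
      R 0 = ampl Λ ρ → (∀ s, R (s + 1) = ampl Λ (Ξ s (R s))) →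
      ∀ (n : ℕ) (g : EuclideanSpace ℝ (Fin m) → ℝ), S.expect Λ (n + 1) g =
        ∑ a, (trace ((M a).comp (R n : HTensor H' K →L[ℂ] HTensor H' K))).re * g (x a) := by
  let c : Unit → EuclideanSpace ℝ (Fin 0) := fun _ => 0
  -- The trivial one-outcome measurement and the zero estimate are placeholders: a finite scheme
  -- reads off only the input state and the operations.
  let E : Estimator H H' m :=
    { K := K, ρ := ρ, ρ_pos := hρ, ρ_trace := hρ1, Ξ := Ξ, Ξ_cptp := hΞ, l := 0
      M := finPOVM c (fun _ => 1) (fun _ => ContinuousLinearMap.isPositive_one) (by simp)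
      T := fun _ => 0
      measurable_T := measurable_const }
  refine ⟨{ E := E, ι := ι, M := M, M_pos := hM, sum_M := hM1, x := x }, fun Λ R h0 hs n g => ?_⟩
  have h : ∀ s, E.run (fun _ => Λ) s = R s := by
    intro s
    induction s with
    | zero => exact h0.symm
    | succ s ih => rw [hs, ← ih]; rfl
  refine Finset.sum_congr rfl fun a _ => ?_
  rw [← h n]
  rfl

section Registers

variable {K₁ K₂ L : Type u} [NormedAddCommGroup K₁] [InnerProductSpace ℂ K₁] [CompleteSpace K₁]
  [NormedAddCommGroup K₂] [InnerProductSpace ℂ K₂] [CompleteSpace K₂]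
  [NormedAddCommGroup L] [InnerProductSpace ℂ L] [CompleteSpace L]
  [TopologicalSpace.SeparableSpace K₁] [TopologicalSpace.SeparableSpace K₂]
  [TopologicalSpace.SeparableSpace L]
  {ι : Type} [Fintype ι]

/-- The states of a composite protocol that runs a protocol on the register `J₁`, then prepares
states in the registers `J₂ a` with weights given by `p`, and continues in those. -/
theorem run_registers (hΛ : IsCPTP Λ) (J₁ : K₁ →L[ℂ] L) (J₂ : ι → K₂ →L[ℂ] L) {n : ℕ}
    {ρ₁ : TC (HTensor H K₁)} {ρ₂ : TC (HTensor H K₂)}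
    {Ξ₁ : ℕ → (TC (HTensor H' K₁) →ₗ[ℂ] TC (HTensor H K₁))}
    {Ξ₂ : ℕ → (TC (HTensor H' K₂) →ₗ[ℂ] TC (HTensor H K₂))}
    {Ψ : ℕ → (TC (HTensor H' L) →ₗ[ℂ] TC (HTensor H L))} {p : ι → TC (HTensor H' K₁) → ℂ}
    (e₁ : ∀ s < n, ∀ X, Ψ s (TC.conj (tmap (.id ℂ H') J₁) X) =
      TC.conj (tmap (.id ℂ H) J₁) (Ξ₁ s X))
    (e₂ : ∀ X, Ψ n (TC.conj (tmap (.id ℂ H') J₁) X) =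
      ∑ a, p a X • TC.conj (tmap (.id ℂ H) (J₂ a)) ρ₂)
    (e₃ : ∀ r a X, Ψ (n + 1 + r) (TC.conj (tmap (.id ℂ H') (J₂ a)) X) =
      TC.conj (tmap (.id ℂ H) (J₂ a)) (Ξ₂ r X))
    {R₁ : ℕ → TC (HTensor H' K₁)} {R₂ : ℕ → TC (HTensor H' K₂)} {R : ℕ → TC (HTensor H' L)}
    (hR₁ : R₁ 0 = ampl Λ ρ₁) (hR₁' : ∀ s, R₁ (s + 1) = ampl Λ (Ξ₁ s (R₁ s)))
    (hR₂ : R₂ 0 = ampl Λ ρ₂) (hR₂' : ∀ s, R₂ (s + 1) = ampl Λ (Ξ₂ s (R₂ s)))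
    (hR : R 0 = ampl Λ (TC.conj (tmap (.id ℂ H) J₁) ρ₁))
    (hR' : ∀ s, R (s + 1) = ampl Λ (Ψ s (R s))) (r : ℕ) :
    R (n + 1 + r) = ∑ a, p a (R₁ n) • TC.conj (tmap (.id ℂ H') (J₂ a)) (R₂ r) := by
  have hb := hΛ.amplBound
  -- Indices are shifted by one: `R s` is the state after `s + 1` uses. `Ψ n` is thus the switching
  -- operation, and the state `R₂ r` of the second protocol appears at index `n + 1 + r`.
  have r₁ : ∀ s ≤ n, R s = TC.conj (tmap (.id ℂ H') J₁) (R₁ s) := by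
    intro s
    induction s with
    | zero => intro _; rw [hR, hR₁]; exact hb.ampl_conj _ _
    | succ s ih =>
      intro hs
      rw [hR', ih (by omega), e₁ s (by omega), hb.ampl_conj, hR₁']
  -- All registers `J₂ a` carry the same state and differ only in weight, so the mixture keeps its
  -- shape under the unknown map.
  have key : ∀ (q : ι → ℂ) (X : TC (HTensor H K₂)),
      ampl Λ (∑ a, q a • TC.conj (tmap (.id ℂ H) (J₂ a)) X) =
        ∑ a, q a • TC.conj (tmap (.id ℂ H') (J₂ a)) (ampl Λ X) := by
    intro q X
    rw [← hb.amplL_apply, map_sum]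
    refine Finset.sum_congr rfl fun a _ => ?_
    rw [map_smul, hb.amplL_apply, hb.ampl_conj]
  induction r with
  | zero => rw [Nat.add_zero, hR', r₁ n le_rfl, e₂, key, hR₂]
  | succ r ih =>
    rw [← Nat.add_assoc, hR', ih, map_sum]
    simp_rw [map_smul, e₃]
    rw [key, hR₂']

end Registers

/-! ### Measurements that are block diagonal over the registers. -/

section Blocks

variable {L L' : Type u} [NormedAddCommGroup L] [InnerProductSpace ℂ L] [CompleteSpace L]
  [NormedAddCommGroup L'] [InnerProductSpace ℂ L'] [CompleteSpace L']
  {ι : Type*} [Fintype ι] [DecidableEq ι] {J : ι → L →L[ℂ] L'}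

theorem trace_comp_sum (N : L' →L[ℂ] L') (p : ι → ℂ) (Y : ι → TC L') :
    trace (N.comp ((∑ a, p a • Y a : TC L') : L' →L[ℂ] L')) =
      ∑ a, p a * trace (N.comp (Y a : L' →L[ℂ] L')) := by
  have h := map_sum ((trL L').comp (TC.mulLeft N)) (fun a => p a • Y a) Finset.univ
  simp_rw [map_smul] at h
  exact h

/-- The compression by `J a` annihilates all blocks of the mixture except the one with index `a`.
This makes the joint distribution of both outcomes a product. -/
theorem trace_block (hJ : ∀ a b, (adjoint (J a)).comp (J b) = if a = b then .id ℂ L else 0)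
    (N : L →L[ℂ] L) (p : ι → ℂ) (X : TC L) (a : ι) :
    trace (((J a).comp (N.comp (adjoint (J a)))).comp
      ((∑ b, p b • TC.conj (J b) X : TC L') : L' →L[ℂ] L')) =
      p a * trace (N.comp (X : L →L[ℂ] L)) := by
  have h1 : ∀ b, ((J a).comp (N.comp (adjoint (J a)))).comp (TC.conj (J b) X : L' →L[ℂ] L') =
      (J a).comp (N.comp (((adjoint (J a)).comp (J b)).comp
        ((X : L →L[ℂ] L).comp (adjoint (J b))))) := fun b => rfl
  rw [trace_comp_sum, Finset.sum_eq_single a]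
  · have h2 : (J a).comp (N.comp (((adjoint (J a)).comp (J a)).comp
        ((X : L →L[ℂ] L).comp (adjoint (J a))))) =
        (TC.conj (J a) (TC.mulLeft N X) : L' →L[ℂ] L') := by
      rw [hJ, if_pos rfl]; rfl
    rw [h1, h2, trace_conj_isometry ((hJ a a).trans (if_pos rfl))]
    rfl
  · intro b _ hb
    have h0 : trace (0 : L' →L[ℂ] L') = 0 := by simp [trace]
    rw [h1, hJ, if_neg (Ne.symm hb)]
    simp [h0]
  · simp

/-- The mixture is supported in the blocks, so the extra outcome that completes the measurement has
probability `0`. -/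
theorem trace_block_compl
    (hJ : ∀ a b, (adjoint (J a)).comp (J b) = if a = b then .id ℂ L else 0)
    (p : ι → ℂ) (X : TC L) :
    trace ((1 - ∑ a, (J a).comp (adjoint (J a))).comp
      ((∑ b, p b • TC.conj (J b) X : TC L') : L' →L[ℂ] L')) = 0 := by
  have h0 : trace (0 : L' →L[ℂ] L') = 0 := by simp [trace]
  rw [trace_comp_sum]
  refine Finset.sum_eq_zero fun b _ => ?_
  have h1 : (1 - ∑ a, (J a).comp (adjoint (J a))).comp (TC.conj (J b) X : L' →L[ℂ] L') =
      ((1 - ∑ a, (J a).comp (adjoint (J a))).comp (J b)).comp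
        ((X : L →L[ℂ] L).comp (adjoint (J b))) := rfl
  have h3 : (1 - ∑ a, (J a).comp (adjoint (J a))).comp (J b) = 0 := by
    rw [ContinuousLinearMap.sub_comp, sum_comp_adjoint_comp hJ]
    ext x; simp
  rw [h1, h3, ContinuousLinearMap.zero_comp, h0, mul_zero]

theorem sum_block {κ : Type*} [Fintype κ] {N : κ → L →L[ℂ] L} (hN : ∑ b, N b = 1) :
    (∑ o : Option (ι × κ), (o.elim (1 - ∑ a, (J a).comp (adjoint (J a)))
      fun p => (J p.1).comp ((N p.2).comp (adjoint (J p.1))) : L' →L[ℂ] L')) = 1 := by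
  rw [Fintype.sum_option, Fintype.sum_prod_type]
  have h2 : ∀ v, ∑ b, N b v = v := fun v => by
    have h3 := congrArg (fun T : L →L[ℂ] L => T v) hN
    simpa using h3
  have h1 : ∀ a, ∑ b, (J a).comp ((N b).comp (adjoint (J a))) = (J a).comp (adjoint (J a)) := by
    intro a
    ext v
    simp only [_root_.sum_apply, ContinuousLinearMap.comp_apply]
    rw [← map_sum, h2]
  simp only [Option.elim, h1]
  simp

end Blocks

/-! ### Channels driving a two-stage protocol on registers. -/

section Channels

variable {A₁ A₂ A B₁ B₂ B : Type u}
  [NormedAddCommGroup A₁] [InnerProductSpace ℂ A₁] [CompleteSpace A₁]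
  [NormedAddCommGroup A₂] [InnerProductSpace ℂ A₂] [CompleteSpace A₂]
  [NormedAddCommGroup A] [InnerProductSpace ℂ A] [CompleteSpace A]
  [NormedAddCommGroup B₁] [InnerProductSpace ℂ B₁] [CompleteSpace B₁]
  [NormedAddCommGroup B₂] [InnerProductSpace ℂ B₂] [CompleteSpace B₂]
  [NormedAddCommGroup B] [InnerProductSpace ℂ B] [CompleteSpace B]
  {ι : Type} [Fintype ι] [DecidableEq ι]
  {W' : A₁ →L[ℂ] A} {W : B₁ →L[ℂ] B} {V' : ι → A₂ →L[ℂ] A} {V : ι → B₂ →L[ℂ] B}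

/-- The operations of a composite protocol: `n` operations on a register, a measurement of the
register that controls the preparation of states in further registers, and operations on those. -/
theorem exists_register_channels (hW : (adjoint W).comp W = .id ℂ B₁)
    (hW' : (adjoint W').comp W' = .id ℂ A₁)
    (hV : ∀ a, (adjoint (V a)).comp (V a) = .id ℂ B₂)
    (hV' : ∀ a b, (adjoint (V' a)).comp (V' b) = if a = b then .id ℂ A₂ else 0)
    {Ξ₁ : ℕ → (TC A₁ →ₗ[ℂ] TC B₁)} (hΞ₁ : ∀ s, IsCPTP (Ξ₁ s))
    {Ξ₂ : ℕ → (TC A₂ →ₗ[ℂ] TC B₂)} (hΞ₂ : ∀ s, IsCPTP (Ξ₂ s))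
    {M : ι → A₁ →L[ℂ] A₁} (hM : ∀ a, (M a).IsPositive) (hM1 : ∑ a, M a = 1)
    {ρ : TC B₂} (hρ : (ρ : B₂ →L[ℂ] B₂).IsPositive) (hρ1 : trace (ρ : B₂ →L[ℂ] B₂) = 1)
    {τ : TC B} (hτ : (τ : B →L[ℂ] B).IsPositive) (hτ1 : trace (τ : B →L[ℂ] B) = 1) (n : ℕ) :
    ∃ Ψ : ℕ → (TC A →ₗ[ℂ] TC B), (∀ s, IsCPTP (Ψ s)) ∧
      (∀ s < n, ∀ X, Ψ s (TC.conj W' X) = TC.conj W (Ξ₁ s X)) ∧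
      (∀ X, Ψ n (TC.conj W' X) =
        ∑ a, trace ((M a).comp (X : A₁ →L[ℂ] A₁)) • TC.conj (V a) ρ) ∧
      (∀ r a X, Ψ (n + 1 + r) (TC.conj (V' a) X) = TC.conj (V a) (Ξ₂ r X)) := by
  -- A single isometry is treated as a family over `Unit`, so that `exists_glue` also covers the
  -- operations on the first register.
  have hW'' : ∀ i j : Unit, (adjoint W').comp W' = if i = j then .id ℂ A₁ else 0 := fun i j => by
    rw [if_pos rfl]; exact hW'
  have h1 : ∀ s, ∃ Ψ : TC A →ₗ[ℂ] TC B, IsCPTP Ψ ∧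
      ∀ X, Ψ (TC.conj W' X) = TC.conj W (Ξ₁ s X) := fun s => by
    obtain ⟨Ψ, hΨ, h⟩ := exists_glue hW'' (fun _ : Unit => isCPTP_conj_comp (hΞ₁ s) hW) hτ hτ1
    exact ⟨Ψ, hΨ, h ()⟩
  have h2 : ∃ Ψ : TC A →ₗ[ℂ] TC B, IsCPTP Ψ ∧
      ∀ X, Ψ (TC.conj W' X) = ∑ a, trace ((M a).comp (X : A₁ →L[ℂ] A₁)) • TC.conj (V a) ρ := by
    have hsw := isCPTP_sum_measPrep (τ := fun a => TC.conj (V a) ρ) hM hM1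
      (fun a => TC.conj_isPositive _ hρ) (fun a => by rw [trace_conj_isometry (hV a), hρ1])
    obtain ⟨Ψ, hΨ, h⟩ := exists_glue hW'' (fun _ : Unit => hsw) hτ hτ1
    exact ⟨Ψ, hΨ, fun X => by rw [h (), LinearMap.sum_apply]; rfl⟩
  have h3 : ∀ r, ∃ Ψ : TC A →ₗ[ℂ] TC B, IsCPTP Ψ ∧
      ∀ a X, Ψ (TC.conj (V' a) X) = TC.conj (V a) (Ξ₂ r X) := fun r =>
    exists_glue hV' (fun a => isCPTP_conj_comp (hΞ₂ r) (hV a)) hτ hτ1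
  choose Ψ₁ hΨ₁ e₁ using h1
  obtain ⟨Ψ₂, hΨ₂, e₂⟩ := h2
  choose Ψ₃ hΨ₃ e₃ using h3
  refine ⟨fun s => if s < n then Ψ₁ s else if s = n then Ψ₂ else Ψ₃ (s - (n + 1)), fun s => ?_,
    fun s hs X => ?_, fun X => ?_, fun r a X => ?_⟩
  · dsimp only
    split_ifs
    exacts [hΨ₁ s, hΨ₂, hΨ₃ _]
  · simp only [if_pos hs]; exact e₁ s X
  · simp only [lt_irrefl, if_false, if_true]; exact e₂ X
  · have h1 : ¬ n + 1 + r < n := by omega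
    have h2 : ¬ n + 1 + r = n := by omega
    simp only [h1, h2, if_false, Nat.add_sub_cancel_left]
    exact e₃ r a X

end Channels

variable (S₁ S₂ : FiniteScheme H H' m)

/-- The composition of two schemes. -/
theorem exists_compose {n k : ℕ} (hn : 1 ≤ n) (hk : 1 ≤ k)
    (z : S₁.ι → S₂.ι → EuclideanSpace ℝ (Fin m)) :
    ∃ S : FiniteScheme H H' m, ∀ Λ : TC H →ₗ[ℂ] TC H', IsCPTP Λ →
      ∀ g : EuclideanSpace ℝ (Fin m) → ℝ, S.expect Λ (n + k) g =
        ∑ a, ∑ b, S₁.prob Λ n a * S₂.prob Λ k b * g (z a b) := by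
  classical
  -- From here `n` and `k` denote the numbers of uses minus one, to match the indexing of `run`.
  obtain ⟨n, rfl⟩ := Nat.exists_eq_add_of_le' hn
  obtain ⟨k, rfl⟩ := Nat.exists_eq_add_of_le' hk
  have hW := adjoint_tmap_registerLeft_comp (H := H) (K₁ := S₁.E.K) (K₂ := S₂.E.K) S₁.ι
  have hV := adjoint_tmap_registerRight_comp (H := H) (K₁ := S₁.E.K) (K₂ := S₂.E.K) (ι := S₁.ι)
  have hJ := adjoint_tmap_registerRight_comp (H := H') (K₁ := S₁.E.K) (K₂ := S₂.E.K) (ι := S₁.ι)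
  -- The embedded input state of the first scheme serves both as the input and as the fallback state
  -- required for gluing channels.
  have hτ := TC.conj_isPositive (tmap (.id ℂ H) (registerLeft S₁.E.K S₂.E.K S₁.ι)) S₁.E.ρ_pos
  have hτ1 := (trace_conj_isometry hW S₁.E.ρ).trans S₁.E.ρ_trace
  obtain ⟨Ψ, hΨ, e₁, e₂, e₃⟩ := exists_register_channels hW
    (adjoint_tmap_registerLeft_comp (H := H') (K₁ := S₁.E.K) (K₂ := S₂.E.K) S₁.ι)
    (fun a => (hV a a).trans (if_pos rfl)) hJ
    S₁.E.Ξ_cptp S₂.E.Ξ_cptp S₁.M_pos S₁.sum_M S₂.E.ρ_pos S₂.E.ρ_trace hτ hτ1 n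
  obtain ⟨S, hS⟩ := exists_of_data (m := m) _ hτ hτ1 Ψ hΨ
    -- `none` is the complement of the registers, an outcome that never occurs; its estimate is set
    -- to `0`.
    (ι := Option (S₁.ι × S₂.ι)) _
    (by
      rintro (_ | ⟨a, b⟩)
      exacts [isPositive_one_sub_sum hJ, (S₂.M_pos b).conj_adjoint _])
    (sum_block S₂.sum_M) (fun o => o.elim 0 fun p => z p.1 p.2)
  refine ⟨S, fun Λ hΛ g => ?_⟩
  let R : ℕ → TC (HTensor H' (RegisterSpace S₁.E.K S₂.E.K S₁.ι)) := fun s => Nat.rec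
    (ampl Λ (TC.conj (tmap (.id ℂ H) (registerLeft S₁.E.K S₂.E.K S₁.ι)) S₁.E.ρ))
    (fun s X => ampl Λ (Ψ s X)) s
  have hR := run_registers hΛ _ _ e₁ e₂ e₃ (R₁ := S₁.E.run fun _ => Λ) (R₂ := S₂.E.run fun _ => Λ)
    (R := R) rfl (fun _ => rfl) rfl (fun _ => rfl) rfl (fun _ => rfl) k
  have hp : ∀ a, trace ((S₁.M a).comp (S₁.E.run (fun _ => Λ) n :
      HTensor H' S₁.E.K →L[ℂ] HTensor H' S₁.E.K)) = (S₁.prob Λ (n + 1) a : ℂ) :=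
    fun a => S₁.trace_eq_prob hΛ (n + 1) a
  have hq : ∀ b, trace ((S₂.M b).comp (S₂.E.run (fun _ => Λ) k :
      HTensor H' S₂.E.K →L[ℂ] HTensor H' S₂.E.K)) = (S₂.prob Λ (k + 1) b : ℂ) :=
    fun b => S₂.trace_eq_prob hΛ (k + 1) b
  have h := hS Λ R rfl (fun _ => rfl) (n + 1 + k) g
  rw [hR, Fintype.sum_option, Fintype.sum_prod_type] at h
  simp only [Option.elim, trace_block hJ, trace_block_compl hJ, hp, hq] at h
  rw [← Nat.add_assoc, h]
  simp [← Complex.ofReal_mul]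

end FiniteScheme

/-! ### The normed space of trace class operators -/

section NormedTraceClass

variable {L L' : Type u} [NormedAddCommGroup L] [InnerProductSpace ℂ L] [CompleteSpace L]
  [NormedAddCommGroup L'] [InnerProductSpace ℂ L'] [CompleteSpace L']

variable (L) in
/-- The trace class operators, normed by the trace norm. -/
def TN : Type u := TC L

namespace TN

instance : AddCommGroup (TN L) := inferInstanceAs (AddCommGroup (TC L))

instance : Module ℂ (TN L) := inferInstanceAs (Module ℂ (TC L))

variable (L) in
/-- The identification of the underlying spaces. -/
def of : TC L ≃ₗ[ℂ] TN L := LinearEquiv.refl ℂ (TC L)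

instance : Norm (TN L) := ⟨fun X => (traceNorm ((of L).symm X : L →L[ℂ] L)).toReal⟩

theorem core : NormedSpace.Core ℂ (TN L) where
  norm_nonneg _ := ENNReal.toReal_nonneg
  norm_smul c X := by
    change (traceNorm (c • ((of L).symm X : L →L[ℂ] L))).toReal = _
    rw [traceNorm_smul, ENNReal.toReal_mul, toReal_enorm]
    rfl
  norm_triangle X Y := by
    change (traceNorm (((of L).symm X : L →L[ℂ] L) + ((of L).symm Y : L →L[ℂ] L))).toReal ≤ _
    have hX : traceNorm ((of L).symm X : L →L[ℂ] L) ≠ ⊤ := ((of L).symm X).2.ne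
    have hY : traceNorm ((of L).symm Y : L →L[ℂ] L) ≠ ⊤ := ((of L).symm Y).2.ne
    refine (ENNReal.toReal_mono (ENNReal.add_ne_top.2 ⟨hX, hY⟩) (traceNorm_add_le _ _)).trans ?_
    rw [ENNReal.toReal_add hX hY]
    rfl
  norm_eq_zero_iff X := by
    constructor
    · intro h
      have hX : traceNorm ((of L).symm X : L →L[ℂ] L) ≠ ⊤ := ((of L).symm X).2.ne
      have h1 : traceNorm ((of L).symm X : L →L[ℂ] L) = 0 := by
        rcases (ENNReal.toReal_eq_zero_iff _).1 h with h | h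
        exacts [h, absurd h hX]
      have h2 : (of L).symm X = 0 := Subtype.ext (eq_zero_of_traceNorm_eq_zero h1)
      exact (of L).symm.map_eq_zero_iff.1 h2
    · rintro rfl
      change (traceNorm (0 : L →L[ℂ] L)).toReal = 0
      rw [traceNorm_zero, ENNReal.toReal_zero]

instance : NormedAddCommGroup (TN L) := NormedAddCommGroup.ofCore core

instance : NormedSpace ℂ (TN L) := NormedSpace.ofCore core

theorem norm_def (X : TC L) : ‖of L X‖ = (traceNorm (X : L →L[ℂ] L)).toReal := rfl

theorem ofReal_norm_of (X : TC L) : ENNReal.ofReal ‖of L X‖ = traceNorm (X : L →L[ℂ] L) := by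
  rw [norm_def, ENNReal.ofReal_toReal X.2.ne]

/-- A linear map that is bounded for the trace norm. -/
def lift (Φ : TC L →ₗ[ℂ] TC L') {c : ℝ≥0∞} (hc : c ≠ ⊤)
    (h : ∀ X, traceNorm (Φ X : L' →L[ℂ] L') ≤ c * traceNorm (X : L →L[ℂ] L)) :
    TN L →L[ℝ] TN L' :=
  LinearMap.mkContinuous
    (((of L').toLinearMap.comp (Φ.comp (of L).symm.toLinearMap)).restrictScalars ℝ) c.toReal
    fun X => by
      have h1 := ENNReal.toReal_mono (ENNReal.mul_ne_top hc ((of L).symm X).2.ne)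
        (h ((of L).symm X))
      rw [ENNReal.toReal_mul] at h1
      exact h1

theorem lift_of (Φ : TC L →ₗ[ℂ] TC L') {c : ℝ≥0∞} (hc : c ≠ ⊤)
    (h : ∀ X, traceNorm (Φ X : L' →L[ℂ] L') ≤ c * traceNorm (X : L →L[ℂ] L)) (X : TC L) :
    lift Φ hc h (of L X) = of L' (Φ X) := rfl

end TN

end NormedTraceClass

/-! ### Ampliations as bounded operators -/

section Ampliation

variable {H H' : Type u}
  [NormedAddCommGroup H] [InnerProductSpace ℂ H] [CompleteSpace H]
  [NormedAddCommGroup H'] [InnerProductSpace ℂ H'] [CompleteSpace H']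
  {Λ Λ' : TC H →ₗ[ℂ] TC H'} {c c' : ℝ≥0∞}

/-- An infimum over an empty set is `∞`, so a finite cb-norm forces every ampliation to exist; it is
unique, so the infimum is its trace norm. Scaling passes from trace norm `1` to general operators,
with `0` handled separately. -/
theorem amplBound_of_cbNorm_le (hc : c ≠ ⊤) (h : cbNorm Λ ≤ c) : AmplBound Λ c := by
  intro K _ _ _ _ X
  have unit : ∀ X : TC (HTensor H K), traceNorm (X : HTensor H K →L[ℂ] HTensor H K) = 1 →
      ∃ Y : TC (HTensor H' K), IsAmpl Λ X Y ∧
        traceNorm (Y : HTensor H' K →L[ℂ] HTensor H' K) ≤ c := by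
    intro X hX
    have h1 : ⨅ (Y : TC (HTensor H' K)) (_ : IsAmpl Λ X Y),
        traceNorm (Y : HTensor H' K →L[ℂ] HTensor H' K) ≤ c := by
      refine le_trans ?_ h
      refine le_iSup_of_le K ?_
      refine le_iSup_of_le ‹NormedAddCommGroup K› ?_
      refine le_iSup_of_le ‹InnerProductSpace ℂ K› ?_
      refine le_iSup_of_le ‹CompleteSpace K› ?_
      refine le_iSup_of_le ‹TopologicalSpace.SeparableSpace K› ?_
      refine le_iSup_of_le X ?_
      exact le_iSup_of_le hX le_rfl
    obtain ⟨Y, hY⟩ := iInf_lt_iff.1 (lt_of_le_of_lt h1 (lt_top_iff_ne_top.2 hc))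
    obtain ⟨hY, -⟩ := iInf_lt_iff.1 hY
    refine ⟨Y, hY, le_trans (le_iInf₂ fun Y' hY' => ?_) h1⟩
    rw [hY.unique hY']
  by_cases hX : traceNorm (X : HTensor H K →L[ℂ] HTensor H K) = 0
  · have h0 : X = 0 := Subtype.ext (eq_zero_of_traceNorm_eq_zero hX)
    refine ⟨0, fun x y => ?_, ?_⟩
    · rw [h0, ← sliceL_apply, ← sliceL_apply, map_zero, map_zero, map_zero]
    · rw [ZeroMemClass.coe_zero, traceNorm_zero]; exact bot_le
  · set r := (traceNorm (X : HTensor H K →L[ℂ] HTensor H K)).toReal with hr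
    have hr0 : 0 < r := ENNReal.toReal_pos hX X.2.ne
    have hrX : traceNorm (X : HTensor H K →L[ℂ] HTensor H K) = ENNReal.ofReal r :=
      (ENNReal.ofReal_toReal X.2.ne).symm
    have hr1 : (r : ℂ) ≠ 0 := by exact_mod_cast hr0.ne'
    obtain ⟨Y, hY, hYn⟩ := unit (((r : ℂ)⁻¹) • X) (by
      rw [Submodule.coe_smul, traceNorm_smul, hrX, ← ofReal_norm, ← ENNReal.ofReal_mul (norm_nonneg _)]
      simp [abs_of_pos hr0, hr0.ne'])
    refine ⟨(r : ℂ) • Y, ?_, ?_⟩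
    · have := hY.smul (r : ℂ)
      rwa [smul_smul, mul_inv_cancel₀ hr1, one_smul] at this
    · rw [Submodule.coe_smul, traceNorm_smul, hrX, mul_comm c]
      gcongr
      rw [← ofReal_norm, Complex.norm_real, Real.norm_of_nonneg hr0.le]

variable (K : Type u) [NormedAddCommGroup K] [InnerProductSpace ℂ K] [CompleteSpace K]
  [TopologicalSpace.SeparableSpace K]

open Classical in
/-- `Λ ⊗ 1` as a bounded operator (`0` if it is not bounded). -/
def amplOp (Λ : TC H →ₗ[ℂ] TC H') : TN (HTensor H K) →L[ℝ] TN (HTensor H' K) :=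
  if h : ∃ c, c ≠ ⊤ ∧ AmplBound Λ c then
    TN.lift (h.choose_spec.2.amplL K) h.choose_spec.1 h.choose_spec.2.traceNorm_le
  else 0

variable {K}

theorem AmplBound.amplOp_of (h : AmplBound Λ c) (hc : c ≠ ⊤) (X : TC (HTensor H K)) :
    amplOp K Λ (TN.of _ X) = TN.of _ (ampl Λ X) := by
  have hex : ∃ c, c ≠ ⊤ ∧ AmplBound Λ c := ⟨c, hc, h⟩
  rw [amplOp, dif_pos hex]
  rfl

theorem AmplBound.norm_amplOp_le (h : AmplBound Λ c) (hc : c ≠ ⊤) :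
    ‖amplOp K Λ‖ ≤ c.toReal := by
  refine ContinuousLinearMap.opNorm_le_bound _ ENNReal.toReal_nonneg fun X => ?_
  have h1 := ENNReal.toReal_mono (ENNReal.mul_ne_top hc ((TN.of _).symm X).2.ne)
    (h.traceNorm_le ((TN.of _).symm X))
  rw [ENNReal.toReal_mul] at h1
  have h2 : amplOp K Λ X = TN.of _ (ampl Λ ((TN.of _).symm X)) := h.amplOp_of hc _
  rw [h2]
  exact h1

theorem AmplBound.add (h : AmplBound Λ c) (h' : AmplBound Λ' c') : AmplBound (Λ + Λ') (c + c') := by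
  intro K _ _ _ _ X
  obtain ⟨Y, hY, hYn⟩ := h K X
  obtain ⟨Y', hY', hYn'⟩ := h' K X
  refine ⟨Y + Y', hY.add_left hY', ?_⟩
  rw [Submodule.coe_add, add_mul]
  exact (traceNorm_add_le _ _).trans (add_le_add hYn hYn')

theorem AmplBound.smul (h : AmplBound Λ c) (a : ℂ) : AmplBound (a • Λ) (‖a‖ₑ * c) := by
  intro K _ _ _ _ X
  obtain ⟨Y, hY, hYn⟩ := h K X
  refine ⟨a • Y, hY.smul_left a, ?_⟩
  rw [Submodule.coe_smul, traceNorm_smul, mul_assoc]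
  gcongr

theorem sub_eq_add_neg_one_smul : Λ - Λ' = Λ + (-1 : ℂ) • Λ' :=
  LinearMap.ext fun X => by
    rw [LinearMap.sub_apply, LinearMap.add_apply, LinearMap.smul_apply, neg_one_smul,
      sub_eq_add_neg]

theorem AmplBound.sub (h : AmplBound Λ c) (h' : AmplBound Λ' c') : AmplBound (Λ - Λ') (c + c') := by
  have h1 := h.add (h'.smul (-1))
  rwa [enorm_neg, enorm_one, one_mul, ← sub_eq_add_neg_one_smul] at h1

theorem amplOp_sub (h : AmplBound Λ c) (hc : c ≠ ⊤) (h' : AmplBound Λ' c') (hc' : c' ≠ ⊤) :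
    amplOp K (Λ - Λ') = amplOp K Λ - amplOp K Λ' := by
  ext X
  have h1 := (h.sub h').amplOp_of (ENNReal.add_ne_top.2 ⟨hc, hc'⟩) ((TN.of _).symm X)
  have h2 := (h.isAmpl ((TN.of _).symm X)).add_left
    ((h'.isAmpl ((TN.of _).symm X)).smul_left (-1))
  rw [← sub_eq_add_neg_one_smul] at h2
  rw [h2.ampl_eq, map_add, map_smul, neg_one_smul, ← sub_eq_add_neg, ← h.amplOp_of hc, ← h'.amplOp_of hc'] at h1
  exact h1

theorem amplOp_smul (h : AmplBound Λ c) (hc : c ≠ ⊤) (r : ℝ) :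
    amplOp K ((r : ℂ) • Λ) = r • amplOp K Λ := by
  ext X
  have h1 := (h.smul (r : ℂ)).amplOp_of (ENNReal.mul_ne_top enorm_ne_top hc) ((TN.of _).symm X)
  have h2 := (h.isAmpl ((TN.of _).symm X)).smul_left (r : ℂ)
  rw [h2.ampl_eq, map_smul, ← h.amplOp_of hc] at h1
  exact h1

end Ampliation

/-! ### Twice differentiable curves -/

section Curves

variable {F G : Type*} [NormedAddCommGroup F] [NormedSpace ℝ F] [NormedAddCommGroup G]
  [NormedSpace ℝ G]

/-- Differentiability near `0`, with a derivative that is differentiable at `0`. -/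
def TwiceDiff (f : ℝ → F) : Prop :=
  ∃ f' : ℝ → F, (∀ᶠ t in 𝓝 0, HasDerivAt f (f' t) t) ∧ DifferentiableAt ℝ f' 0

theorem twiceDiff_const (x : F) : TwiceDiff fun _ : ℝ => x :=
  ⟨fun _ => 0, .of_forall fun t => hasDerivAt_const t x, differentiableAt_const 0⟩

theorem TwiceDiff.clm_apply {A : ℝ → F →L[ℝ] G} {x : ℝ → F} (hA : TwiceDiff A)
    (hx : TwiceDiff x) : TwiceDiff fun t => A t (x t) := by
  obtain ⟨A', hA, hA'⟩ := hA
  obtain ⟨x', hx, hx'⟩ := hx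
  refine ⟨fun t => A' t (x t) + A t (x' t), ?_, ?_⟩
  · filter_upwards [hA, hx] with t h1 h2
    exact h1.clm_apply h2
  · exact (hA'.clm_apply hx.self_of_nhds.differentiableAt).add
      (hA.self_of_nhds.differentiableAt.clm_apply hx')

/-- Taylor's formula with the remainder in Peano's form. -/
theorem TwiceDiff.taylor {f : ℝ → F} (hf : TwiceDiff f) :
    ∃ a b : F, ∀ ε > 0, ∃ δ > 0, ∀ t : ℝ, |t| < δ →
      ‖f t - f 0 - t • a - t ^ 2 • b‖ ≤ ε * t ^ 2 := by
  obtain ⟨f', hf, hf'⟩ := hf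
  obtain ⟨c, hc⟩ : ∃ c, HasDerivAt f' c 0 := ⟨_, hf'.hasDerivAt⟩
  refine ⟨f' 0, (1 / 2 : ℝ) • c, fun ε hε => ?_⟩
  have h1 : ∀ᶠ t in 𝓝 (0 : ℝ), ‖f' t - f' 0 - t • c‖ ≤ ε * ‖t‖ := by
    have := (hasDerivAt_iff_isLittleO.1 hc).def hε
    simpa using this
  obtain ⟨δ, hδ, h⟩ := Metric.eventually_nhds_iff.1 (hf.and h1)
  simp only [Real.dist_0_eq_abs] at h
  refine ⟨δ, hδ, fun t ht => ?_⟩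
  have hd : ∀ s : ℝ, |s| ≤ |t| → HasDerivAt (fun s => f s - s • f' 0 - s ^ 2 • (1 / 2 : ℝ) • c)
      (f' s - f' 0 - s • c) s := by
    intro s hs
    have h2 := ((h (hs.trans_lt ht)).1.sub ((hasDerivAt_id s).smul_const (f' 0))).sub
      ((hasDerivAt_pow 2 s).smul_const ((1 / 2 : ℝ) • c))
    refine h2.congr_deriv ?_
    rw [one_smul, smul_smul]
    congr 2
    push_cast
    ring
  have hconv : Convex ℝ {s : ℝ | |s| ≤ |t|} := by
    have : {s : ℝ | |s| ≤ |t|} = Set.Icc (-|t|) |t| := by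
      ext s; simp [abs_le]
    rw [this]; exact convex_Icc _ _
  have h3 := hconv.norm_image_sub_le_of_norm_hasDerivWithin_le (C := ε * |t|)
    (fun s hs => (hd s hs).hasDerivWithinAt) (fun s hs => by
      refine (h (lt_of_le_of_lt hs ht)).2.trans ?_
      rw [Real.norm_eq_abs]
      exact mul_le_mul_of_nonneg_left hs hε.le)
    (show (0 : ℝ) ∈ {s : ℝ | |s| ≤ |t|} by simp) (show t ∈ {s : ℝ | |s| ≤ |t|} by simp)
  have e : f t - t • f' 0 - t ^ 2 • (1 / 2 : ℝ) • c - (f 0 - (0 : ℝ) • f' 0 -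
      (0 : ℝ) ^ 2 • (1 / 2 : ℝ) • c) = f t - f 0 - t • f' 0 - t ^ 2 • (1 / 2 : ℝ) • c := by
    simp only [zero_smul, ne_eq, OfNat.ofNat_ne_zero, not_false_eq_true, zero_pow, sub_zero]
    abel
  rw [e] at h3
  refine h3.trans (le_of_eq ?_)
  rw [sub_zero, Real.norm_eq_abs, mul_assoc, abs_mul_abs_self, sq]

end Curves

/-! ### Smoothness of the output -/

section Smoothness

variable {H H' : Type u}
  [NormedAddCommGroup H] [InnerProductSpace ℂ H] [CompleteSpace H]
  [NormedAddCommGroup H'] [InnerProductSpace ℂ H'] [CompleteSpace H']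
  {m : ℕ} {Λ : EuclideanSpace ℝ (Fin m) → (TC H →ₗ[ℂ] TC H')}
  {Θ : Set (EuclideanSpace ℝ (Fin m))} {a₁ : ℝ}

theorem partialDeriv_spec {i : Fin m} {θ : EuclideanSpace ℝ (Fin m)}
    (h : ∃ D, HasPartial Λ i θ D) : HasPartial Λ i θ (partialDeriv Λ i θ) := by
  rw [partialDeriv, dif_pos h]
  exact h.choose_spec

theorem eventually_add_smul_mem (hΘ : IsOpen Θ) {θ : EuclideanSpace ℝ (Fin m)} (hθ : θ ∈ Θ)
    (v : EuclideanSpace ℝ (Fin m)) : ∀ᶠ t : ℝ in 𝓝 0, θ + t • v ∈ Θ := by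
  have h : ContinuousAt (fun t : ℝ => θ + t • v) 0 := by fun_prop
  exact h.eventually (by simpa using hΘ.mem_nhds hθ)

variable (K : Type u) [NormedAddCommGroup K] [InnerProductSpace ℂ K] [CompleteSpace K]
  [TopologicalSpace.SeparableSpace K]

/-- Forming `Λ ⊗ 1` is linear and contractive from the cb-norm to the operator norm, so it carries
the difference quotient and its limit to bounded operators on the normed trace class. -/
theorem HasPartial.hasDerivAt_amplOp (hΘ : IsOpen Θ)
    {F : EuclideanSpace ℝ (Fin m) → (TC H →ₗ[ℂ] TC H')} {i : Fin m} {c : ℝ≥0∞} (hc : c ≠ ⊤)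
    (hF : ∀ θ ∈ Θ, AmplBound (F θ) c) {D : TC H →ₗ[ℂ] TC H'} (hD : AmplBound D c)
    {θ : EuclideanSpace ℝ (Fin m)} (hθ : θ ∈ Θ) (h : HasPartial F i θ D) :
    HasDerivAt (fun t : ℝ => amplOp K (F (θ + t • EuclideanSpace.single i 1))) (amplOp K D) 0 := by
  rw [hasDerivAt_iff_tendsto_slope, tendsto_iff_norm_sub_tendsto_zero]
  have h1 : Tendsto (fun t : ℝ => (cbNorm (((t : ℂ)⁻¹) •
      (F (θ + t • EuclideanSpace.single i 1) - F θ) - D)).toReal) (𝓝[≠] 0) (𝓝 0) := by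
    have := (ENNReal.tendsto_toReal ENNReal.zero_ne_top).comp h
    simpa [Function.comp_def] using this
  refine squeeze_zero' (.of_forall fun _ => norm_nonneg _) ?_ h1
  have h2 : ∀ᶠ t : ℝ in 𝓝[≠] 0, cbNorm (((t : ℂ)⁻¹) •
      (F (θ + t • EuclideanSpace.single i 1) - F θ) - D) < 1 :=
    h.eventually (gt_mem_nhds one_pos)
  filter_upwards [h2, mem_nhdsWithin_of_mem_nhds (eventually_add_smul_mem hΘ hθ _)] with t ht htΘ
  have b1 := hF _ htΘ
  have b0 := hF _ hθ
  have e : slope (fun t : ℝ => amplOp K (F (θ + t • EuclideanSpace.single i 1))) 0 t - amplOp K D =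
      amplOp K (((t : ℂ)⁻¹) • (F (θ + t • EuclideanSpace.single i 1) - F θ) - D) := by
    have hcc : c + c ≠ ⊤ := ENNReal.add_ne_top.2 ⟨hc, hc⟩
    rw [← Complex.ofReal_inv, amplOp_sub ((b1.sub b0).smul _)
      (ENNReal.mul_ne_top enorm_ne_top hcc) hD hc, amplOp_smul (b1.sub b0) hcc,
      amplOp_sub b1 hc b0 hc, slope_def_module]
    simp
  rw [e]
  exact (amplBound_of_cbNorm_le (ht.trans ENNReal.one_lt_top).ne le_rfl).norm_amplOp_le
    (ht.trans ENNReal.one_lt_top).ne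

/-- The derivative at `0` along the coordinate line, applied at the translated base point. -/
theorem hasDerivAt_amplOp (hΘ : IsOpen Θ)
    {F F' : EuclideanSpace ℝ (Fin m) → (TC H →ₗ[ℂ] TC H')} {i : Fin m} {c : ℝ≥0∞} (hc : c ≠ ⊤)
    (hF : ∀ θ ∈ Θ, AmplBound (F θ) c) (hF' : ∀ θ ∈ Θ, AmplBound (F' θ) c)
    (h : ∀ θ ∈ Θ, HasPartial F i θ (F' θ)) (θ : EuclideanSpace ℝ (Fin m)) {t : ℝ}
    (ht : θ + t • EuclideanSpace.single i 1 ∈ Θ) :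
    HasDerivAt (fun t : ℝ => amplOp K (F (θ + t • EuclideanSpace.single i 1)))
      (amplOp K (F' (θ + t • EuclideanSpace.single i 1))) t := by
  have h1 := (h _ ht).hasDerivAt_amplOp K hΘ hc hF (hF' _ ht) ht
  have h2 : HasDerivAt (fun s : ℝ => amplOp K (F (θ + t • EuclideanSpace.single i 1 +
      (s - t) • EuclideanSpace.single i 1)))
      (amplOp K (F' (θ + t • EuclideanSpace.single i 1))) t := by
    rw [← sub_self t] at h1
    exact h1.comp_sub_const t t
  refine h2.congr_of_eventuallyEq (.of_forall fun s => ?_)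
  simp only
  congr 2
  rw [add_assoc, ← add_smul, add_sub_cancel]

theorem AmplBound.mono {Φ : TC H →ₗ[ℂ] TC H'} {c d : ℝ≥0∞} (h : AmplBound Φ c) (hcd : c ≤ d) :
    AmplBound Φ d := by
  intro K _ _ _ _ X
  obtain ⟨Y, hY, hn⟩ := h K X
  exact ⟨Y, hY, hn.trans (by gcongr)⟩

theorem twiceDiff_amplOp (hΘ : IsOpen Θ) (hΛ : ∀ θ ∈ Θ, IsCPTP (Λ θ))
    (hreg : RegularFamily Θ a₁ Λ) {θ : EuclideanSpace ℝ (Fin m)} (hθ : θ ∈ Θ) (i : Fin m) :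
    TwiceDiff fun t : ℝ => amplOp K (Λ (θ + t • EuclideanSpace.single i 1)) := by
  -- One finite constant that bounds the channels (by `4`) and both orders of derivatives (by `a₁ /
  -- 2`).
  have hc : (4 + ENNReal.ofReal (a₁ / 2)) ≠ ⊤ := by simp
  have b0 : ∀ θ ∈ Θ, AmplBound (Λ θ) (4 + ENNReal.ofReal (a₁ / 2)) := fun θ hθ =>
    (hΛ θ hθ).amplBound.mono le_self_add
  have b1 : ∀ θ ∈ Θ, AmplBound (partialDeriv Λ i θ) (4 + ENNReal.ofReal (a₁ / 2)) := fun θ hθ =>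
    amplBound_of_cbNorm_le hc ((hreg.bound i θ hθ).trans le_add_self)
  have b2 : ∀ θ ∈ Θ, AmplBound (partialDeriv (partialDeriv Λ i) i θ)
      (4 + ENNReal.ofReal (a₁ / 2)) := fun θ hθ =>
    amplBound_of_cbNorm_le hc ((hreg.bound₂ i i θ hθ).trans le_add_self)
  refine ⟨fun t => amplOp K (partialDeriv Λ i (θ + t • EuclideanSpace.single i 1)), ?_, ?_⟩
  · filter_upwards [eventually_add_smul_mem hΘ hθ (EuclideanSpace.single i 1)] with t ht
    exact hasDerivAt_amplOp K hΘ hc b0 b1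
      (fun θ hθ => partialDeriv_spec (hreg.exists_partial i θ hθ)) θ ht
  · exact ((partialDeriv_spec (hreg.exists_partial₂ i i θ hθ)).hasDerivAt_amplOp K hΘ hc b1
      (b2 θ hθ) hθ).differentiableAt

/-- The state is obtained by alternately applying the twice differentiable operator curve of `Λ ⊗ 1`
and constant bounded operators, so the product rule `TwiceDiff.clm_apply` propagates smoothness.
Agreement is asked only inside `Θ`, where the family is controlled. -/
theorem Estimator.twiceDiff_run (hΘ : IsOpen Θ) (hΛ : ∀ θ ∈ Θ, IsCPTP (Λ θ))
    (hreg : RegularFamily Θ a₁ Λ) {θ : EuclideanSpace ℝ (Fin m)} (hθ : θ ∈ Θ) (i : Fin m)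
    (E : Estimator H H' m) (n : ℕ) :
    ∃ f : ℝ → TN (HTensor H' E.K), TwiceDiff f ∧
      ∀ t : ℝ, θ + t • EuclideanSpace.single i 1 ∈ Θ →
        f t = TN.of _ (E.run (fun _ => Λ (θ + t • EuclideanSpace.single i 1)) n) := by
  have hA := twiceDiff_amplOp E.K hΘ hΛ hreg hθ i
  induction n with
  | zero =>
    exact ⟨_, hA.clm_apply (twiceDiff_const (TN.of _ E.ρ)), fun t ht =>
      (hΛ _ ht).amplBound.amplOp_of (by simp) _⟩
  | succ n ih =>
    obtain ⟨f, hf, he⟩ := ih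
    refine ⟨_, hA.clm_apply ((twiceDiff_const (TN.lift (E.Ξ n) (c := 4) (by simp)
      (E.Ξ_cptp n).traceNorm_le)).clm_apply hf), fun t ht => ?_⟩
    rw [he t ht, TN.lift_of, (hΛ _ ht).amplBound.amplOp_of (by simp)]
    rfl

/-- The second order expansion of the output. -/
theorem Estimator.output_taylor (hΘ : IsOpen Θ) (hΛ : ∀ θ ∈ Θ, IsCPTP (Λ θ))
    (hreg : RegularFamily Θ a₁ Λ) {θ : EuclideanSpace ℝ (Fin m)} (hθ : θ ∈ Θ) (i : Fin m)
    (E : Estimator H H' m) (n : ℕ) :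
    ∃ σ₁ σ₂ : TC (HTensor H' E.K), ∀ ε > 0, ∀ᶠ t : ℝ in 𝓝 0,
      traceNorm ((E.output (Λ (θ + t • EuclideanSpace.single i 1)) n - E.output (Λ θ) n -
        (t : ℂ) • σ₁ - ((t ^ 2 : ℝ) : ℂ) • σ₂ : TC (HTensor H' E.K)) :
          HTensor H' E.K →L[ℂ] HTensor H' E.K) ≤ ENNReal.ofReal (ε * t ^ 2) := by
  obtain ⟨f, hf, he⟩ := E.twiceDiff_run hΘ hΛ hreg hθ i (n - 1)
  obtain ⟨a, b, h⟩ := hf.taylor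
  refine ⟨(TN.of _).symm a, (TN.of _).symm b, fun ε hε => ?_⟩
  obtain ⟨δ, hδ, h⟩ := h ε hε
  filter_upwards [eventually_add_smul_mem hΘ hθ (EuclideanSpace.single i 1),
    Metric.ball_mem_nhds (0 : ℝ) hδ] with t ht htδ
  have h1 := h t (by simpa [Real.dist_0_eq_abs] using htδ)
  have h0 := he 0 (by simpa using hθ)
  rw [zero_smul, add_zero] at h0
  rw [he t ht, h0] at h1
  rw [← TN.ofReal_norm_of]
  exact ENNReal.ofReal_le_ofReal h1

end Smoothness

/-! ### Approximation of derivatives -/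

section Derivatives

/-- Convergence of the derivatives of truncated expectations: the truncation at level `k + 1` costs
`(k + 1)⁻²` and a term controlled by a tail probability `p k`, which decays faster than `(k + 1)⁻²` at
`0` and has a symmetric second order expansion; the second order remainder of the truncated
expectation grows linearly in `k`. -/
theorem tendsto_deriv_of_truncation {f : ℝ → ℝ} {d : ℝ} (hf : HasDerivAt f d 0)
    {g p : ℕ → ℝ → ℝ} {d' κ : ℕ → ℝ} {K C : ℝ} (hK : 0 ≤ K)
    (h1 : ∀ᶠ t in 𝓝 (0 : ℝ), ∀ k : ℕ, |f t - g k t| ≤ 1 / ((k : ℝ) + 1) ^ 2 + √(C * p k t))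
    (h2 : ∀ᶠ t in 𝓝 (0 : ℝ), ∀ k : ℕ, |g k t - g k 0 - t * d' k| ≤ K * ((k : ℝ) + 2) * t ^ 2)
    (h3 : ∀ ε > 0, ∀ᶠ t in 𝓝 (0 : ℝ), ∀ k,
      p k t + p k (-t) ≤ 2 * p k 0 + 2 * t ^ 2 * κ k + ε * t ^ 2)
    (hp : ∀ᶠ t in 𝓝 (0 : ℝ), ∀ k, 0 ≤ p k t)
    (hp0 : Tendsto (fun k : ℕ => ((k : ℝ) + 1) ^ 2 * p k 0) atTop (𝓝 0))
    (hκ : Tendsto κ atTop (𝓝 0)) : Tendsto d' atTop (𝓝 d) := by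
  have hr : Tendsto (fun k : ℕ => (k : ℝ) + 1) atTop atTop :=
    tendsto_atTop_add_const_right _ _ tendsto_natCast_atTop_atTop
  have main : ∀ s : ℝ, 0 < s → ∀ δ > 0, ∀ᶠ k in atTop, |d - d' k| ≤ 2 * K * s + δ := by
    intro s hs δ hδ
    -- The increment `t = s / (k + 1)` balances the remainder, of size `k t²`, against the
    -- truncation error, of size `o(1 / k)`.
    have ht : Tendsto (fun k : ℕ => s / ((k : ℝ) + 1)) atTop (𝓝 0) := hr.const_div_atTop s
    have ht' : Tendsto (fun k : ℕ => -(s / ((k : ℝ) + 1))) atTop (𝓝 0) := by simpa using ht.neg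
    have hrpos : ∀ k : ℕ, (0 : ℝ) < (k : ℝ) + 1 := fun k => by positivity
    -- In `h3` the nonnegative value at `-t` is dropped. Multiplication by `(k + 1)²` turns each
    -- factor `t²` into `s²`, so the terms vanish apart from a remainder that the choice `ε / (2
    -- s²)` makes `ε / 2`.
    have hu : Tendsto (fun k : ℕ => ((k : ℝ) + 1) ^ 2 * p k (s / ((k : ℝ) + 1))) atTop (𝓝 0) := by
      rw [Metric.tendsto_nhds]
      intro ε hε
      have hε' : 0 < ε / (2 * s ^ 2) := by positivity
      have hlim : Tendsto (fun k : ℕ => 2 * (((k : ℝ) + 1) ^ 2 * p k 0) + 2 * s ^ 2 * κ k +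
          ε / (2 * s ^ 2) * s ^ 2) atTop (𝓝 (2 * 0 + 2 * s ^ 2 * 0 + ε / (2 * s ^ 2) * s ^ 2)) :=
        ((hp0.const_mul 2).add (hκ.const_mul _)).add tendsto_const_nhds
      have hlt : 2 * 0 + 2 * s ^ 2 * 0 + ε / (2 * s ^ 2) * s ^ 2 < ε := by
        field_simp
        linarith
      filter_upwards [ht.eventually (h3 _ hε'), ht.eventually hp, ht'.eventually hp,
        hlim.eventually (gt_mem_nhds hlt)] with k e3 epos eneg el
      have a1 := e3 k
      have a2 := epos k
      have a3 := eneg k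
      have hk := hrpos k
      rw [Real.dist_0_eq_abs, abs_of_nonneg (by positivity)]
      refine lt_of_le_of_lt ?_ el
      have : ((k : ℝ) + 1) ^ 2 * p k (s / ((k : ℝ) + 1)) ≤ ((k : ℝ) + 1) ^ 2 *
          (2 * p k 0 + 2 * (s / ((k : ℝ) + 1)) ^ 2 * κ k +
            ε / (2 * s ^ 2) * (s / ((k : ℝ) + 1)) ^ 2) := by
        gcongr
        linarith
      refine this.trans (le_of_eq ?_)
      field_simp
    have hrem : Tendsto (fun t : ℝ => |f t - f 0 - t * d| / |t|) (𝓝[≠] 0) (𝓝 0) := by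
      have := hasDerivAt_iff_tendsto.1 hf
      refine (this.mono_left nhdsWithin_le_nhds).congr fun t => ?_
      simp [div_eq_inv_mul]
    have htne : Tendsto (fun k : ℕ => s / ((k : ℝ) + 1)) atTop (𝓝[≠] 0) :=
      tendsto_nhdsWithin_iff.2 ⟨ht, .of_forall fun k => (div_pos hs (hrpos k)).ne'⟩
    have hinv : Tendsto (fun k : ℕ => 1 / ((k : ℝ) + 1)) atTop (𝓝 0) := hr.const_div_atTop 1
    have hlim : Tendsto (fun k : ℕ =>
        |f (s / ((k : ℝ) + 1)) - f 0 - s / ((k : ℝ) + 1) * d| / |s / ((k : ℝ) + 1)| +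
        2 / s * (1 / ((k : ℝ) + 1)) +
        1 / s * √(C * (((k : ℝ) + 1) ^ 2 * p k (s / ((k : ℝ) + 1)))) +
        1 / s * √(C * (((k : ℝ) + 1) ^ 2 * p k 0)) + 2 * K * s) atTop
        (𝓝 (0 + 2 / s * 0 + 1 / s * √(C * 0) + 1 / s * √(C * 0) + 2 * K * s)) :=
      ((((hrem.comp htne).add (hinv.const_mul _)).add ((hu.const_mul C).sqrt.const_mul _)).add
        ((hp0.const_mul C).sqrt.const_mul _)).add tendsto_const_nhds
    have hlt : 0 + 2 / s * 0 + 1 / s * √(C * 0) + 1 / s * √(C * 0) + 2 * K * s <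
        2 * K * s + δ := by simp [hδ]
    filter_upwards [hlim.eventually (gt_mem_nhds hlt), ht.eventually h1, ht.eventually h2] with
      k el e1 e2
    refine le_trans ?_ el.le
    have hk := hrpos k
    set r : ℝ := (k : ℝ) + 1 with hr'
    have e1' := e1 k
    have e2' := e2 k
    have e0 := h1.self_of_nhds k
    set t := s / r with ht_def
    have htpos : 0 < t := div_pos hs hk
    have hsq : ∀ q : ℝ, √(C * (r ^ 2 * q)) = r * √(C * q) := fun q => by
      rw [mul_left_comm, Real.sqrt_mul (sq_nonneg r), Real.sqrt_sq hk.le]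
    have key : t * |d - d' k| ≤ |f t - f 0 - t * d| + 2 / r ^ 2 + √(C * p k t) + √(C * p k 0) +
        2 * K * s * t := by
      have a : t * (d - d' k) = -(f t - f 0 - t * d) + (f t - g k t) - (f 0 - g k 0) +
          (g k t - g k 0 - t * d' k) := by ring
      have b : t * |d - d' k| = |t * (d - d' k)| := by rw [abs_mul, abs_of_pos htpos]
      -- Since `k + 2 ≤ 2 (k + 1)` and `(k + 1) t = s`.
      have c : K * ((k : ℝ) + 2) * t ^ 2 ≤ 2 * K * s * t := by
        have h5 : ((k : ℝ) + 2) * t ≤ 2 * s := by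
          rw [ht_def, ← mul_div_assoc, div_le_iff₀ hk]
          nlinarith [Nat.cast_nonneg (α := ℝ) k]
        nlinarith [mul_le_mul_of_nonneg_left h5 (mul_nonneg hK htpos.le)]
      have t1 := abs_le.1 (le_refl |f t - f 0 - t * d|)
      have t2 := abs_le.1 e1'
      have t3 := abs_le.1 e0
      have t4 := abs_le.1 (e2'.trans c)
      have e : 2 / r ^ 2 = 1 / r ^ 2 + 1 / r ^ 2 := by ring
      rw [b, a, e, abs_le]
      constructor <;> linarith [t1.1, t1.2, t2.1, t2.2, t3.1, t3.2, t4.1, t4.2]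
    rw [hsq, hsq, abs_of_pos htpos]
    have hdiv : |d - d' k| ≤ (|f t - f 0 - t * d| + 2 / r ^ 2 + √(C * p k t) + √(C * p k 0) +
        2 * K * s * t) / t := by
      rw [le_div_iff₀ htpos, mul_comm]; exact key
    refine hdiv.trans (le_of_eq ?_)
    rw [add_div, add_div, add_div, add_div, mul_div_assoc (2 * K * s), div_self htpos.ne', mul_one]
    congr 1
    have e4 : ∀ q : ℝ, q / t = 1 / s * (r * q) := fun q => by rw [ht_def]; field_simp
    rw [e4 (√(C * p k t)), e4 (√(C * p k 0)), e4 (2 / r ^ 2)]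
    congr 3
    field_simp
  rw [Metric.tendsto_nhds]
  intro ε hε
  -- With this `s` the surviving term `2 K s` is at most `ε / 2`; `K + 1` avoids division by zero.
  have hs : 0 < ε / (4 * (K + 1)) := by positivity
  filter_upwards [main _ hs (ε / 4) (by positivity)] with k hk
  rw [Real.dist_eq, abs_sub_comm]
  refine lt_of_le_of_lt hk ?_
  have : 2 * K * (ε / (4 * (K + 1))) ≤ ε / 2 := by
    rw [← mul_div_assoc, div_le_div_iff₀ (by positivity) (by positivity)]
    nlinarith
  linarith

end Derivatives

/-! ### Functionals of a measurement -/

section Functionals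

variable {L : Type u} [NormedAddCommGroup L] [InnerProductSpace ℂ L] [CompleteSpace L]

/-- On positive operators, a trace class operator acts as a difference of positive ones. -/
theorem exists_re_trace_eq_sub (Y : TC L) : ∃ P Q : TC L,
    (P : L →L[ℂ] L).IsPositive ∧ (Q : L →L[ℂ] L).IsPositive ∧
    traceNorm (P : L →L[ℂ] L) ≤ traceNorm (Y : L →L[ℂ] L) ∧
    traceNorm (Q : L →L[ℂ] L) ≤ traceNorm (Y : L →L[ℂ] L) ∧
    ∀ N : L →L[ℂ] L, N.IsPositive → (trace (N.comp (Y : L →L[ℂ] L))).re =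
      (trace (N.comp (P : L →L[ℂ] L))).re - (trace (N.comp (Q : L →L[ℂ] L))).re := by
  obtain ⟨P, hP, hPn, hY⟩ := TC.exists_pos_decomp Y
  refine ⟨P 0, P 1, hP 0, hP 1, hPn 0, hPn 1, fun N hN => ?_⟩
  have h1 := congrArg ((trL L).comp (TC.mulLeft N)) hY
  rw [map_add, map_sub, map_smul, map_sub] at h1
  have e : trace (N.comp (Y : L →L[ℂ] L)) = trace (N.comp (P 0 : L →L[ℂ] L)) -
      trace (N.comp (P 1 : L →L[ℂ] L)) + Complex.I * (trace (N.comp (P 2 : L →L[ℂ] L)) -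
      trace (N.comp (P 3 : L →L[ℂ] L))) := h1
  rw [e]
  -- Traces against positive operators are real, so the imaginary part of `Y` contributes nothing to
  -- the real part.
  simp [(TC.trace_mulLeft_pos hN (hP 2)).2, (TC.trace_mulLeft_pos hN (hP 3)).2]

variable {l : ℕ} (M : POVM l L)

/-- The functional `X ↦ ∫ h d tr(M X)`, for `h` of finite range. -/
theorem POVM.exists_functional {h : EuclideanSpace ℝ (Fin l) → ℝ} (hh : Measurable h)
    (hfin : (Set.range h).Finite) {c : ℝ} (hc : ∀ ω, |h ω| ≤ c) :
    ∃ φ : TC L →ₗ[ℝ] ℝ,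
      (∀ X : TC L, (X : L →L[ℂ] L).IsPositive → φ X = ∫ ω, h ω ∂(M.law X)) ∧
      ∀ Y : TC L, |φ Y| ≤ 2 * c * (traceNorm (Y : L →L[ℂ] L)).toReal := by
  classical
  obtain ⟨N, y, hyr⟩ := hfin.fin_embedding
  have hmeas : ∀ a, MeasurableSet (h ⁻¹' {y a}) := fun a => hh (measurableSet_singleton _)
  -- The sum over the level sets of `h` is linear in all trace class operators, whereas `law` is
  -- meaningful only for positive ones.
  let φ : TC L →ₗ[ℝ] ℝ := ∑ a, y a • (Complex.reLm.comp
    (((trL L).comp (TC.mulLeft (M.effect (h ⁻¹' {y a})))).restrictScalars ℝ))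
  have hφ : ∀ Y : TC L, φ Y =
      ∑ a, y a * (trace ((M.effect (h ⁻¹' {y a})).comp (Y : L →L[ℂ] L))).re := fun Y => by
    simp only [φ, LinearMap.sum_apply]
    rfl
  have hpos : ∀ X : TC L, (X : L →L[ℂ] L).IsPositive → φ X = ∫ ω, h ω ∂(M.law X) := by
    intro X hX
    have := M.isFiniteMeasure_law hX
    have h1 : h = fun ω => ∑ a, (h ⁻¹' {y a}).indicator (fun _ => y a) ω := by
      funext ω
      have : h ω ∈ Set.range y := hyr ▸ Set.mem_range_self ω
      obtain ⟨a, ha⟩ := this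
      rw [Finset.sum_eq_single a]
      · rw [Set.indicator_of_mem (show ω ∈ h ⁻¹' {y a} from ha.symm), ha]
      · intro b _ hb
        refine Set.indicator_of_notMem (fun h' => ?_) _
        exact hb (y.injective ((Set.mem_singleton_iff.1 h').symm.trans ha.symm))
      · simp
    rw [hφ]
    conv_rhs => rw [h1]
    rw [integral_finsetSum _ fun a _ => (integrable_const _).indicator (hmeas a)]
    refine Finset.sum_congr rfl fun a _ => ?_
    rw [integral_indicator_const _ (hmeas a), smul_eq_mul, M.real_law hX (hmeas a), mul_comm]
  refine ⟨φ, hpos, fun Y => ?_⟩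
  have hb : ∀ X : TC L, (X : L →L[ℂ] L).IsPositive →
      |φ X| ≤ c * (traceNorm (X : L →L[ℂ] L)).toReal := by
    intro X hX
    have := M.isFiniteMeasure_law hX
    rw [hpos X hX, ← Real.norm_eq_abs]
    refine (norm_integral_le_of_norm_le_const (.of_forall hc)).trans (le_of_eq ?_)
    rw [Measure.real, M.law_univ hX]
  obtain ⟨P, Q, hP, hQ, hPn, hQn, hY⟩ := exists_re_trace_eq_sub Y
  have e : φ Y = φ P - φ Q := by
    rw [hφ, hφ, hφ, ← Finset.sum_sub_distrib]
    refine Finset.sum_congr rfl fun a _ => ?_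
    rw [hY _ (M.isPositive _ (hmeas a))]
    ring
  have hc0 : 0 ≤ c := (abs_nonneg _).trans (hc 0)
  have b1 := (hb P hP).trans
    (mul_le_mul_of_nonneg_left (ENNReal.toReal_mono Y.2.ne hPn) hc0)
  have b2 := (hb Q hQ).trans
    (mul_le_mul_of_nonneg_left (ENNReal.toReal_mono Y.2.ne hQn) hc0)
  rw [e]
  refine (abs_sub _ _).trans ?_
  linarith

theorem POVM.abs_re_trace_effect_le {Δ : Set (EuclideanSpace ℝ (Fin l))} (hΔ : MeasurableSet Δ)
    (Y : TC L) : |(trace ((M.effect Δ).comp (Y : L →L[ℂ] L))).re| ≤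
      2 * (traceNorm (Y : L →L[ℂ] L)).toReal := by
  obtain ⟨P, Q, hP, hQ, hPn, hQn, hY⟩ := exists_re_trace_eq_sub Y
  have hb : ∀ X : TC L, (X : L →L[ℂ] L).IsPositive →
      |(trace ((M.effect Δ).comp (X : L →L[ℂ] L))).re| ≤ (traceNorm (X : L →L[ℂ] L)).toReal := by
    intro X hX
    have := M.isFiniteMeasure_law hX
    rw [← M.real_law hX hΔ, abs_of_nonneg measureReal_nonneg, ← M.law_univ hX]
    exact measureReal_mono (Set.subset_univ _)
  rw [hY _ (M.isPositive _ hΔ)]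
  have b1 := (hb P hP).trans (ENNReal.toReal_mono Y.2.ne hPn)
  have b2 := (hb Q hQ).trans (ENNReal.toReal_mono Y.2.ne hQn)
  refine (abs_sub _ _).trans ?_
  linarith

/-- Continuity from above of the two finite measures that represent `Y`. Applied to the second order
coefficient of the state, this makes the curvature of the tail probabilities vanish. -/
theorem POVM.tendsto_re_trace_effect (Y : TC L) {A : ℕ → Set (EuclideanSpace ℝ (Fin l))}
    (hA : ∀ k, MeasurableSet (A k)) (hanti : Antitone A) (hempty : ⋂ k, A k = ∅) :
    Tendsto (fun k => (trace ((M.effect (A k)).comp (Y : L →L[ℂ] L))).re) atTop (𝓝 0) := by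
  obtain ⟨P, Q, hP, hQ, hPn, hQn, hY⟩ := exists_re_trace_eq_sub Y
  have hb : ∀ X : TC L, (X : L →L[ℂ] L).IsPositive →
      Tendsto (fun k => (trace ((M.effect (A k)).comp (X : L →L[ℂ] L))).re) atTop (𝓝 0) := by
    intro X hX
    have := M.isFiniteMeasure_law hX
    have h1 := tendsto_measure_iInter_atTop (μ := M.law X) (fun k => (hA k).nullMeasurableSet) hanti
      ⟨0, measure_ne_top _ _⟩
    rw [hempty, measure_empty] at h1
    have h2 := (ENNReal.tendsto_toReal ENNReal.zero_ne_top).comp h1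
    rw [ENNReal.toReal_zero] at h2
    refine h2.congr fun k => ?_
    exact M.real_law hX (hA k)
  simp_rw [fun k => hY _ (M.isPositive _ (hA k))]
  simpa using (hb P hP).sub (hb Q hQ)

end Functionals

/-! ### Truncation -/

section Truncation

variable {m : ℕ}

/-- Rounding of the coordinates to multiples of `r⁻²` in the ball of radius `r`; `0` outside. -/
def truncate (r : ℝ) (v : EuclideanSpace ℝ (Fin m)) : EuclideanSpace ℝ (Fin m) := by
  classical
  exact if ‖v‖ ≤ r then WithLp.toLp 2 fun i => (⌊v i * r ^ 2⌋ : ℝ) / r ^ 2 else 0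

theorem truncate_of_norm_le {r : ℝ} {v : EuclideanSpace ℝ (Fin m)} (h : ‖v‖ ≤ r) (i : Fin m) :
    truncate r v i = (⌊v i * r ^ 2⌋ : ℝ) / r ^ 2 := by
  rw [truncate, if_pos h]

theorem truncate_of_lt_norm {r : ℝ} {v : EuclideanSpace ℝ (Fin m)} (h : r < ‖v‖) :
    truncate r v = 0 := by
  rw [truncate, if_neg (not_le.2 h)]

theorem measurable_truncate (r : ℝ) : Measurable (truncate (m := m) r) := by
  refine Measurable.ite (measurableSet_le measurable_norm measurable_const) ?_ measurable_const
  refine (WithLp.measurable_toLp 2 _).comp (measurable_pi_lambda _ fun i => ?_)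
  fun_prop

theorem abs_truncate_sub_le {r : ℝ} (hr : 0 < r) {v : EuclideanSpace ℝ (Fin m)} (h : ‖v‖ ≤ r)
    (i : Fin m) : |truncate r v i - v i| ≤ 1 / r ^ 2 := by
  have hr2 : 0 < r ^ 2 := by positivity
  have e : (⌊v i * r ^ 2⌋ : ℝ) / r ^ 2 - v i = -(Int.fract (v i * r ^ 2) / r ^ 2) := by
    rw [← Int.self_sub_floor]; field_simp; ring
  rw [truncate_of_norm_le h, e, abs_neg, abs_of_nonneg (div_nonneg (Int.fract_nonneg _) hr2.le)]
  exact div_le_div_of_nonneg_right (Int.fract_lt_one _).le hr2.le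

theorem abs_truncate_le {r : ℝ} (hr : 1 ≤ r) (v : EuclideanSpace ℝ (Fin m)) (i : Fin m) :
    |truncate r v i| ≤ |v i| + 1 := by
  rcases le_or_gt ‖v‖ r with h | h
  · have h1 := abs_truncate_sub_le (by linarith) h i
    have h2 : 1 / r ^ 2 ≤ 1 := by
      rw [div_le_one (by positivity)]; nlinarith
    have h3 := abs_add_le (truncate r v i - v i) (v i)
    rw [sub_add_cancel] at h3
    linarith
  · rw [truncate_of_lt_norm h]
    simpa using by positivity

theorem abs_apply_le_norm (v : EuclideanSpace ℝ (Fin m)) (i : Fin m) : |v i| ≤ ‖v‖ :=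
  PiLp.norm_apply_le v i

theorem abs_truncate_le_add_one {r : ℝ} (hr : 1 ≤ r) (v : EuclideanSpace ℝ (Fin m)) (i : Fin m) :
    |truncate r v i| ≤ r + 1 := by
  rcases le_or_gt ‖v‖ r with h | h
  · have := abs_truncate_le hr v i
    have := abs_apply_le_norm v i
    linarith
  · rw [truncate_of_lt_norm h]
    simp only [PiLp.zero_apply, abs_zero]
    linarith

theorem finite_range_truncate {r : ℝ} (hr : 1 ≤ r) : (Set.range (truncate (m := m) r)).Finite := by
  have hf : (Set.pi Set.univ fun _ : Fin m =>
      (fun z : ℤ => (z : ℝ) / r ^ 2) '' Set.Icc ⌊-((r + 1) * r ^ 2)⌋ ⌈(r + 1) * r ^ 2⌉).Finite :=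
    Set.Finite.pi fun _ => (Set.finite_Icc _ _).image _
  have hr2 : 0 < r ^ 2 := by positivity
  refine ((hf.image (WithLp.toLp 2)).union (Set.finite_singleton 0)).subset ?_
  rintro _ ⟨v, rfl⟩
  rcases le_or_gt ‖v‖ r with h | h
  · refine Or.inl ⟨fun i => truncate r v i, fun i _ => ?_, rfl⟩
    refine ⟨⌊v i * r ^ 2⌋, ⟨?_, ?_⟩, (truncate_of_norm_le h i).symm⟩
    · have h1 := abs_truncate_le_add_one hr v i
      rw [truncate_of_norm_le h, abs_le] at h1
      have h2 := (le_div_iff₀ hr2).1 h1.1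
      exact Int.floor_le_iff.2 (by push_cast; linarith)
    · have h1 := abs_truncate_le_add_one hr v i
      rw [truncate_of_norm_le h, abs_le] at h1
      have h2 := (div_le_iff₀ hr2).1 h1.2
      exact Int.le_ceil_iff.2 (by linarith)
  · exact Or.inr (truncate_of_lt_norm h)

theorem tendsto_truncate (v : EuclideanSpace ℝ (Fin m)) (i : Fin m) :
    Tendsto (fun k : ℕ => truncate ((k : ℝ) + 1) v i) atTop (𝓝 (v i)) := by
  have hr : Tendsto (fun k : ℕ => (k : ℝ) + 1) atTop atTop :=
    tendsto_atTop_add_const_right _ _ tendsto_natCast_atTop_atTop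
  rw [tendsto_iff_norm_sub_tendsto_zero]
  have h0 : Tendsto (fun k : ℕ => 1 / ((k : ℝ) + 1) ^ 2) atTop (𝓝 0) :=
    ((tendsto_pow_atTop two_ne_zero).comp hr).const_div_atTop 1
  refine squeeze_zero' (.of_forall fun _ => norm_nonneg _) ?_ h0
  filter_upwards [hr.eventually (eventually_ge_atTop ‖v‖)] with k hk
  exact abs_truncate_sub_le (by positivity) hk i

end Truncation

/-! ### Moments of truncated random vectors -/

section Moments

variable {Ω : Type*} [MeasurableSpace Ω] {μ : Measure Ω} [IsProbabilityMeasure μ] {m : ℕ}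
  {T : Ω → EuclideanSpace ℝ (Fin m)}

theorem memLp_two_of_lintegral (hT : Measurable T) {C : ℝ}
    (hC : ∫⁻ ω, ‖T ω‖ₑ ^ 2 ∂μ ≤ ENNReal.ofReal C) : MemLp T 2 μ := by
  refine ⟨hT.aestronglyMeasurable, ?_⟩
  rw [eLpNorm_lt_top_iff_lintegral_rpow_enorm_lt_top two_ne_zero ENNReal.ofNat_ne_top]
  simpa using lt_of_le_of_lt hC ENNReal.ofReal_lt_top

theorem integral_norm_sq_le (hT : Measurable T) {C : ℝ} (hC0 : 0 ≤ C)
    (hC : ∫⁻ ω, ‖T ω‖ₑ ^ 2 ∂μ ≤ ENNReal.ofReal C) : ∫ ω, ‖T ω‖ ^ 2 ∂μ ≤ C := by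
  rw [integral_eq_lintegral_of_nonneg_ae (.of_forall fun _ => sq_nonneg _)
    (hT.norm.pow_const 2).aestronglyMeasurable]
  refine ENNReal.toReal_le_of_le_ofReal hC0 (le_trans (le_of_eq ?_) hC)
  refine lintegral_congr fun ω => ?_
  rw [ENNReal.ofReal_pow (norm_nonneg _), ofReal_norm]

theorem integrable_norm_sq (hT2 : MemLp T 2 μ) : Integrable (fun ω => ‖T ω‖ ^ 2) μ :=
  (memLp_two_iff_integrable_sq_norm hT2.1).1 hT2

theorem memLp_apply (hT2 : MemLp T 2 μ) (i : Fin m) : MemLp (fun ω => T ω i) 2 μ :=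
  hT2.of_le ((EuclideanSpace.proj (𝕜 := ℝ) i).continuous.comp_aestronglyMeasurable hT2.1)
    (.of_forall fun ω => PiLp.norm_apply_le (T ω) i)

theorem integrable_apply (hT2 : MemLp T 2 μ) (i : Fin m) : Integrable (fun ω => T ω i) μ :=
  (memLp_apply hT2 i).integrable (by norm_num)

theorem integrable_apply_mul (hT2 : MemLp T 2 μ) (i j : Fin m) :
    Integrable (fun ω => T ω i * T ω j) μ := (memLp_apply hT2 i).integrable_mul (memLp_apply hT2 j)

theorem integrable_truncate (hT : Measurable T) {r : ℝ} (hr : 1 ≤ r) (i : Fin m) :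
    Integrable (fun ω => truncate r (T ω) i) μ := by
  refine Integrable.of_bound (C := r + 1) ?_ (.of_forall fun ω => abs_truncate_le_add_one hr _ _)
  exact ((EuclideanSpace.proj (𝕜 := ℝ) i).continuous.measurable.comp
    ((measurable_truncate r).comp hT)).aestronglyMeasurable

theorem measurableSet_tail (hT : Measurable T) (r : ℝ) : MeasurableSet {ω | r < ‖T ω‖} :=
  measurableSet_lt measurable_const hT.norm

/-- Cauchy-Schwarz between `‖T‖` and the indicator of `A`. -/
theorem integral_norm_indicator_le (hT : Measurable T) {C : ℝ} (hC0 : 0 ≤ C)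
    (hC : ∫⁻ ω, ‖T ω‖ₑ ^ 2 ∂μ ≤ ENNReal.ofReal C) {A : Set Ω} (hA : MeasurableSet A) :
    ∫ ω, ‖T ω‖ * A.indicator (fun _ => (1 : ℝ)) ω ∂μ ≤ √(C * μ.real A) := by
  have hT2 := memLp_two_of_lintegral hT hC
  have h1 : MemLp (A.indicator fun _ => (1 : ℝ)) 2 μ := (memLp_const 1).indicator hA
  have h := integral_mul_le_Lp_mul_Lq_of_nonneg (μ := μ) Real.HolderConjugate.two_two
    (f := fun ω => ‖T ω‖) (g := A.indicator fun _ => (1 : ℝ))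
    (.of_forall fun _ => norm_nonneg _)
    (.of_forall fun ω => Set.indicator_nonneg (fun _ _ => zero_le_one) ω)
    (by simpa using hT2.norm) (by simpa using h1)
  refine h.trans ?_
  have e : ∫ ω, A.indicator (fun _ => (1 : ℝ)) ω ^ (2 : ℝ) ∂μ = μ.real A := by
    rw [← integral_indicator_one hA]
    refine integral_congr_ae (.of_forall fun ω => ?_)
    by_cases hω : ω ∈ A <;> simp [hω]
  rw [e, ← Real.sqrt_eq_rpow, ← Real.sqrt_eq_rpow, ← Real.sqrt_mul' _ measureReal_nonneg]
  refine Real.sqrt_le_sqrt (mul_le_mul_of_nonneg_right ?_ measureReal_nonneg)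
  simpa using integral_norm_sq_le hT hC0 hC

/-- Inside the ball the error is the rounding `r⁻²`; outside it is at most `‖T‖`. The mesh `r⁻²` is
fine enough to remain negligible after division by an increment of order `1 / r`. -/
theorem abs_integral_sub_truncate_le (hT : Measurable T) {C : ℝ} (hC0 : 0 ≤ C)
    (hC : ∫⁻ ω, ‖T ω‖ₑ ^ 2 ∂μ ≤ ENNReal.ofReal C) {r : ℝ} (hr : 1 ≤ r) (i : Fin m) :
    |∫ ω, T ω i ∂μ - ∫ ω, truncate r (T ω) i ∂μ| ≤
      1 / r ^ 2 + √(C * μ.real {ω | r < ‖T ω‖}) := by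
  have hT2 := memLp_two_of_lintegral hT hC
  have hA := measurableSet_tail hT r
  have hint : Integrable
      (fun ω => ‖T ω‖ * {ω | r < ‖T ω‖}.indicator (fun _ => (1 : ℝ)) ω) μ := by
    exact MemLp.integrable_mul (q := 2) hT2.norm ((memLp_const (1 : ℝ)).indicator hA)
  rw [← integral_sub (integrable_apply hT2 i) (integrable_truncate hT hr i), ← Real.norm_eq_abs]
  refine (norm_integral_le_of_norm_le ((integrable_const (1 / r ^ 2)).add hint)
    (.of_forall fun ω => ?_)).trans ?_
  · rcases le_or_gt ‖T ω‖ r with h | h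
    · have h0 : ω ∉ {ω | r < ‖T ω‖} := not_lt.2 h
      have := abs_truncate_sub_le (by linarith) h i
      rw [abs_sub_comm] at this
      simpa [h0] using this
    · have h0 : ω ∈ {ω | r < ‖T ω‖} := h
      have := abs_apply_le_norm (T ω) i
      have h2 : 0 ≤ 1 / r ^ 2 := by positivity
      rw [truncate_of_lt_norm h]
      simp only [PiLp.zero_apply, sub_zero, Pi.add_apply, Set.indicator_of_mem h0, mul_one,
        Real.norm_eq_abs]
      linarith
  · simp only [Pi.add_apply]
    rw [integral_add (integrable_const _) hint, integral_const, probReal_univ, one_smul]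
    have := integral_norm_indicator_le hT hC0 hC hA
    linarith

/-- Chebyshev's inequality with the second moment restricted to the tail, which vanishes by
dominated convergence. The bare inequality would give only boundedness. -/
theorem tendsto_sq_mul_tail (hT : Measurable T) (hT2 : MemLp T 2 μ) :
    Tendsto (fun k : ℕ => ((k : ℝ) + 1) ^ 2 * μ.real {ω | (k : ℝ) + 1 < ‖T ω‖}) atTop (𝓝 0) := by
  have hlim : Tendsto (fun k : ℕ => ∫ ω, {ω | (k : ℝ) + 1 < ‖T ω‖}.indicator
      (fun ω => ‖T ω‖ ^ 2) ω ∂μ) atTop (𝓝 (∫ _, (0 : ℝ) ∂μ)) := by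
    refine tendsto_integral_of_dominated_convergence (fun ω => ‖T ω‖ ^ 2) (fun k => ?_)
      (integrable_norm_sq hT2) (fun k => .of_forall fun ω => ?_) (.of_forall fun ω => ?_)
    · exact ((hT.norm.pow_const 2).indicator (measurableSet_tail hT _)).aestronglyMeasurable
    · rw [Real.norm_of_nonneg (Set.indicator_nonneg (fun _ _ => sq_nonneg _) _)]
      exact Set.indicator_le_self' (fun _ _ => sq_nonneg _) ω
    · refine tendsto_const_nhds.congr' ?_
      filter_upwards [(tendsto_natCast_atTop_atTop (R := ℝ)).eventually (eventually_ge_atTop ‖T ω‖)]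
        with k hk
      rw [Set.indicator_of_notMem]
      simp only [Set.mem_ofPred_eq, not_lt]
      linarith
  rw [integral_zero] at hlim
  refine squeeze_zero (fun k => by positivity) (fun k => ?_) hlim
  have hA := measurableSet_tail hT ((k : ℝ) + 1)
  have e : ((k : ℝ) + 1) ^ 2 * μ.real {ω | (k : ℝ) + 1 < ‖T ω‖} =
      ∫ ω, {ω | (k : ℝ) + 1 < ‖T ω‖}.indicator (fun _ => ((k : ℝ) + 1) ^ 2) ω ∂μ := by
    rw [integral_indicator_const _ hA, smul_eq_mul, mul_comm]
  rw [e]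
  refine integral_mono ((integrable_const _).indicator hA) ((integrable_norm_sq hT2).indicator hA)
    fun ω => Set.indicator_le_indicator' fun hω => ?_
  have hω' : (k : ℝ) + 1 < ‖T ω‖ := hω
  have : (0 : ℝ) ≤ (k : ℝ) + 1 := by positivity
  gcongr

theorem tendsto_integral_truncate (hT : Measurable T) (hT2 : MemLp T 2 μ) (i : Fin m) :
    Tendsto (fun k : ℕ => ∫ ω, truncate ((k : ℝ) + 1) (T ω) i ∂μ) atTop (𝓝 (∫ ω, T ω i ∂μ)) := by
  refine tendsto_integral_of_dominated_convergence (fun ω => |T ω i| + 1)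
    (fun k => (integrable_truncate hT (by simp) i).1)
    ((integrable_apply hT2 i).abs.add (integrable_const 1))
    (fun k => .of_forall fun ω => abs_truncate_le (by simp) _ i)
    (.of_forall fun ω => tendsto_truncate _ i)

theorem tendsto_integral_truncate_mul (hT : Measurable T) (hT2 : MemLp T 2 μ) (i j : Fin m) :
    Tendsto (fun k : ℕ => ∫ ω, truncate ((k : ℝ) + 1) (T ω) i * truncate ((k : ℝ) + 1) (T ω) j ∂μ)
      atTop (𝓝 (∫ ω, T ω i * T ω j ∂μ)) := by
  have hL : ∀ i, MemLp (fun ω => |T ω i| + 1) 2 μ := fun i =>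
    (memLp_apply hT2 i).abs.add (memLp_const 1)
  refine tendsto_integral_of_dominated_convergence (fun ω => (|T ω i| + 1) * (|T ω j| + 1))
    (fun k => (integrable_truncate hT (by simp) i).1.mul (integrable_truncate hT (by simp) j).1)
    ((hL i).integrable_mul (hL j))
    (fun k => .of_forall fun ω => ?_)
    (.of_forall fun ω => (tendsto_truncate _ i).mul (tendsto_truncate _ j))
  rw [norm_mul]
  exact mul_le_mul (abs_truncate_le (by simp) _ i) (abs_truncate_le (by simp) _ j) (norm_nonneg _)
    (by positivity)

end Moments

/-! ### Approximation of estimators by finite schemes -/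

section Expansion

variable {L : Type u} [NormedAddCommGroup L] [InnerProductSpace ℂ L] [CompleteSpace L]

/-- The error depends on `φ` only through `c`. Hence one expansion of the states holds uniformly for
all truncations and all tail events. -/
theorem abs_expansion_le {X Y σ₁ σ₂ : TC L} {t q c : ℝ} (hq : 0 ≤ q) (hc : 0 ≤ c)
    (h : traceNorm ((X - Y - (t : ℂ) • σ₁ - ((t ^ 2 : ℝ) : ℂ) • σ₂ : TC L) : L →L[ℂ] L) ≤
      ENNReal.ofReal q) {φ : TC L →ₗ[ℝ] ℝ}
    (hφ : ∀ Z : TC L, |φ Z| ≤ 2 * c * (traceNorm (Z : L →L[ℂ] L)).toReal) :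
    |φ X - φ Y - t * φ σ₁ - t ^ 2 * φ σ₂| ≤ 2 * c * q := by
  have h1 := hφ (X - Y - (t : ℂ) • σ₁ - ((t ^ 2 : ℝ) : ℂ) • σ₂)
  have e : ∀ (r : ℝ) (Z : TC L), φ ((r : ℂ) • Z) = r * φ Z := fun r Z => φ.map_smul r Z
  rw [map_sub, map_sub, map_sub, e, e] at h1
  exact h1.trans (mul_le_mul_of_nonneg_left (ENNReal.toReal_le_of_le_ofReal hq h) (by positivity))

end Expansion

section Approximation

variable {H H' : Type u}
  [NormedAddCommGroup H] [InnerProductSpace ℂ H] [CompleteSpace H]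
  [NormedAddCommGroup H'] [InnerProductSpace ℂ H'] [CompleteSpace H']
  {m : ℕ} {Λ : EuclideanSpace ℝ (Fin m) → (TC H →ₗ[ℂ] TC H')}
  {Θ : Set (EuclideanSpace ℝ (Fin m))} {a₁ : ℝ}

end Approximation

/-! ### Convergence of the derivatives of truncated means along a curve of states. -/

section TruncatedDerivative

variable {L : Type u} [NormedAddCommGroup L] [InnerProductSpace ℂ L] [CompleteSpace L]

theorem hasDerivAt_of_abs_sub_le {g : ℝ → ℝ} {d K : ℝ}
    (h : ∀ᶠ t in 𝓝 (0 : ℝ), |g t - g 0 - t * d| ≤ K * t ^ 2) : HasDerivAt g d 0 := by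
  rw [hasDerivAt_iff_isLittleO]
  have h1 : (fun t : ℝ => g t - g 0 - (t - 0) • d) =O[𝓝 0] fun t : ℝ => t ^ 2 :=
    Asymptotics.IsBigO.of_bound K (by
      filter_upwards [h] with t ht
      simpa using ht)
  refine h1.trans_isLittleO ?_
  simpa using Asymptotics.isLittleO_pow_id (𝕜 := ℝ) one_lt_two

theorem POVM.isProbabilityMeasure_law {l : ℕ} (M : POVM l L) {X : TC L}
    (hX : (X : L →L[ℂ] L).IsPositive) (hX1 : traceNorm (X : L →L[ℂ] L) = 1) :
    IsProbabilityMeasure (M.law X) := ⟨by rw [M.law_univ hX, hX1]⟩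

/-- The derivatives of the expectations of the truncations of `T` converge to the derivative of the
expectation of `T`, along a curve of states with a second order expansion, if the second moment of
`T` is locally bounded. -/
theorem exists_tendsto_deriv_truncate {X : ℝ → TC L}
    (hX : ∀ᶠ t in 𝓝 (0 : ℝ), (X t : L →L[ℂ] L).IsPositive ∧ traceNorm (X t : L →L[ℂ] L) = 1)
    {σ₁ σ₂ : TC L} (hexp : ∀ ε > 0, ∀ᶠ t : ℝ in 𝓝 0,
      traceNorm ((X t - X 0 - (t : ℂ) • σ₁ - ((t ^ 2 : ℝ) : ℂ) • σ₂ : TC L) : L →L[ℂ] L) ≤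
        ENNReal.ofReal (ε * t ^ 2))
    {l m : ℕ} (M : POVM l L) {T : EuclideanSpace ℝ (Fin l) → EuclideanSpace ℝ (Fin m)}
    (hT : Measurable T) {C : ℝ} (hC0 : 0 ≤ C)
    (hC : ∀ᶠ t in 𝓝 (0 : ℝ), ∫⁻ ω, ‖T ω‖ₑ ^ 2 ∂(M.law (X t)) ≤ ENNReal.ofReal C) (i : Fin m) {d : ℝ}
    (hd : HasDerivAt (fun t => ∫ ω, T ω i ∂(M.law (X t))) d 0) :
    ∃ d' : ℕ → ℝ,
      (∀ k : ℕ, HasDerivAt (fun t => ∫ ω, truncate ((k : ℝ) + 1) (T ω) i ∂(M.law (X t))) (d' k) 0) ∧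
      Tendsto d' atTop (𝓝 d) := by
  have hφ : ∀ k : ℕ, ∃ φ : TC L →ₗ[ℝ] ℝ,
      (∀ X : TC L, (X : L →L[ℂ] L).IsPositive →
        φ X = ∫ ω, truncate ((k : ℝ) + 1) (T ω) i ∂(M.law X)) ∧
      ∀ Y : TC L, |φ Y| ≤ 2 * ((k : ℝ) + 2) * (traceNorm (Y : L →L[ℂ] L)).toReal := fun k => by
    refine M.exists_functional ((EuclideanSpace.proj (𝕜 := ℝ) i).continuous.measurable.comp
      ((measurable_truncate _).comp hT)) ?_ fun ω => ?_
    · refine ((finite_range_truncate (m := m) (r := (k : ℝ) + 1) (by simp)).image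
        fun v => v i).subset ?_
      rintro _ ⟨ω, rfl⟩
      exact ⟨_, Set.mem_range_self (T ω), rfl⟩
    · exact (abs_truncate_le_add_one (by simp) _ _).trans (by linarith)
  choose φ hφ hφb using hφ
  let A : ℕ → Set (EuclideanSpace ℝ (Fin l)) := fun k => {ω | (k : ℝ) + 1 < ‖T ω‖}
  have hA : ∀ k, MeasurableSet (A k) := fun k => measurableSet_tail hT _
  let ψ : ℕ → TC L →ₗ[ℝ] ℝ := fun k => Complex.reLm.comp
    (((trL L).comp (TC.mulLeft (M.effect (A k)))).restrictScalars ℝ)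
  have hψ : ∀ k Y, ψ k Y = (trace ((M.effect (A k)).comp (Y : L →L[ℂ] L))).re := fun k Y => rfl
  have hψb : ∀ k (Y : TC L), |ψ k Y| ≤ 2 * 1 * (traceNorm (Y : L →L[ℂ] L)).toReal := fun k Y => by
    rw [mul_one]; exact M.abs_re_trace_effect_le (hA k) Y
  have hψ' : ∀ k (Y : TC L), (Y : L →L[ℂ] L).IsPositive → ψ k Y = (M.law Y).real (A k) :=
    fun k Y hY => (M.real_law hY (hA k)).symm
  set s := (traceNorm (σ₂ : L →L[ℂ] L)).toReal with hs
  have hs0 : 0 ≤ s := ENNReal.toReal_nonneg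
  have hX0 := hX.self_of_nhds
  -- The truncation is bounded by `k + 2`, so `φ k` has norm at most `2 (k + 2)`; the factor `s + 1`
  -- collects the coefficient `σ₂` and the remainder with `ε = 1`.
  have hquad : ∀ᶠ t in 𝓝 (0 : ℝ), ∀ k : ℕ, |φ k (X t) - φ k (X 0) - t * φ k σ₁| ≤
      2 * (s + 1) * ((k : ℝ) + 2) * t ^ 2 := by
    filter_upwards [hexp 1 one_pos] with t ht k
    have h1 := abs_expansion_le (by positivity) (by positivity) ht (hφb k)
    have h2 := mul_le_mul_of_nonneg_left (hφb k σ₂) (sq_nonneg t)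
    have h3 : |t ^ 2 * φ k σ₂| = t ^ 2 * |φ k σ₂| := by rw [abs_mul, abs_of_nonneg (sq_nonneg t)]
    have h4 := abs_add_le (φ k (X t) - φ k (X 0) - t * φ k σ₁ - t ^ 2 * φ k σ₂) (t ^ 2 * φ k σ₂)
    rw [sub_add_cancel] at h4
    rw [← hs] at h2
    linarith
  have heq : ∀ k : ℕ, (fun t => ∫ ω, truncate ((k : ℝ) + 1) (T ω) i ∂(M.law (X t))) =ᶠ[𝓝 0]
      fun t => φ k (X t) := fun k => by
    filter_upwards [hX] with t ht
    exact (hφ k _ ht.1).symm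
  refine ⟨fun k => φ k σ₁, fun k => ?_, ?_⟩
  · exact (hasDerivAt_of_abs_sub_le (g := fun t => φ k (X t)) (hquad.mono fun t ht => ht k)
      ).congr_of_eventuallyEq (heq k)
  · have := M.isProbabilityMeasure_law hX0.1 hX0.2
    refine tendsto_deriv_of_truncation hd (g := fun k t => φ k (X t)) (p := fun k t => ψ k (X t))
      (κ := fun k => ψ k σ₂) (K := 2 * (s + 1)) (C := C) (by positivity) ?_ hquad ?_ ?_ ?_ ?_
    · filter_upwards [hX, hC] with t ht htC k
      have := M.isProbabilityMeasure_law ht.1 ht.2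
      rw [hφ k _ ht.1, hψ' k _ ht.1]
      exact abs_integral_sub_truncate_le hT hC0 htC (by simp) i
    · intro ε hε
      -- Summing the expansions at `t` and `-t` cancels the term with `σ₁`. Each remainder is `2 ·
      -- (ε / 4) t²`, together `ε t²`.
      have hneg : Tendsto (fun t : ℝ => -t) (𝓝 0) (𝓝 0) := by
        simpa using (continuous_neg (G := ℝ)).tendsto 0
      filter_upwards [hexp (ε / 4) (by positivity), hneg.eventually (hexp (ε / 4) (by positivity))]
        with t h1 h2 k
      have a1 := (abs_le.1 (abs_expansion_le (by positivity) zero_le_one h1 (hψb k))).2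
      have a2 := (abs_le.1 (abs_expansion_le (by positivity) zero_le_one h2 (hψb k))).2
      rw [neg_sq] at a2
      linarith
    · filter_upwards [hX] with t ht k
      rw [hψ' k _ ht.1]
      exact measureReal_nonneg
    · simp_rw [hψ' _ _ hX0.1]
      exact tendsto_sq_mul_tail hT (memLp_two_of_lintegral hT hC.self_of_nhds)
    · refine M.tendsto_re_trace_effect σ₂ hA (fun a b hab ω hω => ?_) ?_
      · have : ((b : ℝ) + 1) < ‖T ω‖ := hω
        have hab' : (a : ℝ) ≤ b := by exact_mod_cast hab
        exact lt_of_le_of_lt (by linarith) this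
      · refine Set.eq_empty_of_forall_notMem fun ω hω => ?_
        obtain ⟨k, hk⟩ := exists_nat_ge ‖T ω‖
        have : (k : ℝ) + 1 < ‖T ω‖ := Set.mem_iInter.1 hω k
        linarith

end TruncatedDerivative

section Approximation

variable {H H' : Type u}
  [NormedAddCommGroup H] [InnerProductSpace ℂ H] [CompleteSpace H]
  [NormedAddCommGroup H'] [InnerProductSpace ℂ H'] [CompleteSpace H']
  {m : ℕ} {Λ : EuclideanSpace ℝ (Fin m) → (TC H →ₗ[ℂ] TC H')}
  {Θ : Set (EuclideanSpace ℝ (Fin m))} {a₁ : ℝ}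

/-- A matrix of derivatives at `θ` and the covariance matrix of a finite scheme. -/
structure FiniteScheme.Moments (S : FiniteScheme H H' m)
    (Λ : EuclideanSpace ℝ (Fin m) → (TC H →ₗ[ℂ] TC H')) (n : ℕ) (θ : EuclideanSpace ℝ (Fin m))
    (B V : Matrix (Fin m) (Fin m) ℝ) : Prop where
  hasDerivAt : ∀ i j, HasDerivAt
    (fun t : ℝ => S.expect (Λ (θ + t • EuclideanSpace.single j 1)) n fun x => x i) (B i j) 0
  cov : ∀ i j, V i j = S.expect (Λ θ) n (fun x => x i * x j) -
    S.expect (Λ θ) n (fun x => x i) * S.expect (Λ θ) n fun x => x j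

/-- An estimator with locally bounded second moments is approximated by finite schemes, together with
the derivatives of its expectation and its covariance. -/
theorem Estimator.exists_approx (hΘ : IsOpen Θ) (hΛ : ∀ θ ∈ Θ, IsCPTP (Λ θ))
    (hreg : RegularFamily Θ a₁ Λ) {θ : EuclideanSpace ℝ (Fin m)} (hθ : θ ∈ Θ)
    (E : Estimator H H' m) {n : ℕ} (hE : E.MeanDifferentiable Λ n θ) {C : ℝ} (hC0 : 0 ≤ C)
    (hC : ∀ᶠ θ' in 𝓝 θ, ∫⁻ ω, ‖E.T ω‖ₑ ^ 2 ∂(E.P (Λ θ') n) ≤ ENNReal.ofReal C) :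
    ∃ (S : ℕ → FiniteScheme H H' m) (B V : ℕ → Matrix (Fin m) (Fin m) ℝ),
      (∀ k, (S k).Moments Λ n θ (B k) (V k)) ∧
      Tendsto B atTop (𝓝 (E.B Λ n θ)) ∧ Tendsto V atTop (𝓝 (E.V (Λ θ) n)) := by
  have hfin : ∀ k : ℕ, (Set.range fun ω => truncate ((k : ℝ) + 1) (E.T ω)).Finite := fun k =>
    (finite_range_truncate (r := (k : ℝ) + 1) (by simp)).subset (by
      rintro _ ⟨ω, rfl⟩; exact Set.mem_range_self _)
  choose S hS using fun k : ℕ =>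
    FiniteScheme.exists_of_estimator E ((measurable_truncate _).comp E.measurable_T) (hfin k)
  have hcurve : ∀ j : Fin m, Tendsto (fun t : ℝ => θ + t • EuclideanSpace.single j (1 : ℝ)) (𝓝 0)
      (𝓝 θ) := fun j => by
    have h : ContinuousAt (fun t : ℝ => θ + t • EuclideanSpace.single j (1 : ℝ)) 0 := by fun_prop
    simpa [ContinuousAt] using h
  have hder : ∀ i j, ∃ d' : ℕ → ℝ, (∀ k : ℕ, HasDerivAt (fun t : ℝ => ∫ ω,
      truncate ((k : ℝ) + 1) (E.T ω) i ∂(E.P (Λ (θ + t • EuclideanSpace.single j 1)) n)) (d' k) 0) ∧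
      Tendsto d' atTop (𝓝 (E.B Λ n θ i j)) := by
    intro i j
    obtain ⟨σ₁, σ₂, hexp⟩ := E.output_taylor hΘ hΛ hreg hθ j n
    refine exists_tendsto_deriv_truncate
      (X := fun t => E.output (Λ (θ + t • EuclideanSpace.single j 1)) n) ?_ (σ₁ := σ₁) (σ₂ := σ₂)
      ?_ E.M E.measurable_T hC0 ((hcurve j).eventually hC) i (hE i j).hasDerivAt
    · filter_upwards [eventually_add_smul_mem hΘ hθ (EuclideanSpace.single j 1)] with t ht
      exact E.run_spec (hΛ _ ht) _
    · simpa using hexp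
  choose D hD hDB using hder
  refine ⟨S, fun k => Matrix.of fun i j => D i j k, fun k => Matrix.of fun i j =>
    (S k).expect (Λ θ) n (fun x => x i * x j) -
      (S k).expect (Λ θ) n (fun x => x i) * (S k).expect (Λ θ) n fun x => x j,
    fun k => ⟨fun i j => ?_, fun i j => rfl⟩, ?_, ?_⟩
  · refine (hD i j k).congr_of_eventuallyEq ?_
    filter_upwards [eventually_add_smul_mem hΘ hθ (EuclideanSpace.single j 1)] with t ht
    exact hS k _ n (hΛ _ ht) _
  · exact tendsto_pi_nhds.2 fun i => tendsto_pi_nhds.2 fun j => hDB i j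
  · have := E.isProbabilityMeasure_P (hΛ θ hθ) n
    have hT2 := memLp_two_of_lintegral E.measurable_T hC.self_of_nhds
    refine tendsto_pi_nhds.2 fun i => tendsto_pi_nhds.2 fun j => ?_
    have e : E.V (Λ θ) n i j = ∫ ω, E.T ω i * E.T ω j ∂(E.P (Λ θ) n) -
        (∫ ω, E.T ω i ∂(E.P (Λ θ) n)) * ∫ ω, E.T ω j ∂(E.P (Λ θ) n) :=
      ProbabilityTheory.covariance_eq_sub (memLp_apply hT2 i) (memLp_apply hT2 j)
    rw [e]
    simp only [Matrix.of_apply, hS _ _ n (hΛ θ hθ)]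
    exact (tendsto_integral_truncate_mul E.measurable_T hT2 i j).sub
      ((tendsto_integral_truncate E.measurable_T hT2 i).mul
        (tendsto_integral_truncate E.measurable_T hT2 j))

end Approximation

/-! ### Operations on finite schemes -/

section Schemes

variable {H H' : Type u}
  [NormedAddCommGroup H] [InnerProductSpace ℂ H] [CompleteSpace H]
  [NormedAddCommGroup H'] [InnerProductSpace ℂ H'] [CompleteSpace H']
  {m : ℕ} {Λ : EuclideanSpace ℝ (Fin m) → (TC H →ₗ[ℂ] TC H')}
  {Θ : Set (EuclideanSpace ℝ (Fin m))} {a₁ : ℝ} {θ : EuclideanSpace ℝ (Fin m)}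
  {n k : ℕ} {B V B' V' C : Matrix (Fin m) (Fin m) ℝ}

namespace FiniteScheme

variable (S : FiniteScheme H H' m) {Φ : TC H →ₗ[ℂ] TC H'}

theorem expect_sum {ι : Type*} (s : Finset ι) (c : ι → ℝ)
    (g : ι → EuclideanSpace ℝ (Fin m) → ℝ) :
    S.expect Φ n (fun x => ∑ k ∈ s, c k * g k x) = ∑ k ∈ s, c k * S.expect Φ n (g k) := by
  simp only [expect, Finset.mul_sum]
  rw [Finset.sum_comm]
  exact Finset.sum_congr rfl fun _ _ => Finset.sum_congr rfl fun _ _ => by ring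

/-- The scheme with the estimate `C x` in place of `x`. -/
def mapLinear (C : Matrix (Fin m) (Fin m) ℝ) : FiniteScheme H H' m :=
  { S with x := fun a => WithLp.toLp 2 fun i => ∑ k, C i k * S.x a k }

theorem expect_mapLinear (C : Matrix (Fin m) (Fin m) ℝ) (g : EuclideanSpace ℝ (Fin m) → ℝ) :
    (S.mapLinear C).expect Φ n g =
      S.expect Φ n fun x => g (WithLp.toLp 2 fun i => ∑ k, C i k * x k) := rfl

/-- A linear map of the estimate acts linearly on the mean and its derivatives and bilinearly on the
second moments. -/
theorem Moments.mapLinear {S : FiniteScheme H H' m} (h : S.Moments Λ n θ B V)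
    (C : Matrix (Fin m) (Fin m) ℝ) :
    (S.mapLinear C).Moments Λ n θ (C * B) (C * V * C.transpose) := by
  have h1 : ∀ (Φ : TC H →ₗ[ℂ] TC H') i, (S.mapLinear C).expect Φ n (fun x => x i) =
      ∑ k, C i k * S.expect Φ n fun x => x k := fun Φ i => by
    rw [expect_mapLinear]
    exact S.expect_sum Finset.univ (fun k => C i k) fun k (x : EuclideanSpace ℝ (Fin m)) => x k
  have h2 : ∀ (Φ : TC H →ₗ[ℂ] TC H') i j, (S.mapLinear C).expect Φ n (fun x => x i * x j) =
      ∑ p : Fin m × Fin m, (C i p.1 * C j p.2) * S.expect Φ n fun x => x p.1 * x p.2 :=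
    fun Φ i j => by
    rw [expect_mapLinear, ← expect_sum]
    congr 1
    funext x
    rw [Fintype.sum_mul_sum, Fintype.sum_prod_type]
    exact Finset.sum_congr rfl fun _ _ => Finset.sum_congr rfl fun _ _ => by ring
  refine ⟨fun i j => ?_, fun i j => ?_⟩
  · simp only [h1, Matrix.mul_apply]
    exact HasDerivAt.fun_sum fun k _ => (h.hasDerivAt k j).const_mul _
  · rw [h1, h1, h2, Fintype.sum_mul_sum, Fintype.sum_prod_type, ← Finset.sum_sub_distrib]
    simp only [← Finset.sum_sub_distrib, Matrix.mul_apply, Matrix.transpose_apply, Finset.sum_mul]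
    rw [Finset.sum_comm]
    refine Finset.sum_congr rfl fun k _ => Finset.sum_congr rfl fun l _ => ?_
    rw [h.cov]
    ring

/-- The scheme with the estimate shifted by `c`. -/
def shift (c : EuclideanSpace ℝ (Fin m)) : FiniteScheme H H' m :=
  { S with x := fun a => S.x a + c }

theorem expect_shift (hΦ : IsCPTP Φ) (c : EuclideanSpace ℝ (Fin m)) (i : Fin m) :
    (S.shift c).expect Φ n (fun x => x i) = S.expect Φ n (fun x => x i) + c i := by
  have h : (S.shift c).expect Φ n (fun x => x i) = ∑ a, S.prob Φ n a * (S.x a i + c i) := rfl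
  rw [h]
  simp only [mul_add, Finset.sum_add_distrib, ← Finset.sum_mul, S.sum_prob hΦ, one_mul]
  rfl

theorem expect_shift_centered (hΦ : IsCPTP Φ) (c d : EuclideanSpace ℝ (Fin m)) (i j : Fin m)
    (hi : d i = S.expect Φ n (fun x => x i) + c i) (hj : d j = S.expect Φ n (fun x => x j) + c j) :
    (S.shift c).expect Φ n (fun x => (x i - d i) * (x j - d j)) =
      S.expect Φ n (fun x => x i * x j) -
        S.expect Φ n (fun x => x i) * S.expect Φ n fun x => x j := by
  have h : (S.shift c).expect Φ n (fun x => (x i - d i) * (x j - d j)) =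
      ∑ a, S.prob Φ n a * ((S.x a i + c i - d i) * (S.x a j + c j - d j)) := rfl
  rw [h, hi, hj]
  set μi := S.expect Φ n fun x => x i with hμi
  set μj := S.expect Φ n fun x => x j with hμj
  have e : ∀ a, S.prob Φ n a * ((S.x a i + c i - (μi + c i)) * (S.x a j + c j - (μj + c j))) =
      S.prob Φ n a * (S.x a i * S.x a j) - S.prob Φ n a * S.x a i * μj -
        S.prob Φ n a * S.x a j * μi + S.prob Φ n a * (μi * μj) := fun a => by ring
  simp only [e, Finset.sum_add_distrib, Finset.sum_sub_distrib, ← Finset.sum_mul, S.sum_prob hΦ]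
  have ei : ∑ a, S.prob Φ n a * S.x a i = μi := rfl
  have ej : ∑ a, S.prob Φ n a * S.x a j = μj := rfl
  have eij : ∑ a, S.prob Φ n a * (S.x a i * S.x a j) = S.expect Φ n fun x => x i * x j := rfl
  rw [ei, ej, eij]
  ring

end FiniteScheme

/-! ### Algebra of attainable pairs of derivatives and covariance. -/

/-- Some finite scheme has the derivatives `B` at `θ` and the covariance matrix `V`. -/
def Achieves (Λ : EuclideanSpace ℝ (Fin m) → (TC H →ₗ[ℂ] TC H')) (n : ℕ)
    (θ : EuclideanSpace ℝ (Fin m)) (B V : Matrix (Fin m) (Fin m) ℝ) : Prop :=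
  ∃ S : FiniteScheme H H' m, S.Moments Λ n θ B V

theorem Achieves.conj (h : Achieves Λ n θ B V) (C : Matrix (Fin m) (Fin m) ℝ) :
    Achieves Λ n θ (C * B) (C * V * C.transpose) :=
  let ⟨S, hS⟩ := h
  ⟨S.mapLinear C, hS.mapLinear C⟩

/-- In the composed scheme the two outcomes are independent, so the means and the covariances of the
summed estimates add. -/
theorem Achieves.add (hΘ : IsOpen Θ) (hΛ : ∀ θ ∈ Θ, IsCPTP (Λ θ)) (hθ : θ ∈ Θ)
    (hn : 1 ≤ n) (hk : 1 ≤ k) (h : Achieves Λ n θ B V) (h' : Achieves Λ k θ B' V') :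
    Achieves Λ (n + k) θ (B + B') (V + V') := by
  obtain ⟨S₁, h₁⟩ := h
  obtain ⟨S₂, h₂⟩ := h'
  obtain ⟨S, hS⟩ := S₁.exists_compose S₂ hn hk fun a b => S₁.x a + S₂.x b
  have e1 : ∀ {Φ : TC H →ₗ[ℂ] TC H'}, IsCPTP Φ → ∀ i, S.expect Φ (n + k) (fun x => x i) =
      S₁.expect Φ n (fun x => x i) + S₂.expect Φ k fun x => x i := by
    intro Φ hΦ i
    have s1 : ∀ a, ∑ b, S₁.prob Φ n a * S₂.prob Φ k b * (S₁.x a i + S₂.x b i) =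
        S₁.prob Φ n a * S₁.x a i + S₁.prob Φ n a * S₂.expect Φ k fun x => x i := fun a => by
      simp only [mul_add, Finset.sum_add_distrib, mul_assoc, ← Finset.mul_sum, ← Finset.sum_mul,
        S₂.sum_prob hΦ, one_mul]
      rfl
    rw [hS Φ hΦ]
    refine (Finset.sum_congr rfl fun a _ => s1 a).trans ?_
    rw [Finset.sum_add_distrib, ← Finset.sum_mul, S₁.sum_prob hΦ, one_mul]
    rfl
  have e2 : ∀ i j, S.expect (Λ θ) (n + k) (fun x => x i * x j) =
      S₁.expect (Λ θ) n (fun x => x i * x j) +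
      S₁.expect (Λ θ) n (fun x => x i) * S₂.expect (Λ θ) k (fun x => x j) +
      S₁.expect (Λ θ) n (fun x => x j) * S₂.expect (Λ θ) k (fun x => x i) +
      S₂.expect (Λ θ) k fun x => x i * x j := by
    intro i j
    have hΦ := hΛ θ hθ
    have s1 : ∀ a, ∑ b, S₁.prob (Λ θ) n a * S₂.prob (Λ θ) k b *
        ((S₁.x a i + S₂.x b i) * (S₁.x a j + S₂.x b j)) =
        S₁.prob (Λ θ) n a * (S₁.x a i * S₁.x a j) +
        S₁.prob (Λ θ) n a * S₁.x a i * S₂.expect (Λ θ) k (fun x => x j) +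
        S₁.prob (Λ θ) n a * S₁.x a j * S₂.expect (Λ θ) k (fun x => x i) +
        S₁.prob (Λ θ) n a * S₂.expect (Λ θ) k fun x => x i * x j := fun a => by
      have : S₁.prob (Λ θ) n a * (S₁.x a i * S₁.x a j) =
          S₁.prob (Λ θ) n a * (S₁.x a i * S₁.x a j) * ∑ b, S₂.prob (Λ θ) k b := by
        rw [S₂.sum_prob hΦ, mul_one]
      rw [this]
      simp only [FiniteScheme.expect, Finset.mul_sum, ← Finset.sum_add_distrib]
      exact Finset.sum_congr rfl fun b _ => by ring
    rw [hS _ hΦ]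
    refine (Finset.sum_congr rfl fun a _ => s1 a).trans ?_
    simp only [Finset.sum_add_distrib, ← Finset.sum_mul, S₁.sum_prob hΦ, one_mul]
    rfl
  refine ⟨S, fun i j => ?_, fun i j => ?_⟩
  · refine ((h₁.hasDerivAt i j).add (h₂.hasDerivAt i j)).congr_of_eventuallyEq ?_
    filter_upwards [eventually_add_smul_mem hΘ hθ (EuclideanSpace.single j 1)] with t ht
    exact e1 (hΛ _ ht) i
  · rw [e1 (hΛ θ hθ), e1 (hΛ θ hθ), e2, Matrix.add_apply, h₁.cov, h₂.cov]
    ring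

theorem Achieves.add_uses (hΘ : IsOpen Θ) (hΛ : ∀ θ ∈ Θ, IsCPTP (Λ θ)) (hθ : θ ∈ Θ)
    (hn : 1 ≤ n) (h : Achieves Λ n θ B V) (k : ℕ) : Achieves Λ (n + k) θ B V := by
  rcases Nat.eq_zero_or_pos k with rfl | hk
  · exact h
  obtain ⟨S₁, h₁⟩ := h
  -- Surplus uses are spent on a second run whose outcome is ignored.
  obtain ⟨S, hS⟩ := S₁.exists_compose S₁ hn hk fun a _ => S₁.x a
  have e : ∀ {Φ : TC H →ₗ[ℂ] TC H'}, IsCPTP Φ → ∀ g, S.expect Φ (n + k) g = S₁.expect Φ n g := by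
    intro Φ hΦ g
    rw [hS Φ hΦ]
    refine Finset.sum_congr rfl fun a _ => ?_
    rw [← Finset.sum_mul, ← Finset.mul_sum, S₁.sum_prob hΦ, mul_one]
  refine ⟨S, fun i j => ?_, fun i j => ?_⟩
  · refine (h₁.hasDerivAt i j).congr_of_eventuallyEq ?_
    filter_upwards [eventually_add_smul_mem hΘ hθ (EuclideanSpace.single j 1)] with t ht
    exact e (hΛ _ ht) _
  · simp only [e (hΛ θ hθ), h₁.cov]

theorem Achieves.smul (h : Achieves Λ n θ B V) (r : ℝ) : Achieves Λ n θ (r • B) (r ^ 2 • V) := by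
  have := h.conj (r • 1)
  simpa [smul_smul, sq] using this

/-- Averaging over independent repetitions. -/
theorem Achieves.repeat (hΘ : IsOpen Θ) (hΛ : ∀ θ ∈ Θ, IsCPTP (Λ θ)) (hθ : θ ∈ Θ)
    (hn : 1 ≤ n) (h : Achieves Λ n θ B V) (hk : 1 ≤ k) :
    Achieves Λ (k * n) θ B ((k : ℝ)⁻¹ • V) := by
  induction k, hk using Nat.le_induction with
  | base => simpa using h
  | succ k hk ih =>
    have hk0 : (k : ℝ) ≠ 0 := by positivity
    have hk1 : (k : ℝ) + 1 ≠ 0 := by positivity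
    -- Update of a running mean: weight `k / (k + 1)` for the old average, `1 / (k + 1)` for the new
    -- estimate.
    have h1 := (ih.smul ((k : ℝ) / (k + 1))).add hΘ hΛ hθ (Nat.mul_pos hk hn) hn
      (h.smul (1 / ((k : ℝ) + 1)))
    rw [← add_smul, smul_smul, ← add_smul] at h1
    have e1 : (k : ℝ) / (k + 1) + 1 / (k + 1) = 1 := by field_simp
    have e2 : ((k : ℝ) / (k + 1)) ^ 2 * (k : ℝ)⁻¹ + (1 / ((k : ℝ) + 1)) ^ 2 =
        ((k + 1 : ℕ) : ℝ)⁻¹ := by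
      push_cast
      field_simp
    rw [e1, e2, one_smul] at h1
    rwa [Nat.succ_mul]

/-- With derivatives already equal to `1`, a constant shift corrects the mean at `θ`. Finitely many
outcomes give a bounded estimator with the same covariance. -/
theorem Achieves.localBound_le (hΘ : IsOpen Θ) (hΛ : ∀ θ ∈ Θ, IsCPTP (Λ θ)) (hθ : θ ∈ Θ)
    (h : Achieves Λ n θ 1 V) (G : Matrix (Fin m) (Fin m) ℝ) :
    localBound Λ G θ n ≤ ENNReal.ofReal (n * (G * V).trace) := by
  obtain ⟨S, hS⟩ := h
  let c : EuclideanSpace ℝ (Fin m) := WithLp.toLp 2 fun i => θ i - S.expect (Λ θ) n fun x => x i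
  have hc : ∀ i, c i = θ i - S.expect (Λ θ) n fun x => x i := fun i => rfl
  obtain ⟨E, hE, hEx⟩ := (S.shift c).exists_estimator
  have hmean : ∀ θ' ∈ Θ, ∀ i, E.mean (Λ θ') n i = S.expect (Λ θ') n (fun x => x i) + c i :=
    fun θ' hθ' i => (hEx _ n (hΛ θ' hθ') fun x => x i).trans (S.expect_shift (hΛ θ' hθ') c i)
  have hmθ : ∀ i, E.mean (Λ θ) n i = θ i := fun i => by rw [hmean θ hθ, hc]; ring
  have hder : ∀ i j, HasDerivAt
      (fun t : ℝ => E.mean (Λ (θ + t • EuclideanSpace.single j 1)) n i)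
      ((1 : Matrix (Fin m) (Fin m) ℝ) i j) 0 := fun i j => by
    refine ((hS.hasDerivAt i j).add_const (c i)).congr_of_eventuallyEq ?_
    filter_upwards [eventually_add_smul_mem hΘ hθ (EuclideanSpace.single j 1)] with t ht
    exact hmean _ ht i
  have hV : E.V (Λ θ) n = V := by
    ext i j
    have h1 : E.V (Λ θ) n i j = ∫ ω, (E.T ω i - θ i) * (E.T ω j - θ j) ∂(E.P (Λ θ) n) := by
      simp only [Estimator.V, Matrix.of_apply, hmθ]
    rw [h1, hS.cov, hEx _ n (hΛ θ hθ) fun x => (x i - θ i) * (x j - θ j)]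
    exact S.expect_shift_centered (hΛ θ hθ) c θ i j (by rw [hc]; ring) (by rw [hc]; ring)
  refine iInf_le_of_le E (iInf_le_of_le ⟨fun i j => (hder i j).differentiableAt, hmθ, ?_⟩
    (iInf_le_of_le hE ?_))
  · ext i j
    exact (hder i j).deriv
  · rw [hV]

end Schemes

/-! ### The limit of the local bounds -/

section Limit

variable {m : ℕ}

theorem tendsto_matrix_inv {B : ℕ → Matrix (Fin m) (Fin m) ℝ} {B₀ : Matrix (Fin m) (Fin m) ℝ}
    (hB : Tendsto B atTop (𝓝 B₀)) (h0 : B₀.det ≠ 0) :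
    (∀ᶠ k in atTop, (B k).det ≠ 0) ∧ Tendsto (fun k => (B k)⁻¹) atTop (𝓝 B₀⁻¹) := by
  have hdet : Tendsto (fun k => (B k).det) atTop (𝓝 B₀.det) :=
    (continuous_id.matrix_det.tendsto B₀).comp hB
  refine ⟨hdet.eventually_ne h0, ?_⟩
  simp only [Matrix.inv_def, Ring.inverse_eq_inv']
  exact (hdet.inv₀ h0).smul ((continuous_id.matrix_adjugate.tendsto B₀).comp hB)

theorem tendsto_trace_mul (G : Matrix (Fin m) (Fin m) ℝ) {V : ℕ → Matrix (Fin m) (Fin m) ℝ}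
    {V₀ : Matrix (Fin m) (Fin m) ℝ} (hV : Tendsto V atTop (𝓝 V₀)) :
    Tendsto (fun k => (G * V k).trace) atTop (𝓝 (G * V₀).trace) :=
  ((continuous_const.matrix_mul continuous_id).matrix_trace.tendsto V₀).comp hV

theorem tendsto_conj {A : ℕ → Matrix (Fin m) (Fin m) ℝ} {A₀ : Matrix (Fin m) (Fin m) ℝ}
    (hA : Tendsto A atTop (𝓝 A₀)) {V : ℕ → Matrix (Fin m) (Fin m) ℝ}
    {V₀ : Matrix (Fin m) (Fin m) ℝ} (hV : Tendsto V atTop (𝓝 V₀)) :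
    Tendsto (fun k => A k * V k * (A k).transpose) atTop (𝓝 (A₀ * V₀ * A₀.transpose)) :=
  (hA.mul hV).mul ((continuous_id.matrix_transpose.tendsto A₀).comp hA)

variable {H H' : Type u}
  [NormedAddCommGroup H] [InnerProductSpace ℂ H] [CompleteSpace H]
  [NormedAddCommGroup H'] [InnerProductSpace ℂ H'] [CompleteSpace H']
  {Λ : EuclideanSpace ℝ (Fin m) → (TC H →ₗ[ℂ] TC H')}
  {Θ : Set (EuclideanSpace ℝ (Fin m))} {a₁ : ℝ} {θ : EuclideanSpace ℝ (Fin m)}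
  {n k : ℕ}

/-- Normalization of the derivatives. -/
theorem exists_normalized {B V : ℕ → Matrix (Fin m) (Fin m) ℝ}
    {B₀ V₀ : Matrix (Fin m) (Fin m) ℝ} (h : ∀ k, Achieves Λ n θ (B k) (V k))
    (hB : Tendsto B atTop (𝓝 B₀)) (hV : Tendsto V atTop (𝓝 V₀)) (h0 : B₀.det ≠ 0) :
    ∃ W : ℕ → Matrix (Fin m) (Fin m) ℝ, (∀ᶠ k in atTop, Achieves Λ n θ 1 (W k)) ∧
      Tendsto W atTop (𝓝 (B₀⁻¹ * V₀ * B₀⁻¹.transpose)) := by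
  obtain ⟨hdet, hinv⟩ := tendsto_matrix_inv hB h0
  refine ⟨fun k => (B k)⁻¹ * V k * (B k)⁻¹.transpose, ?_, tendsto_conj hinv hV⟩
  filter_upwards [hdet] with k hk
  have := (h k).conj (B k)⁻¹
  rwa [Matrix.nonsing_inv_mul _ (isUnit_iff_ne_zero.2 hk)] at this

variable (Λ θ) in
/-- The infimum of `n Tr G V` over the covariances of finite schemes with derivatives `1`. -/
def schemeBound (G : Matrix (Fin m) (Fin m) ℝ) : ℝ≥0∞ :=
  ⨅ (n : ℕ) (_ : 1 ≤ n) (V : Matrix (Fin m) (Fin m) ℝ) (_ : Achieves Λ n θ 1 V),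
    ENNReal.ofReal (n * (G * V).trace)

theorem schemeBound_le (hn : 1 ≤ n) {V : Matrix (Fin m) (Fin m) ℝ} (h : Achieves Λ n θ 1 V)
    (G : Matrix (Fin m) (Fin m) ℝ) : schemeBound Λ θ G ≤ ENNReal.ofReal (n * (G * V).trace) :=
  iInf_le_of_le n <| iInf_le_of_le hn <| iInf_le_of_le V <| iInf_le_of_le h le_rfl

/-- A bounded estimate has bounded second moments, so finite schemes approximate it together with
its derivatives. The latter converge to `1`, so multiplication by their inverses costs nothing in
the limit. -/
theorem schemeBound_le_localBound (hΘ : IsOpen Θ) (hΛ : ∀ θ ∈ Θ, IsCPTP (Λ θ))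
    (hreg : RegularFamily Θ a₁ Λ) (hθ : θ ∈ Θ) (hn : 1 ≤ n) (G : Matrix (Fin m) (Fin m) ℝ) :
    schemeBound Λ θ G ≤ localBound Λ G θ n := by
  refine le_iInf fun E => le_iInf fun hE => le_iInf fun hb => ?_
  obtain ⟨R, hR⟩ := hb.exists_norm_le
  have hR' : ∀ ω, ‖E.T ω‖ ≤ R := fun ω => hR _ (Set.mem_range_self ω)
  have hC : ∀ᶠ θ' in 𝓝 θ, ∫⁻ ω, ‖E.T ω‖ₑ ^ 2 ∂(E.P (Λ θ') n) ≤ ENNReal.ofReal (R ^ 2) := by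
    filter_upwards [hΘ.mem_nhds hθ] with θ' hθ'
    have := E.isProbabilityMeasure_P (hΛ θ' hθ') n
    refine (lintegral_mono fun ω => ?_).trans (lintegral_const _).le |>.trans (by
      rw [measure_univ, mul_one])
    rw [← ofReal_norm, ← ENNReal.ofReal_pow (norm_nonneg _)]
    exact ENNReal.ofReal_le_ofReal (pow_le_pow_left₀ (norm_nonneg _) (hR' ω) 2)
  obtain ⟨S, B, V, hS, hB, hV⟩ := E.exists_approx hΘ hΛ hreg hθ hE.differentiable (sq_nonneg R) hC
  rw [hE.B_eq] at hB
  obtain ⟨W, hW, hWlim⟩ := exists_normalized (fun k => ⟨S k, hS k⟩) hB hV (by simp)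
  rw [inv_one, Matrix.transpose_one, one_mul, mul_one] at hWlim
  refine ge_of_tendsto (ENNReal.tendsto_ofReal ((tendsto_trace_mul G hWlim).const_mul (n : ℝ))) ?_
  filter_upwards [hW] with k hk
  exact schemeBound_le hn hk G

theorem tendsto_div_div (n₀ : ℕ) (hn₀ : 1 ≤ n₀) :
    Tendsto (fun n : ℕ => (n : ℝ) / ((n / n₀ : ℕ) : ℝ)) atTop (𝓝 (n₀ : ℝ)) := by
  have hq : Tendsto (fun n : ℕ => ((n / n₀ : ℕ) : ℝ)) atTop atTop :=
    tendsto_natCast_atTop_atTop.comp (Nat.tendsto_div_const_atTop (by omega))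
  have hlim : Tendsto (fun n : ℕ => (n₀ : ℝ) + n₀ / ((n / n₀ : ℕ) : ℝ)) atTop (𝓝 ((n₀ : ℝ) + 0)) :=
    tendsto_const_nhds.add (hq.const_div_atTop _)
  rw [add_zero] at hlim
  refine tendsto_of_tendsto_of_tendsto_of_le_of_le' tendsto_const_nhds hlim ?_ ?_
  · filter_upwards [hq.eventually (eventually_gt_atTop 0)] with n hn
    rw [le_div_iff₀ hn]
    exact_mod_cast Nat.mul_div_le n n₀
  · filter_upwards [hq.eventually (eventually_gt_atTop 0)] with n hn
    rw [div_le_iff₀ hn, add_mul, div_mul_cancel₀ _ hn.ne']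
    have := Nat.lt_mul_div_succ n (show 0 < n₀ by omega)
    have h2 : (n : ℝ) ≤ ((n₀ * (n / n₀ + 1) : ℕ) : ℝ) := by exact_mod_cast this.le
    push_cast at h2
    linarith

/-- A near-optimal scheme with `n₀` uses is repeated `⌊n / n₀⌋` times and the remaining uses are
wasted. The value becomes `n / ⌊n / n₀⌋ · Tr G V`, which tends to `n₀ Tr G V`. -/
theorem limsup_localBound_le (hΘ : IsOpen Θ) (hΛ : ∀ θ ∈ Θ, IsCPTP (Λ θ)) (hθ : θ ∈ Θ)
    (G : Matrix (Fin m) (Fin m) ℝ) :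
    limsup (fun n => localBound Λ G θ n) atTop ≤ schemeBound Λ θ G := by
  refine le_iInf fun n₀ => le_iInf fun hn₀ => le_iInf fun V => le_iInf fun h => ?_
  have hlim : Tendsto (fun n : ℕ => ENNReal.ofReal ((n : ℝ) / ((n / n₀ : ℕ) : ℝ) * (G * V).trace))
      atTop (𝓝 (ENNReal.ofReal (n₀ * (G * V).trace))) :=
    ENNReal.tendsto_ofReal ((tendsto_div_div n₀ hn₀).mul_const _)
  rw [← hlim.limsup_eq]
  refine limsup_le_limsup ?_
  filter_upwards [eventually_ge_atTop n₀] with n hn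
  have hq : 1 ≤ n / n₀ := Nat.div_pos hn hn₀
  have h1 := (h.repeat hΘ hΛ hθ hn₀ hq).add_uses hΘ hΛ hθ (Nat.mul_pos hq hn₀) (n % n₀)
  rw [mul_comm, Nat.div_add_mod] at h1
  refine (h1.localBound_le hΘ hΛ hθ G).trans (le_of_eq ?_)
  rw [Matrix.mul_smul, Matrix.trace_smul, smul_eq_mul, ← mul_assoc, div_eq_mul_inv]

theorem tendsto_localBound (hΘ : IsOpen Θ) (hΛ : ∀ θ ∈ Θ, IsCPTP (Λ θ))
    (hreg : RegularFamily Θ a₁ Λ) (hθ : θ ∈ Θ) (G : Matrix (Fin m) (Fin m) ℝ) :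
    Tendsto (fun n => localBound Λ G θ n) atTop (𝓝 (schemeBound Λ θ G)) := by
  refine tendsto_of_le_liminf_of_limsup_le ?_ (limsup_localBound_le hΘ hΛ hθ G)
  refine le_liminf_of_le (by isBoundedDefault) ?_
  filter_upwards [eventually_ge_atTop 1] with n hn
  exact schemeBound_le_localBound hΘ hΛ hreg hθ hn G

/-! ### The asymptotic bound -/

/-- The condition bounds `T` around the true parameter `θ'`. Near `θ` one has `‖θ'‖ < ‖θ‖ + 1`, and
`‖x + y‖² ≤ 2 ‖x‖² + 2 ‖y‖²` removes the centering. -/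
theorem Estimator.lintegral_sq_le (hΘ : IsOpen Θ) (hΛ : ∀ θ ∈ Θ, IsCPTP (Λ θ)) (hθ : θ ∈ Θ)
    (E : Estimator H H' m) (hE : E.IntegrabilityCondition Θ a₁ Λ n) :
    ∃ C : ℝ, 0 ≤ C ∧
      ∀ᶠ θ' in 𝓝 θ, ∫⁻ ω, ‖E.T ω‖ₑ ^ 2 ∂(E.P (Λ θ') n) ≤ ENNReal.ofReal C := by
  obtain ⟨a₄, -, sq, -, h⟩ := hE
  refine ⟨2 * (n * a₄ ^ 2) + 2 * (‖θ‖ + 1) ^ 2, by positivity, ?_⟩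
  have hnorm : ∀ᶠ θ' in 𝓝 θ, ‖θ'‖ < ‖θ‖ + 1 :=
    continuous_norm.continuousAt.eventually (gt_mem_nhds (by linarith))
  filter_upwards [hΘ.mem_nhds hθ, hnorm] with θ' hθ' hn
  have := E.isProbabilityMeasure_P (hΛ θ' hθ') n
  have h1 : ∀ ω, ‖E.T ω‖ₑ ^ 2 ≤ 2 * ‖E.T ω - θ'‖ₑ ^ 2 + ENNReal.ofReal (2 * (‖θ‖ + 1) ^ 2) := by
    intro ω
    have h2 : ∀ x : ℝ, 2 * ENNReal.ofReal x = ENNReal.ofReal (2 * x) := fun x => by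
      rw [ENNReal.ofReal_mul zero_le_two, ENNReal.ofReal_ofNat]
    rw [← ofReal_norm, ← ofReal_norm, ← ENNReal.ofReal_pow (norm_nonneg _),
      ← ENNReal.ofReal_pow (norm_nonneg _), h2,
      ← ENNReal.ofReal_add (by positivity) (by positivity)]
    refine ENNReal.ofReal_le_ofReal ?_
    have h3 := norm_add_le (E.T ω - θ') θ'
    rw [sub_add_cancel] at h3
    have h4 : ‖E.T ω‖ ≤ ‖E.T ω - θ'‖ + (‖θ‖ + 1) := by linarith
    have h5 := pow_le_pow_left₀ (norm_nonneg _) h4 2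
    nlinarith [sq_nonneg (‖E.T ω - θ'‖ - (‖θ‖ + 1))]
  calc ∫⁻ ω, ‖E.T ω‖ₑ ^ 2 ∂(E.P (Λ θ') n)
      ≤ ∫⁻ ω, (2 * ‖E.T ω - θ'‖ₑ ^ 2 + ENNReal.ofReal (2 * (‖θ‖ + 1) ^ 2)) ∂(E.P (Λ θ') n) :=
        lintegral_mono h1
    _ = 2 * ∫⁻ ω, ‖E.T ω - θ'‖ₑ ^ 2 ∂(E.P (Λ θ') n) + ENNReal.ofReal (2 * (‖θ‖ + 1) ^ 2) := by
        rw [lintegral_add_right _ measurable_const,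
          lintegral_const_mul _ ((E.measurable_T.sub_const θ').enorm.pow_const 2),
          lintegral_const, measure_univ, mul_one]
    _ ≤ 2 * ENNReal.ofReal (n * a₄ ^ 2) + ENNReal.ofReal (2 * (‖θ‖ + 1) ^ 2) := by
        gcongr
        exact (h θ' hθ').2
    _ = ENNReal.ofReal (2 * (n * a₄ ^ 2) + 2 * (‖θ‖ + 1) ^ 2) := by
        rw [ENNReal.ofReal_add (by positivity) (by positivity),
          ENNReal.ofReal_mul (p := 2) zero_le_two]
        simp

/-- The mean square error is the covariance plus the rank one matrix `b bᵀ` of the bias, and `Tr (G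
b bᵀ) = bᵀ G b ≥ 0`. -/
theorem Estimator.trace_V_le_trace_MSE (hΛ : IsCPTP (Λ θ)) (E : Estimator H H' m)
    (hT : MemLp E.T 2 (E.P (Λ θ) n)) {G : Matrix (Fin m) (Fin m) ℝ} (hG : G.PosSemidef) :
    (G * E.V (Λ θ) n).trace ≤ (G * E.MSE (Λ θ) n θ).trace := by
  have := E.isProbabilityMeasure_P hΛ n
  set b : Fin m → ℝ := fun i => E.mean (Λ θ) n i - θ i with hb
  have e : E.MSE (Λ θ) n θ = E.V (Λ θ) n + Matrix.vecMulVec b b := by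
    ext i j
    have hV : E.V (Λ θ) n i j = ∫ ω, E.T ω i * E.T ω j ∂(E.P (Λ θ) n) -
        E.mean (Λ θ) n i * E.mean (Λ θ) n j :=
      ProbabilityTheory.covariance_eq_sub (memLp_apply hT i) (memLp_apply hT j)
    have hM : E.MSE (Λ θ) n θ i j = ∫ ω, E.T ω i * E.T ω j ∂(E.P (Λ θ) n) -
        E.mean (Λ θ) n i * θ j - θ i * E.mean (Λ θ) n j + θ i * θ j := by
      have h1 : ∀ ω, (E.T ω i - θ i) * (E.T ω j - θ j) =
          E.T ω i * E.T ω j - E.T ω i * θ j - θ i * E.T ω j + θ i * θ j := fun ω => by ring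
      have i1 := integrable_apply_mul hT i j
      have i2 := (integrable_apply hT i).mul_const (θ j)
      have i3 := (integrable_apply hT j).const_mul (θ i)
      have s1 := integral_add ((i1.sub i2).sub i3)
        (integrable_const (μ := E.P (Λ θ) n) (θ i * θ j))
      have s2 := integral_sub (i1.sub i2) i3
      have s3 := integral_sub i1 i2
      simp only [Pi.sub_apply] at s1 s2 s3
      simp only [Estimator.MSE, Matrix.of_apply, h1, Estimator.mean]
      rw [s1, s2, s3, integral_mul_const, integral_const_mul, integral_const, probReal_univ,
        one_smul]
    rw [hM, Matrix.add_apply, hV, Matrix.vecMulVec_apply, hb]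
    ring
  have hpos := hG.dotProduct_mulVec_nonneg b
  rw [star_trivial] at hpos
  rw [e, mul_add, Matrix.trace_add, Matrix.mul_vecMulVec, Matrix.trace_vecMulVec, dotProduct_comm]
  linarith

/-- Correction of the derivatives of a scheme by repetitions of another one. -/
theorem Achieves.correct (hΘ : IsOpen Θ) (hΛ : ∀ θ ∈ Θ, IsCPTP (Λ θ)) (hθ : θ ∈ Θ)
    {n₀ : ℕ} (hn₀ : 1 ≤ n₀) {V₀ : Matrix (Fin m) (Fin m) ℝ} (h₀ : Achieves Λ n₀ θ 1 V₀)
    (hn : 1 ≤ n) (hk : 1 ≤ k) {B V : Matrix (Fin m) (Fin m) ℝ} (h : Achieves Λ n θ B V) :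
    Achieves Λ (n + k * n₀) θ 1 (V + (k : ℝ)⁻¹ • ((1 - B) * V₀ * (1 - B).transpose)) := by
  have h1 := h.add hΘ hΛ hθ hn (Nat.mul_pos hk hn₀) ((h₀.repeat hΘ hΛ hθ hn₀ hk).conj (1 - B))
  rwa [mul_one, add_sub_cancel, Matrix.mul_smul, Matrix.smul_mul] at h1

/-- The correction is made on finite approximants of `E`, and the bound passes to the limit by
continuity of the trace expressions. -/
theorem Estimator.schemeBound_le (hΘ : IsOpen Θ) (hΛ : ∀ θ ∈ Θ, IsCPTP (Λ θ))
    (hreg : RegularFamily Θ a₁ Λ) (hθ : θ ∈ Θ) {n₀ : ℕ} (hn₀ : 1 ≤ n₀)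
    {V₀ : Matrix (Fin m) (Fin m) ℝ} (h₀ : Achieves Λ n₀ θ 1 V₀)
    (E : Estimator H H' m) (hn : 1 ≤ n) (hk : 1 ≤ k) (hE : E.MeanDifferentiable Λ n θ)
    (hCE : E.IntegrabilityCondition Θ a₁ Λ n) (G : Matrix (Fin m) (Fin m) ℝ) :
    schemeBound Λ θ G ≤ ENNReal.ofReal (((n + k * n₀ : ℕ) : ℝ) * ((G * E.V (Λ θ) n).trace +
      (k : ℝ)⁻¹ * (G * ((1 - E.B Λ n θ) * V₀ * (1 - E.B Λ n θ).transpose)).trace)) := by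
  obtain ⟨C, hC0, hC⟩ := E.lintegral_sq_le hΘ hΛ hθ hCE
  obtain ⟨S, B, V, hS, hB, hV⟩ := E.exists_approx hΘ hΛ hreg hθ hE hC0 hC
  have hB' : Tendsto (fun j => 1 - B j) atTop (𝓝 (1 - E.B Λ n θ)) := tendsto_const_nhds.sub hB
  have hlim := ((tendsto_trace_mul G hV).add ((tendsto_trace_mul G
    (tendsto_conj hB' (tendsto_const_nhds (x := V₀)))).const_mul (k : ℝ)⁻¹)).const_mul
      ((n + k * n₀ : ℕ) : ℝ)
  refine ge_of_tendsto (ENNReal.tendsto_ofReal hlim) (.of_forall fun j => ?_)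
  have h1 := QOpEstimation.schemeBound_le (by omega)
    (Achieves.correct hΘ hΛ hθ hn₀ h₀ hn hk ⟨S j, hS j⟩) G
  rwa [mul_add, Matrix.mul_smul, Matrix.trace_add, Matrix.trace_smul, smul_eq_mul] at h1

/-- Since `B_n → 1`, some `B_n` is invertible; a finite approximant then has invertible derivatives
and can be normalized. Its variance is irrelevant, because it is used only to correct a vanishing
defect. -/
theorem exists_achieves_one (hΘ : IsOpen Θ) (hΛ : ∀ θ ∈ Θ, IsCPTP (Λ θ))
    (hreg : RegularFamily Θ a₁ Λ) (hθ : θ ∈ Θ) {E : ℕ → Estimator H H' m}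
    (hE : AsymptoticallyUnbiased Θ Λ E)
    (hCE : ∀ n, 1 ≤ n → (E n).IntegrabilityCondition Θ a₁ Λ n) :
    ∃ n, 1 ≤ n ∧ ∃ V, Achieves Λ n θ 1 V := by
  have hB : Tendsto (fun n => (E n).B Λ n θ) atTop (𝓝 1) :=
    tendsto_pi_nhds.2 fun i => tendsto_pi_nhds.2 fun j => hE.tendsto_B θ hθ i j
  obtain ⟨n, hdet, hn⟩ :=
    ((tendsto_matrix_inv hB (by simp)).1.and (eventually_ge_atTop 1)).exists
  obtain ⟨C, hC0, hC⟩ := (E n).lintegral_sq_le hΘ hΛ hθ (hCE n hn)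
  obtain ⟨S, B, V, hS, hB, hV⟩ :=
    (E n).exists_approx hΘ hΛ hreg hθ (hE.differentiable n hn θ hθ) hC0 hC
  obtain ⟨W, hW, -⟩ := exists_normalized (fun k => ⟨S k, hS k⟩) hB hV hdet
  obtain ⟨j, hj⟩ := hW.exists
  exact ⟨n, hn, W j, hj⟩

theorem schemeBound_le_limsup (hΘ : IsOpen Θ) (hΛ : ∀ θ ∈ Θ, IsCPTP (Λ θ))
    (hreg : RegularFamily Θ a₁ Λ) (hθ : θ ∈ Θ) {G : Matrix (Fin m) (Fin m) ℝ} (hG : G.PosSemidef)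
    {E : ℕ → Estimator H H' m} (hE : AsymptoticallyUnbiased Θ Λ E)
    (hCE : ∀ n, 1 ≤ n → (E n).IntegrabilityCondition Θ a₁ Λ n) :
    schemeBound Λ θ G ≤
      limsup (fun n : ℕ => ENNReal.ofReal (n * (G * (E n).MSE (Λ θ) n θ).trace)) atTop := by
  obtain ⟨n₀, hn₀, V₀, h₀⟩ := exists_achieves_one hΘ hΛ hreg hθ hE hCE
  refine le_of_forall_gt_imp_ge_of_dense fun c hc => ?_
  rcases eq_or_ne c ⊤ with rfl | hctop
  · exact le_top
  have hcr : c = ENNReal.ofReal c.toReal := (ENNReal.ofReal_toReal hctop).symm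
  set s := c.toReal with hs
  have hs0 : 0 ≤ s := ENNReal.toReal_nonneg
  -- `c` exceeds the limsup, so eventually `n Tr G MSE ≤ s`, and the covariance is no larger.
  have hev : ∀ᶠ n : ℕ in atTop, n * (G * (E n).V (Λ θ) n).trace ≤ s := by
    filter_upwards [eventually_lt_of_limsup_lt hc, eventually_ge_atTop 1] with n hn hn1
    obtain ⟨C, hC0, hC⟩ := (E n).lintegral_sq_le hΘ hΛ hθ (hCE n hn1)
    have := (E n).isProbabilityMeasure_P (hΛ θ hθ) n
    have h1 := (E n).trace_V_le_trace_MSE (hΛ θ hθ)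
      (memLp_two_of_lintegral (E n).measurable_T hC.self_of_nhds) hG
    rw [hcr] at hn
    have h2 := (ENNReal.ofReal_le_ofReal_iff hs0).1 hn.le
    exact (mul_le_mul_of_nonneg_left h1 (Nat.cast_nonneg n)).trans h2
  have hB : Tendsto (fun n => 1 - (E n).B Λ n θ) atTop (𝓝 0) := by
    have : Tendsto (fun n => (E n).B Λ n θ) atTop (𝓝 1) :=
      tendsto_pi_nhds.2 fun i => tendsto_pi_nhds.2 fun j => hE.tendsto_B θ hθ i j
    simpa using (tendsto_const_nhds (x := (1 : Matrix (Fin m) (Fin m) ℝ))).sub this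
  set q : ℕ → ℝ := fun n =>
    (G * ((1 - (E n).B Λ n θ) * V₀ * (1 - (E n).B Λ n θ).transpose)).trace with hq
  have hqlim : Tendsto (fun n => |q n|) atTop (𝓝 0) := by
    have := (tendsto_trace_mul G (tendsto_conj hB (tendsto_const_nhds (x := V₀)))).abs
    rwa [zero_mul, zero_mul, mul_zero, Matrix.trace_zero, abs_zero] at this
  -- For fixed `ε` the limit `n → ∞` removes the cost `ε⁻¹ |q n|` of the defective derivatives; only
  -- the fraction `ε n₀` of additional uses remains.
  have main : ∀ ε > 0, schemeBound Λ θ G ≤ ENNReal.ofReal ((1 + ε * n₀) * s) := by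
    intro ε hε
    have hinv : Tendsto (fun n : ℕ => (n₀ : ℝ) / (n : ℝ)) atTop (𝓝 0) :=
      tendsto_natCast_atTop_atTop.const_div_atTop _
    have hlim : Tendsto (fun n : ℕ => (1 + ε * n₀ + n₀ / (n : ℝ)) * (s + ε⁻¹ * |q n|)) atTop
        (𝓝 ((1 + ε * n₀ + 0) * (s + ε⁻¹ * 0))) :=
      (tendsto_const_nhds.add hinv).mul (tendsto_const_nhds.add (hqlim.const_mul _))
    rw [add_zero, mul_zero, add_zero] at hlim
    refine ge_of_tendsto (ENNReal.tendsto_ofReal hlim) ?_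
    filter_upwards [hev, eventually_ge_atTop 1] with n hn hn1
    have hn0 : (0 : ℝ) < n := by exact_mod_cast hn1
    have hεn : 0 < ε * n := by positivity
    -- `k = ⌈ε n⌉` repetitions: at least `ε n`, to suppress the added variance, and at most `ε n +
    -- 1`, the excess being the source of the term `n₀ / n`.
    have hk : 1 ≤ ⌈ε * n⌉₊ := Nat.one_le_ceil_iff.2 hεn
    refine ((E n).schemeBound_le hΘ hΛ hreg hθ hn₀ h₀ hn1 hk (hE.differentiable n hn1 θ hθ)
      (hCE n hn1) G).trans (ENNReal.ofReal_le_ofReal ?_)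
    have hk1 : ε * n ≤ (⌈ε * n⌉₊ : ℝ) := Nat.le_ceil _
    have hk2 : (⌈ε * n⌉₊ : ℝ) ≤ ε * n + 1 := (Nat.ceil_lt_add_one hεn.le).le
    have b1 : ((n + ⌈ε * n⌉₊ * n₀ : ℕ) : ℝ) ≤ (1 + ε * n₀ + n₀ / (n : ℝ)) * n := by
      have e : (1 + ε * n₀ + n₀ / (n : ℝ)) * n = n + (ε * n + 1) * n₀ := by
        field_simp
        ring
      rw [e]
      push_cast
      gcongr
    -- The absolute value makes the factor `|q n|` nonnegative whatever the sign of `q n`, as needed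
    -- when `k⁻¹` is replaced by the larger `(ε n)⁻¹`.
    have b2 : (⌈ε * n⌉₊ : ℝ)⁻¹ * q n ≤ (ε * n)⁻¹ * |q n| :=
      (mul_le_mul_of_nonneg_left (le_abs_self _) (by positivity)).trans
        (mul_le_mul_of_nonneg_right (inv_anti₀ hεn hk1) (abs_nonneg _))
    have b3 : (n : ℝ) * ((G * (E n).V (Λ θ) n).trace + (ε * n)⁻¹ * |q n|) ≤ s + ε⁻¹ * |q n| := by
      have e : (n : ℝ) * ((ε * n)⁻¹ * |q n|) = ε⁻¹ * |q n| := by field_simp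
      rw [mul_add, e]
      linarith
    have b4 : (G * (E n).V (Λ θ) n).trace + (⌈ε * n⌉₊ : ℝ)⁻¹ * q n ≤
        (s + ε⁻¹ * |q n|) / n := by
      rw [le_div_iff₀ hn0, mul_comm]
      refine le_trans ?_ b3
      gcongr
    have b5 : 0 ≤ (s + ε⁻¹ * |q n|) / n := by positivity
    calc _ ≤ ((n + ⌈ε * n⌉₊ * n₀ : ℕ) : ℝ) * ((s + ε⁻¹ * |q n|) / n) :=
          mul_le_mul_of_nonneg_left b4 (Nat.cast_nonneg _)
      _ ≤ (1 + ε * n₀ + n₀ / (n : ℝ)) * n * ((s + ε⁻¹ * |q n|) / n) :=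
          mul_le_mul_of_nonneg_right b1 b5
      _ = _ := by field_simp
  rw [hcr]
  have hlim : Tendsto (fun ε : ℝ => ENNReal.ofReal ((1 + ε * n₀) * s)) (𝓝[>] 0)
      (𝓝 (ENNReal.ofReal s)) := by
    have h1 : Tendsto (fun ε : ℝ => (1 + ε * n₀) * s) (𝓝[>] 0) (𝓝 ((1 + 0 * n₀) * s)) :=
      (Continuous.tendsto (by fun_prop) 0).mono_left nhdsWithin_le_nhds
    rw [zero_mul, add_zero, one_mul] at h1
    exact ENNReal.tendsto_ofReal h1
  exact ge_of_tendsto hlim (by filter_upwards [self_mem_nhdsWithin] with ε hε using main ε hε)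

end Limit

end QOpEstimation

end

theorem mainTheorem5 {H H' : Type u}
    [NormedAddCommGroup H] [InnerProductSpace ℂ H] [CompleteSpace H]
    [TopologicalSpace.SeparableSpace H]
    [NormedAddCommGroup H'] [InnerProductSpace ℂ H'] [CompleteSpace H']
    [TopologicalSpace.SeparableSpace H']
    {m : ℕ} (Θ : Set (EuclideanSpace ℝ (Fin m))) (hΘ : IsOpen Θ)
    (Λ : EuclideanSpace ℝ (Fin m) →
      (QOpEstimation.TC H →ₗ[ℂ] QOpEstimation.TC H'))
    (hΛ : ∀ θ ∈ Θ, QOpEstimation.IsCPTP (Λ θ))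
    (a₁ : ℝ) (hreg : QOpEstimation.RegularFamily Θ a₁ Λ)
    (θ : EuclideanSpace ℝ (Fin m)) (hθ : θ ∈ Θ)
    (G : Matrix (Fin m) (Fin m) ℝ) (hG : G.PosSemidef) :
    ∃ L : ℝ≥0∞,
      Tendsto (fun n : ℕ => QOpEstimation.localBound Λ G θ n) atTop (𝓝 L) ∧
      L ≤ QOpEstimation.CQOp Θ a₁ Λ G θ :=
  ⟨QOpEstimation.schemeBound Λ θ G, QOpEstimation.tendsto_localBound hΘ hΛ hreg hθ G,
    le_iInf fun _ => le_iInf fun hE => le_iInf fun hCE =>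
      QOpEstimation.schemeBound_le_limsup hΘ hΛ hreg hθ hG hE hCE⟩
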